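/- Let $q=2^f>2$ and let $S=\mathrm{PSp}_4(q)$ be the projective symplectic group of dimension $4$ over the field with $q$ elements. For a positive integer $n$, let $m_n(S)$ denote the number of elements of order $n$ in $S$, let $\varphi$ be Euler's totient function, and let $\psi(n)=n\prod_{p\mid n}\left(1+\frac1p\right)$ (product over the prime divisors $p$ of $n$) be the Dedekind function. Then, for positive integers $r$ and $s$: 1. $m_2(S)=(q^2+1)(q^4-1)$; 2. $m_4(S)=q^2(q^2-1)(q^4-1)$; 3. $m_r(S)=\varphi(r)\,q^3(q^2+1)(q+1)\left(1-\frac{q(q+1)}{2}+\frac{q(q+1)}{8}\psi(r)\right)$ if $1\neq r\mid q-1$; 4. $m_r(S)=\varphi(r)\,q^3(q^2+1)(q-1)\left(1-\frac{q(q-1)}{2}+\frac{q(q-1)}{8}\psi(r)\right)$ if $1\neq r\mid q+1$; 5. $m_{2r}(S)=\varphi(r)\,q^3(q+1)(q^4-1)$ if $1\neq r\mid q-1$; 6. $m_{2r}(S)=\varphi(r)\,q^3(q-1)(q^4-1)$ if $1\neq r\mid q+1$; 7. $m_{rs}(S)=\frac12\varphi(rs)\,q^4(q^4-1)$ if $1\neq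 r\mid q-1$ and $1\neq s\mid q+1$; 8. $m_r(S)=\frac14\varphi(r)\,q^4(q^2-1)^2$ if $1\neq r\mid q^2+1$. -/

import Mathlib

/-- The projective symplectic group `PSp_{2n}(R)` (with `n = |l|`): the symplectic group modulo
its center. -/
abbrev ProjectiveSymplecticGroup (l : Type*) [DecidableEq l] [Fintype l]
    (R : Type*) [CommRing R] : Type _ :=
  Matrix.symplecticGroup l R ⧸ Subgroup.center (Matrix.symplecticGroup l R)

/-- The group `PSp_4(F)`. -/
abbrev PSp4 (F : Type*) [Field F] : Type _ := ProjectiveSymplecticGroup (Fin 2) F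

/-- The number `m_n(G)` of elements of order `n` in the (finite) group `G`. -/
noncomputable def numElementsOfOrder (G : Type*) [Group G] (n : ℕ) : ℕ :=
  Nat.card {g : G // orderOf g = n}

/-- The Dedekind arithmetic function `ψ(n) = n ∏_{p ∣ n} (1 + 1/p)`. -/
def dedekindPsi (n : ℕ) : ℚ :=
  n * ∏ p ∈ n.primeFactors, (1 + 1 / (p : ℚ))

/-!
In characteristic two the center of `Sp₄(q)` is trivial, since a central element commutes with all
transvections (`center_symplecticGroup_eq_bot`). So the problem is to count elements of given order
in `Sp₄(q)`, which is done class by class.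

**Class sizes without centralizers in `Sp₄(q)`.** Fix a `4 × 4` matrix `C` and count the pairs
`(g, P)` with `g` symplectic, `P` invertible and `g P = P C`. Forgetting `P` gives the number of
symplectic `g` that are conjugate to `C` in `GL₄(q)` times the order of the centralizer of `C` in
`GL₄(q)`. The map `(g, P) ↦ Pᵀ J P` takes values in the invertible alternating forms that are
invariant under `C`; it is onto, because all such forms are equivalent, and its fibres are cosets of
`Sp₄(q)`. This is `card_symplecticSimilar_mul`. Both other factors are elementary: a centralizer in
`GL₄` and the number of solutions of a linear system with non-zero Pfaffian. For `C = 1` the identity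
yields the order of `Sp₄(q)` itself.

**Regular elements.** The characteristic polynomial of a symplectic matrix is
`X⁴ + tX³ + sX² + tX + 1`. If it equals the minimal polynomial, a cyclic vector makes the matrix
conjugate to the companion matrix; the centralizer is then the unit group of `F[X]/(p)`, and the
invariant forms are the pairs at which the quadratic form `v² + tuv + su²` does not vanish
(`card_minpoly_eq_palindromicQuartic_mul`). This includes the elements of order four, whose minimal
polynomial is `(X + 1)⁴`: the minimal polynomial `(X + 1)³` does not occur
(`sq_eq_one_of_add_one_pow_three_eq_zero`).

**Other elements.** Involutions are transvections or have two Jordan blocks of size two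
(`card_involutions`). The semisimple elements that are not regular satisfy `g² + yg + 1 = 0`, or
`(g + 1)(g² + yg + 1) = 0` with trace `y`; either condition describes one class
(`card_quadratic_split_mul`, `card_quadratic_nonsplit_mul`, `card_trace_eq_mul`).

**Orders.** Over an algebraic closure the eigenvalues are `a, a⁻¹, b, b⁻¹`. When these are distinct
the order of the element is `lcm(|a|, |b|)`, and the element determines `(a, b)` up to eight choices,
so elements of given order are counted by counting pairs `(a, b)` (`card_orderOf_generic_mul`).
Frobenius fixes or exchanges `a + a⁻¹` and `b + b⁻¹`:

* for orders dividing `q² + 1` they are exchanged and `b = a^q` up to inversion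
  (`card_orderOf_eq_of_dvd_sq_add_one`);
* for orders `rs` with `r ∣ q - 1` and `s ∣ q + 1` they are fixed, and `(|a|, |b|)` is `(r, s)` or
  `(s, r)`, or they are exchanged, and `b = a^q` up to inversion with `|a| = rs`; both types of
  classes have the same size (`card_orderOf_eq_of_dvd_sub_one_of_dvd_add_one`);
* for orders `r ∣ q ∓ 1` all pairs with `lcm(|a|, |b|) = r` occur. There are `φ(r) ψ(r)` of them,
  because `φ ψ` is Jordan's totient function of order two (`card_lcm_orderOf_eq`), which is where
  the Dedekind function comes from. Of these, `4 φ(r)` are degenerate, with `a = 1`, `b = 1` or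
  `b = a^{±1}`; they belong to the two kinds of semisimple elements that are not regular
  (`card_orderOf_eq_of_isSplittingSign`). The regular elements with the same degenerate eigenvalues
  are the elements of order `2r` (`card_orderOf_eq_two_mul_of_isSplittingSign`).

The cases `q - 1` and `q + 1` are treated together: the class sizes are polynomials in `q` and in a
sign `e` that is `1` if `X² + yX + 1` splits over `F` and `-1` if it is irreducible
(`IsSplittingSign`).
-/

open Matrix Polynomial

/-! ### Counting by conjugation over the general linear group -/

theorem Nat.card_eq_mul_of_card_fiber {α β : Type*} [Finite α] [Finite β] (f : α → β) (k : ℕ)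
    (h : ∀ b, Nat.card {a // f a = b} = k) : Nat.card α = Nat.card β * k := by
  have := Fintype.ofFinite β
  rw [← Nat.card_congr (Equiv.sigmaFiberEquiv f), Nat.card_sigma]
  simp [h]

/-- The symplectic forms (Gram matrices) that are invariant under a matrix `C`. -/
def invariantForms {n F : Type*} [Fintype n] [DecidableEq n] [Field F] (C : Matrix n n F) :
    Set (Matrix n n F) :=
  {M | Mᵀ = -M ∧ (∀ i, M i i = 0) ∧ IsUnit M.det ∧ Cᵀ * M * C = M}

/-- The invertible matrices that commute with `C`. -/
def invertibleCentralizer {n F : Type*} [Fintype n] [DecidableEq n] [Field F]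
    (C : Matrix n n F) : Set (Matrix n n F) :=
  {P | IsUnit P.det ∧ P * C = C * P}

/-- The symplectic matrices that are conjugate to `C` in the general linear group. -/
def symplecticSimilar {l F : Type*} [Fintype l] [DecidableEq l] [Field F]
    (C : Matrix (l ⊕ l) (l ⊕ l) F) : Set (symplecticGroup l F) :=
  {g | ∃ P : Matrix (l ⊕ l) (l ⊕ l) F, IsUnit P.det ∧ (g : Matrix (l ⊕ l) (l ⊕ l) F) * P = P * C}

/-- Every invertible alternating form on `F⁴` is equivalent to the standard symplectic form. The
conditions on `M` say that it is alternating also in characteristic two. -/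
theorem Matrix.exists_transpose_mul_J_mul {F : Type*} [Field F]
    {M : Matrix (Fin 2 ⊕ Fin 2) (Fin 2 ⊕ Fin 2) F} (hM : Mᵀ = -M) (hd : ∀ i, M i i = 0)
    (hu : IsUnit M.det) : ∃ P : Matrix (Fin 2 ⊕ Fin 2) (Fin 2 ⊕ Fin 2) F,
      Pᵀ * J (Fin 2) F * P = M := by
  have hs : ∀ i j, M i j = - M j i := fun i j => by
    have := congrFun (congrFun hM j) i
    simpa using this
  have key : ∃ k, M (Sum.inl 0) k ≠ 0 := by
    by_contra! h
    rw [det_eq_zero_of_row_eq_zero _ h] at hu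
    simp at hu
  set x := M (.inl 0) (.inl 1) with hx
  set y := M (.inl 0) (.inr 0) with hy
  set z := M (.inl 0) (.inr 1) with hz
  set c := M (.inl 1) (.inr 0) with hc
  set d := M (.inl 1) (.inr 1) with hd'
  set e := M (.inr 0) (.inr 1) with he
  have hM' : M = fromBlocks !![0, x; -x, 0] !![y, z; c, d] !![-y, -c; -z, -d] !![0, e; -e, 0] := by
    ext i j
    rcases i with i | i <;> rcases j with j | j <;> fin_cases i <;> fin_cases j <;>
      simp [hd, hx, hy, hz, hc, hd', he] <;> exact hs _ _
  clear_value x y z c d e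
  subst hM'
  have hk : x ≠ 0 ∨ y ≠ 0 ∨ z ≠ 0 := by
    by_contra! h
    obtain ⟨k, hk⟩ := key
    apply hk
    rcases k with k | k <;> fin_cases k <;> simp [h]
  -- The columns of `P` are vectors with Gram matrix `M` for the standard form. Take the first basis
  -- vector for the first of them and a multiple of its dual vector for one that pairs non-trivially
  -- with it, and correct the other two by the second hyperbolic pair.
  rcases hk with h | h | h
  · refine ⟨fromBlocks !![1, 0; 0, 0] !![-c/x, -d/x; 1, 0] !![0, -x; 0, 0]
      !![-y, -z; 0, -(e + (c*z-d*y)/x)], ?_⟩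
    ext i j
    rcases i with i | i <;> rcases j with j | j <;> fin_cases i <;> fin_cases j <;>
      simp [Matrix.mul_apply, J, Matrix.fromBlocks] <;> field_simp <;> ring
  · refine ⟨fromBlocks !![1, c/y; 0, 1] !![0, -e/y; 0, 0] !![0, -x; 0, 0]
      !![-y, -z; 0, -(d + (-e*x-c*z)/y)], ?_⟩
    ext i j
    rcases i with i | i <;> rcases j with j | j <;> fin_cases i <;> fin_cases j <;>
      simp [Matrix.mul_apply, J, Matrix.fromBlocks] <;> field_simp <;> ring
  · refine ⟨fromBlocks !![1, d/z; 0, 1] !![e/z, 0; 0, 0] !![0, -x; 0, 0]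
      !![-y, -z; -(c + (e*x-y*d)/z), 0], ?_⟩
    ext i j
    rcases i with i | i <;> rcases j with j | j <;> fin_cases i <;> fin_cases j <;>
      simp [Matrix.mul_apply, J, Matrix.fromBlocks] <;> field_simp <;> ring

/-- The pairs `(g, P)` with `g` symplectic, `P` invertible and `g P = P C` are counted by `g` and
by the invariant form `Pᵀ J P`. -/
theorem card_symplecticSimilar_mul {F : Type*} [Field F] [Finite F]
    (C : Matrix (Fin 2 ⊕ Fin 2) (Fin 2 ⊕ Fin 2) F) :
    Nat.card (symplecticSimilar C) * Nat.card (invertibleCentralizer C) =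
      Nat.card (invariantForms C) * Nat.card (symplecticGroup (Fin 2) F) := by
  let T := {x : symplecticGroup (Fin 2) F × Matrix (Fin 2 ⊕ Fin 2) (Fin 2 ⊕ Fin 2) F //
    IsUnit x.2.det ∧ (x.1 : Matrix (Fin 2 ⊕ Fin 2) (Fin 2 ⊕ Fin 2) F) * x.2 = x.2 * C}
  have hJ : (J (Fin 2) F)ᵀ = - J (Fin 2) F := J_transpose _ _
  trans Nat.card T
  · symm
    let f : T → symplecticSimilar C := fun x => ⟨x.1.1, x.1.2, x.2⟩
    apply Nat.card_eq_mul_of_card_fiber f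
    -- the fibre over `g` is a coset of the centralizer of `C`
    rintro ⟨g, P₀, hP₀, hg⟩
    refine Nat.card_congr ⟨fun x => ⟨P₀⁻¹ * x.1.1.2, ?_⟩, fun Q => ⟨⟨(g, P₀ * Q.1), ?_⟩, ?_⟩, ?_, ?_⟩
    · obtain ⟨⟨⟨g', P⟩, hP, hgP⟩, h⟩ := x
      obtain rfl : g' = g := congrArg Subtype.val h
      refine ⟨?_, ?_⟩
      · rw [det_mul]
        exact (isUnit_nonsing_inv_det P₀ hP₀).mul hP
      · have h1 : P₀⁻¹ * (g'.1 * P₀) = C := by rw [hg, nonsing_inv_mul_cancel_left _ _ hP₀]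
        simp only at hgP ⊢
        rw [Matrix.mul_assoc, ← hgP, ← h1]
        simp only [Matrix.mul_assoc]
        rw [mul_nonsing_inv_cancel_left _ _ hP₀]
    · obtain ⟨Q, hQ, hC⟩ := Q
      refine ⟨by simpa [det_mul] using ⟨hP₀.ne_zero, hQ.ne_zero⟩, ?_⟩
      simp only
      rw [← Matrix.mul_assoc, hg, Matrix.mul_assoc, Matrix.mul_assoc, hC]
    · rfl
    · rintro ⟨⟨⟨g', P⟩, hP, hgP⟩, h⟩
      obtain rfl : g' = g := congrArg Subtype.val h
      simp [mul_nonsing_inv_cancel_left _ _ hP₀]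
    · rintro ⟨Q, hQ, hC⟩
      simp [nonsing_inv_mul_cancel_left _ _ hP₀]
  · let f : T → invariantForms C := fun x => ⟨x.1.2ᵀ * J (Fin 2) F * x.1.2, by
      obtain ⟨⟨g, P⟩, hP, hgP⟩ := x
      refine ⟨?_, ?_, ?_, ?_⟩
      · simp [Matrix.mul_assoc]
      · intro i
        simp only [Matrix.mul_apply, transpose_apply, J, Fintype.sum_sum_type, Fin.sum_univ_two]
        simp
        ring
      · simp only [det_mul, det_transpose]
        exact (hP.mul (isUnit_det_J _ _)).mul hP
      · simp only at hgP ⊢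
        have := SymplecticGroup.mem_iff'.mp g.2
        calc Cᵀ * (Pᵀ * J (Fin 2) F * P) * C = (P * C)ᵀ * J (Fin 2) F * (P * C) := by
              simp [Matrix.mul_assoc]
          _ = Pᵀ * (g.1ᵀ * J (Fin 2) F * g.1) * P := by
              rw [← hgP]; simp [Matrix.mul_assoc]
          _ = _ := by rw [this]⟩
    apply Nat.card_eq_mul_of_card_fiber f
    -- two matrices `P`, `Q` with `Pᵀ J P = Qᵀ J Q = M` differ by a symplectic matrix, and `g` is
    -- determined by `P`
    rintro ⟨M, hM, hd, hu, hC⟩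
    obtain ⟨P₀, hP₀⟩ := exists_transpose_mul_J_mul hM hd hu
    have hunit : ∀ P : Matrix (Fin 2 ⊕ Fin 2) (Fin 2 ⊕ Fin 2) F, Pᵀ * J (Fin 2) F * P = M →
        IsUnit P.det := by
      intro P hP
      rw [← hP, det_mul] at hu
      exact isUnit_of_mul_isUnit_right hu
    have hP₀u := hunit P₀ hP₀
    have hP₀t : IsUnit (P₀ᵀ).det := by rwa [det_transpose]
    have hsym : ∀ P Q : Matrix (Fin 2 ⊕ Fin 2) (Fin 2 ⊕ Fin 2) F, Pᵀ * J (Fin 2) F * P = M →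
        Qᵀ * J (Fin 2) F * Q = M → P * Q⁻¹ ∈ symplecticGroup (Fin 2) F := by
      intro P Q hP hQ
      have hQu := hunit Q hQ
      have hQt : IsUnit (Qᵀ).det := by rwa [det_transpose]
      rw [SymplecticGroup.mem_iff', transpose_mul, transpose_nonsing_inv]
      calc Qᵀ⁻¹ * Pᵀ * J (Fin 2) F * (P * Q⁻¹) = Qᵀ⁻¹ * (Pᵀ * J (Fin 2) F * P) * Q⁻¹ := by
            simp [Matrix.mul_assoc]
        _ = _ := by
            rw [hP, ← hQ]
            simp only [Matrix.mul_assoc]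
            rw [mul_nonsing_inv _ hQu, Matrix.mul_one, nonsing_inv_mul_cancel_left _ _ hQt]
    have hmul : ∀ (g : symplecticGroup (Fin 2) F), (g.1 * P₀)ᵀ * J (Fin 2) F * (g.1 * P₀) = M := by
      intro g
      have := SymplecticGroup.mem_iff'.mp g.2
      calc _ = P₀ᵀ * (g.1ᵀ * J (Fin 2) F * g.1) * P₀ := by simp [Matrix.mul_assoc]
        _ = M := by rw [this, hP₀]
    have hCM : ∀ P : Matrix (Fin 2 ⊕ Fin 2) (Fin 2 ⊕ Fin 2) F, Pᵀ * J (Fin 2) F * P = M →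
        (P * C)ᵀ * J (Fin 2) F * (P * C) = M := by
      intro P hP
      calc _ = Cᵀ * (Pᵀ * J (Fin 2) F * P) * C := by simp [Matrix.mul_assoc]
        _ = M := by rw [hP, hC]
    refine Nat.card_congr ⟨fun x => ⟨x.1.1.2 * P₀⁻¹, ?_⟩, fun g => ⟨⟨(⟨g.1 * P₀ * C * (g.1 * P₀)⁻¹, ?_⟩,
      g.1 * P₀), ?_, ?_⟩, ?_⟩, ?_, ?_⟩
    · exact hsym _ _ (congrArg Subtype.val x.2) hP₀
    · exact hsym _ _ (hCM _ (hmul g)) (hmul g)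
    · exact hunit _ (hmul g)
    · exact nonsing_inv_mul_cancel_right _ _ (hunit _ (hmul g))
    · exact Subtype.ext (hmul g)
    · rintro ⟨⟨⟨g, P⟩, hP, hgP⟩, h⟩
      simp only at hP hgP
      simp only [nonsing_inv_mul_cancel_right _ _ hP₀u, Subtype.mk.injEq]
      have : g.1 * P * P⁻¹ = g.1 := mul_nonsing_inv_cancel_right _ _ hP
      simp only [← hgP, this]
    · intro g
      apply Subtype.ext
      exact mul_nonsing_inv_cancel_right _ _ hP₀u

/-! ### Alternating matrices of size four and the order of the symplectic group -/

/-- The alternating matrix with the given entries above the diagonal. -/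
def altMatrix {F : Type*} [Field F] (x y z c d e : F) :
    Matrix (Fin 2 ⊕ Fin 2) (Fin 2 ⊕ Fin 2) F :=
  fromBlocks !![0, x; -x, 0] !![y, z; c, d] !![-y, -c; -z, -d] !![0, e; -e, 0]

theorem Matrix.det_sum_fin_two {F : Type*} [CommRing F]
    (M : Matrix (Fin 2 ⊕ Fin 2) (Fin 2 ⊕ Fin 2) F) :
    M.det = (M.submatrix (finSumFinEquiv (m := 2) (n := 2)).symm
      (finSumFinEquiv (m := 2) (n := 2)).symm).det :=
  (det_submatrix_equiv_self _ _).symm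

theorem Matrix.det_fromBlocks_fin_two {F : Type*} [CommRing F]
    (a b c d e f g h i j k l m n o p : F) :
    (fromBlocks !![a, b; e, f] !![c, d; g, h] !![i, j; m, n] !![k, l; o, p]).det =
      (!![a, b, c, d; e, f, g, h; i, j, k, l; m, n, o, p]).det := by
  rw [det_sum_fin_two]
  congr 1
  ext r s
  fin_cases r <;> fin_cases s <;> rfl

theorem Matrix.det_fin_four {F : Type*} [CommRing F] (M : Matrix (Fin 4) (Fin 4) F) : M.det =
    M 0 0 * (M 1 1 * (M 2 2 * M 3 3 - M 2 3 * M 3 2) - M 1 2 * (M 2 1 * M 3 3 - M 2 3 * M 3 1) +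
      M 1 3 * (M 2 1 * M 3 2 - M 2 2 * M 3 1)) -
    M 0 1 * (M 1 0 * (M 2 2 * M 3 3 - M 2 3 * M 3 2) - M 1 2 * (M 2 0 * M 3 3 - M 2 3 * M 3 0) +
      M 1 3 * (M 2 0 * M 3 2 - M 2 2 * M 3 0)) +
    M 0 2 * (M 1 0 * (M 2 1 * M 3 3 - M 2 3 * M 3 1) - M 1 1 * (M 2 0 * M 3 3 - M 2 3 * M 3 0) +
      M 1 3 * (M 2 0 * M 3 1 - M 2 1 * M 3 0)) -
    M 0 3 * (M 1 0 * (M 2 1 * M 3 2 - M 2 2 * M 3 1) - M 1 1 * (M 2 0 * M 3 2 - M 2 2 * M 3 0) +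
      M 1 2 * (M 2 0 * M 3 1 - M 2 1 * M 3 0)) := by
  simp only [det_succ_row_zero, Fin.sum_univ_succ]
  simp [Fin.succAbove, Matrix.submatrix]
  ring

/-- The determinant of an alternating matrix is the square of its Pfaffian. -/
theorem det_altMatrix {F : Type*} [Field F] (x y z c d e : F) :
    (altMatrix x y z c d e).det = (x * e - y * d + z * c) ^ 2 := by
  rw [altMatrix, det_fromBlocks_fin_two, det_fin_four]
  simp
  ring

theorem exists_eq_altMatrix {F : Type*} [Field F] {M : Matrix (Fin 2 ⊕ Fin 2) (Fin 2 ⊕ Fin 2) F}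
    (hM : Mᵀ = -M) (hd : ∀ i, M i i = 0) :
    M = altMatrix (M (.inl 0) (.inl 1)) (M (.inl 0) (.inr 0)) (M (.inl 0) (.inr 1))
      (M (.inl 1) (.inr 0)) (M (.inl 1) (.inr 1)) (M (.inr 0) (.inr 1)) := by
  have hs : ∀ i j, M i j = - M j i := fun i j => by
    have := congrFun (congrFun hM j) i
    simpa using this
  ext i j
  rcases i with i | i <;> rcases j with j | j <;> fin_cases i <;> fin_cases j <;>
    simp [hd, altMatrix] <;> exact hs _ _

theorem altMatrix_transpose {F : Type*} [Field F] (x y z c d e : F) :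
    (altMatrix x y z c d e)ᵀ = -altMatrix x y z c d e := by
  ext i j
  rcases i with i | i <;> rcases j with j | j <;> fin_cases i <;> fin_cases j <;>
    simp [altMatrix]

theorem altMatrix_diag {F : Type*} [Field F] (x y z c d e : F) (i : Fin 2 ⊕ Fin 2) :
    altMatrix x y z c d e i i = 0 := by
  rcases i with i | i <;> fin_cases i <;> simp [altMatrix]

/-- An invariant form amounts to six coordinates with non-zero Pfaffian. -/
def invariantFormsEquiv {F : Type*} [Field F] (C : Matrix (Fin 2 ⊕ Fin 2) (Fin 2 ⊕ Fin 2) F) :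
    invariantForms C ≃ {v : F × F × F × F × F × F //
      v.1 * v.2.2.2.2.2 - v.2.1 * v.2.2.2.2.1 + v.2.2.1 * v.2.2.2.1 ≠ 0 ∧
      Cᵀ * altMatrix v.1 v.2.1 v.2.2.1 v.2.2.2.1 v.2.2.2.2.1 v.2.2.2.2.2 * C =
        altMatrix v.1 v.2.1 v.2.2.1 v.2.2.2.1 v.2.2.2.2.1 v.2.2.2.2.2} where
  toFun M := ⟨(M.1 (.inl 0) (.inl 1), M.1 (.inl 0) (.inr 0), M.1 (.inl 0) (.inr 1),
      M.1 (.inl 1) (.inr 0), M.1 (.inl 1) (.inr 1), M.1 (.inr 0) (.inr 1)), by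
    obtain ⟨M, hM, hd, hu, hC⟩ := M
    have h := exists_eq_altMatrix hM hd
    refine ⟨?_, ?_⟩
    · rw [h, det_altMatrix] at hu
      simpa using hu
    · simp only [← h, hC]⟩
  invFun v := ⟨_, altMatrix_transpose _ _ _ _ _ _, altMatrix_diag _ _ _ _ _ _, by
    rw [det_altMatrix]; simpa using v.2.1, v.2.2⟩
  left_inv M := Subtype.ext (exists_eq_altMatrix M.2.1 M.2.2.1).symm
  right_inv v := by
    obtain ⟨⟨x, y, z, c, d, e⟩, h⟩ := v
    simp [altMatrix]

theorem card_ne_zero (F : Type*) [Field F] [Finite F] :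
    Nat.card {x : F // x ≠ 0} = Nat.card F - 1 := by
  rw [← Nat.card_congr unitsEquivNeZero, Nat.card_units]

theorem card_linearMap_ne_zero {F V : Type*} [Field F] [Finite F] [AddCommGroup V] [Module F V]
    [Finite V] (φ : V →ₗ[F] F) (hφ : φ ≠ 0) :
    Nat.card F * Nat.card {v // φ v ≠ 0} = Nat.card V * (Nat.card F - 1) := by
  have hs : Function.Surjective φ := LinearMap.surjective hφ
  have hf : ∀ b : F, Nat.card {v // φ v = b} = Nat.card (LinearMap.ker φ) := by
    intro b
    obtain ⟨w, rfl⟩ := hs b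
    exact Nat.card_congr ⟨fun v => ⟨v.1 - w, by simp [v.2]⟩, fun v => ⟨v.1 + w, by simp⟩,
      fun v => by simp, fun v => by simp⟩
  have h1 := Nat.card_eq_mul_of_card_fiber φ _ hf
  have h2 : Nat.card {v // φ v ≠ 0} = Nat.card {x : F // x ≠ 0} * Nat.card (LinearMap.ker φ) := by
    apply Nat.card_eq_mul_of_card_fiber (fun v => (⟨φ v.1, v.2⟩ : {x : F // x ≠ 0}))
    rintro ⟨b, hb⟩
    rw [← hf b]
    exact Nat.card_congr ⟨fun v => ⟨v.1.1, congrArg Subtype.val v.2⟩,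
      fun v => ⟨⟨v.1, by rw [v.2]; exact hb⟩, Subtype.ext v.2⟩, fun v => by simp, fun v => by simp⟩
  rw [h2, h1, card_ne_zero]
  ring

/-- The first row of an alternating matrix with non-zero Pfaffian is non-zero, and given this row
the Pfaffian is a non-zero linear form in the other three entries. -/
theorem card_pfaffian_ne_zero (F : Type*) [Field F] [Finite F] :
    Nat.card {v : F × F × F × F × F × F //
      v.1 * v.2.2.2.2.2 - v.2.1 * v.2.2.2.2.1 + v.2.2.1 * v.2.2.2.1 ≠ 0} =
    (Nat.card F ^ 3 - 1) * (Nat.card F ^ 2 * (Nat.card F - 1)) := by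
  have h1 : Nat.card {w : F × F × F // w ≠ 0} = Nat.card F ^ 3 - 1 := by
    have := Fintype.ofFinite F
    classical
    rw [Nat.card_eq_fintype_card, Fintype.card_subtype_compl]
    simp
    ring_nf
  rw [← h1]
  apply Nat.card_eq_mul_of_card_fiber (fun v => (⟨(v.1.1, v.1.2.1, v.1.2.2.1), by
    rintro h
    have h2 := v.2
    simp only [Prod.mk_eq_zero] at h
    simp [h] at h2⟩ : {w : F × F × F // w ≠ 0}))
  rintro ⟨⟨x, y, z⟩, hw⟩
  let φ : F × F × F →ₗ[F] F :=
    z • LinearMap.fst F F (F × F) - y • (LinearMap.fst F F F ∘ₗ LinearMap.snd F F (F × F))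
      + x • (LinearMap.snd F F F ∘ₗ LinearMap.snd F F (F × F))
  have hφ : ∀ c d e, φ (c, d, e) = x * e - y * d + z * c := fun c d e => by
    simp [φ]; ring
  have hφ0 : φ ≠ 0 := by
    intro h
    apply hw
    have h1 := hφ 1 0 0
    have h2 := hφ 0 1 0
    have h3 := hφ 0 0 1
    simp [h] at h1 h2 h3
    simp [← h1, ← h2, ← h3]
  have h := card_linearMap_ne_zero φ hφ0
  have hq : 0 < Nat.card F := Nat.card_pos
  have : Nat.card {v // φ v ≠ 0} = Nat.card F ^ 2 * (Nat.card F - 1) := by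
    apply Nat.eq_of_mul_eq_mul_left hq
    rw [h]
    simp only [Nat.card_prod]
    ring
  rw [← this]
  refine Nat.card_congr ⟨fun v => ⟨v.1.1.2.2.2, ?_⟩, fun v => ⟨⟨(x, y, z, v.1), ?_⟩, rfl⟩, ?_, ?_⟩
  · obtain ⟨⟨⟨x', y', z', c, d, e⟩, hv⟩, h'⟩ := v
    simp only [Subtype.mk.injEq, Prod.mk.injEq] at h'
    obtain ⟨rfl, rfl, rfl⟩ := h'
    rw [hφ]
    exact hv
  · have := v.2
    rwa [hφ] at this
  · rintro ⟨⟨⟨x', y', z', c, d, e⟩, h⟩, h'⟩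
    simp only [Subtype.mk.injEq, Prod.mk.injEq] at h'
    obtain ⟨rfl, rfl, rfl⟩ := h'
    rfl
  · intro v
    rfl

theorem card_det_isUnit {n : Type*} (F : Type*) [Fintype n] [DecidableEq n] [Field F] [Finite F]
    {m : ℕ} (hm : Fintype.card n = m) : Nat.card {P : Matrix n n F // IsUnit P.det} =
      ∏ i : Fin m, (Nat.card F ^ m - Nat.card F ^ (i : ℕ)) := by
  subst hm
  have := Fintype.ofFinite F
  have h := Matrix.card_GL_field (𝔽 := F) (Fintype.card n)
  rw [Nat.card_eq_fintype_card (α := F), ← h]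
  let e := Fintype.equivFin n
  refine Nat.card_congr (?_ : _ ≃ (Matrix (Fin (Fintype.card n)) (Fin (Fintype.card n)) F)ˣ)
  refine Equiv.trans ?_ (Units.mapEquiv (Matrix.reindexAlgEquiv F F e).toMulEquiv).toEquiv
  exact ⟨fun P => nonsingInvUnit P.1 P.2, fun P => ⟨P.1, (isUnit_iff_isUnit_det _).mp P.isUnit⟩,
    fun P => rfl, fun P => Units.ext rfl⟩

/-- The order of `Sp₄(q)` is the order of `GL₄(q)` divided by the number of invertible alternating
forms, by `card_symplecticSimilar_mul` for `C = 1`. -/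
theorem card_symplecticGroup_fin_two (F : Type*) [Field F] [Finite F] :
    (Nat.card (symplecticGroup (Fin 2) F) : ℚ) =
      (Nat.card F : ℚ) ^ 4 * ((Nat.card F : ℚ) ^ 2 - 1) * ((Nat.card F : ℚ) ^ 4 - 1) := by
  have h := card_symplecticSimilar_mul (1 : Matrix (Fin 2 ⊕ Fin 2) (Fin 2 ⊕ Fin 2) F)
  have h1 : Nat.card (symplecticSimilar (1 : Matrix (Fin 2 ⊕ Fin 2) (Fin 2 ⊕ Fin 2) F)) = 1 := by
    have : symplecticSimilar (1 : Matrix (Fin 2 ⊕ Fin 2) (Fin 2 ⊕ Fin 2) F) = {1} := by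
      ext g
      simp only [symplecticSimilar, Matrix.mul_one, Set.mem_ofPred_eq, Set.mem_singleton_iff]
      constructor
      · rintro ⟨P, hP, h⟩
        apply Subtype.ext
        have : g.1 * P * P⁻¹ = P * P⁻¹ := by rw [h]
        rwa [mul_nonsing_inv_cancel_right _ _ hP, mul_nonsing_inv _ hP] at this
      · rintro rfl
        exact ⟨1, by simp⟩
    rw [this]; simp
  have h2 : invertibleCentralizer (1 : Matrix (Fin 2 ⊕ Fin 2) (Fin 2 ⊕ Fin 2) F) =
      {P | IsUnit P.det} := by
    ext P; simp [invertibleCentralizer]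
  have h3 := card_det_isUnit (n := Fin 2 ⊕ Fin 2) F (m := 4) rfl
  have h4 : Nat.card (invariantForms (1 : Matrix (Fin 2 ⊕ Fin 2) (Fin 2 ⊕ Fin 2) F)) =
      (Nat.card F ^ 3 - 1) * (Nat.card F ^ 2 * (Nat.card F - 1)) := by
    rw [← card_pfaffian_ne_zero, Nat.card_congr (invariantFormsEquiv _)]
    simp
  rw [h1, h2, h4] at h
  erw [h3] at h
  have hq : 1 < Nat.card F := Finite.one_lt_card
  generalize Nat.card F = q at *
  simp only [Fin.prod_univ_four, one_mul] at h
  have e1 : 1 ≤ q ^ 4 := Nat.one_le_pow _ _ (by omega)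
  have e2 : q ^ 1 ≤ q ^ 4 := Nat.pow_le_pow_right (by omega) (by omega)
  have e3 : q ^ 2 ≤ q ^ 4 := Nat.pow_le_pow_right (by omega) (by omega)
  have e4 : q ^ 3 ≤ q ^ 4 := Nat.pow_le_pow_right (by omega) (by omega)
  have e5 : 1 ≤ q ^ 3 := Nat.one_le_pow _ _ (by omega)
  change (q ^ 4 - q ^ 0) * (q ^ 4 - q ^ 1) * (q ^ 4 - q ^ 2) * (q ^ 4 - q ^ 3) = _ at h
  rw [pow_zero] at h
  have h' := congrArg (Nat.cast : ℕ → ℚ) h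
  push_cast [Nat.cast_sub e1, Nat.cast_sub e2, Nat.cast_sub e3, Nat.cast_sub e4, Nat.cast_sub e5,
    Nat.cast_sub hq.le] at h'
  have hq' : (1 : ℚ) < q := by exact_mod_cast hq
  have n1 : (q : ℚ) - 1 ≠ 0 := by linarith
  have n2 : (q : ℚ) ^ 3 - 1 ≠ 0 := by
    have : (1 : ℚ) < q ^ 3 := one_lt_pow₀ hq' (by norm_num)
    linarith
  have n3 : (q : ℚ) ≠ 0 := by linarith
  have n4 : ((q : ℚ) ^ 3 - 1) * (q ^ 2 * (q - 1)) ≠ 0 := by positivity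
  apply mul_left_cancel₀ n4
  rw [← h']
  ring

/-! ### Regular elements: cyclic vectors and companion matrices -/

/-- The monic self-reciprocal quartic `X⁴ + tX³ + sX² + tX + 1`. -/
noncomputable def palindromicQuartic {F : Type*} [CommRing F] (t s : F) : F[X] :=
  X ^ 4 + C t * X ^ 3 + C s * X ^ 2 + C t * X + 1

/-- The companion matrix of `palindromicQuartic t s` in characteristic two. -/
def companionMatrix {F : Type*} [Field F] (t s : F) : Matrix (Fin 2 ⊕ Fin 2) (Fin 2 ⊕ Fin 2) F :=
  fromBlocks !![0, 0; 1, 0] !![0, 1; 0, t] !![0, 1; 0, 0] !![0, s; 1, t]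

theorem palindromicQuartic_monic {F : Type*} [CommRing F] [Nontrivial F] (t s : F) :
    (palindromicQuartic t s).Monic := by
  unfold palindromicQuartic
  monicity!

theorem palindromicQuartic_natDegree {F : Type*} [CommRing F] [Nontrivial F] (t s : F) :
    (palindromicQuartic t s).natDegree = 4 := by
  unfold palindromicQuartic
  compute_degree!

theorem Module.End.exists_aeval_apply_eq_zero_imp {F V : Type*} [Field F] [AddCommGroup V]
    [Module F V] [Module.Finite F V] (g : Module.End F V) :
    ∃ v : V, ∀ h : F[X], aeval g h v = 0 → aeval g h = 0 := by
  obtain ⟨x, hx⟩ := Module.exists_ker_toSpanSingleton_eq_annihilator F[X] (Module.AEval F V g)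
  obtain ⟨v, rfl⟩ := (Module.AEval.of F V g).surjective x
  refine ⟨v, fun h hh => ?_⟩
  have : h ∈ Module.annihilator F[X] (Module.AEval F V g) := by
    rw [← hx, LinearMap.mem_ker, LinearMap.toSpanSingleton_apply, ← Module.AEval.of_aeval_smul]
    simp [hh]
  rw [Module.AEval.annihilator_eq_ker_aeval] at this
  exact this

/-- There is a vector whose annihilator in `F[X]` is generated by the minimal polynomial. -/
theorem Matrix.exists_aeval_mulVec_eq_zero_imp {F n : Type*} [Field F] [Fintype n] [DecidableEq n]
    (g : Matrix n n F) : ∃ v : n → F, ∀ h : F[X], aeval g h *ᵥ v = 0 → minpoly F g ∣ h := by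
  obtain ⟨v, hv⟩ := Module.End.exists_aeval_apply_eq_zero_imp (toLinAlgEquiv' g : Module.End F (n → F))
  refine ⟨v, fun h hh => minpoly.dvd _ _ ?_⟩
  have := hv h (by
    rw [show (aeval (toLinAlgEquiv' g)) h = toLinAlgEquiv' (aeval g h) from
      aeval_algHom_apply (toLinAlgEquiv' (R := F) (n := n)).toAlgHom g h]
    simpa using hh)
  rw [show (aeval (toLinAlgEquiv' g)) h = toLinAlgEquiv' (aeval g h) from
    aeval_algHom_apply (toLinAlgEquiv' (R := F) (n := n)).toAlgHom g h] at this
  simpa using this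

theorem minpoly_eq_of_mul_eq_mul {F n : Type*} [Field F] [Fintype n] [DecidableEq n]
    {g P C : Matrix n n F} (hP : IsUnit P.det) (h : g * P = P * C) : minpoly F g = minpoly F C := by
  have hU : IsUnit P := (isUnit_iff_isUnit_det _).mpr hP
  have key : ∀ f : F[X], aeval g f * P = P * aeval C f := by
    intro f
    induction f using Polynomial.induction_on' with
    | add p q hp hq => rw [map_add, map_add, add_mul, mul_add, hp, hq]
    | monomial n a =>
      have : ∀ n : ℕ, g ^ n * P = P * C ^ n := fun n => by
        induction n with
        | zero => simp
        | succ n ih => rw [pow_succ, pow_succ, Matrix.mul_assoc, h, ← Matrix.mul_assoc, ih, Matrix.mul_assoc]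
      rw [aeval_monomial, aeval_monomial, Matrix.mul_assoc, this, ← Matrix.mul_assoc,
        ← Matrix.mul_assoc, Algebra.commutes]
  refine eq_of_monic_of_associated (minpoly.monic (Algebra.IsIntegral.isIntegral _))
    (minpoly.monic (Algebra.IsIntegral.isIntegral _)) (associated_of_dvd_dvd
      (minpoly.dvd _ _ ?_) (minpoly.dvd _ _ ?_))
  · have := key (minpoly F C)
    rw [minpoly.aeval, mul_zero] at this
    exact hU.mul_left_eq_zero.mp this
  · have := key (minpoly F g)
    rw [minpoly.aeval, zero_mul] at this
    exact hU.mul_right_eq_zero.mp this.symm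

section
variable {F : Type*} [Field F]

theorem companionMatrix_mulVec (t s : F) :
    companionMatrix t s *ᵥ Pi.single (.inl 0) 1 = Pi.single (.inl 1) 1 ∧
    companionMatrix t s *ᵥ Pi.single (.inl 1) 1 = Pi.single (.inr 0) 1 ∧
    companionMatrix t s *ᵥ Pi.single (.inr 0) 1 = Pi.single (.inr 1) 1 ∧
    companionMatrix t s *ᵥ Pi.single (.inr 1) 1 = Pi.single (.inl 0) 1 + t • Pi.single (.inl 1) 1 +
      s • Pi.single (.inr 0) 1 + t • Pi.single (.inr 1) 1 := by
  refine ⟨?_, ?_, ?_, ?_⟩ <;>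
  · ext i
    rcases i with i | i <;> fin_cases i <;> simp [companionMatrix]

theorem Matrix.ext_mulVec_single {R : Type*} [CommRing R] {P Q : Matrix (Fin 2 ⊕ Fin 2) (Fin 2 ⊕ Fin 2) R}
    (h0 : P *ᵥ Pi.single (.inl 0) 1 = Q *ᵥ Pi.single (.inl 0) 1)
    (h1 : P *ᵥ Pi.single (.inl 1) 1 = Q *ᵥ Pi.single (.inl 1) 1)
    (h2 : P *ᵥ Pi.single (.inr 0) 1 = Q *ᵥ Pi.single (.inr 0) 1)
    (h3 : P *ᵥ Pi.single (.inr 1) 1 = Q *ᵥ Pi.single (.inr 1) 1) : P = Q := by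
  apply Matrix.ext_of_mulVec_single
  rintro (i | i) <;> fin_cases i <;> assumption

/-- A matrix that commutes with the companion matrix is determined by its first column. -/
theorem eq_of_commute_companionMatrix {t s : F} {P Q : Matrix (Fin 2 ⊕ Fin 2) (Fin 2 ⊕ Fin 2) F}
    (hP : P * companionMatrix t s = companionMatrix t s * P)
    (hQ : Q * companionMatrix t s = companionMatrix t s * Q)
    (h0 : P *ᵥ Pi.single (.inl 0) 1 = Q *ᵥ Pi.single (.inl 0) 1) : P = Q := by
  obtain ⟨e1, e2, e3, -⟩ := companionMatrix_mulVec t s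
  have step : ∀ v w, companionMatrix t s *ᵥ v = w → P *ᵥ v = Q *ᵥ v → P *ᵥ w = Q *ᵥ w := by
    rintro v w rfl h
    rw [mulVec_mulVec, mulVec_mulVec, hP, hQ, ← mulVec_mulVec, h, mulVec_mulVec]
  have h1 := step _ _ e1 h0
  have h2 := step _ _ e2 h1
  have h3 := step _ _ e3 h2
  exact ext_mulVec_single h0 h1 h2 h3

theorem aeval_companionMatrix_mulVec (t s a b c d : F) :
    aeval (companionMatrix t s) (C a + C b * X + C c * X ^ 2 + C d * X ^ 3) *ᵥ Pi.single (.inl 0) 1 =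
      Sum.elim ![a, b] ![c, d] := by
  obtain ⟨e1, e2, e3, e4⟩ := companionMatrix_mulVec t s
  simp only [map_add, map_mul, aeval_X, aeval_C,
      add_mulVec, pow_succ, pow_zero, one_mul, ← mulVec_mulVec, e1, e2, e3, one_mulVec,
      Algebra.algebraMap_eq_smul_one, smul_mulVec]
  ext i
  rcases i with i | i <;> fin_cases i <;> simp

theorem Polynomial.eq_of_natDegree_lt_four {R : Type*} [CommRing R] {h : R[X]}
    (hd : h.natDegree < 4) : h = C (h.coeff 0) + C (h.coeff 1) * X + C (h.coeff 2) * X ^ 2 +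
      C (h.coeff 3) * X ^ 3 := by
  conv_lhs => rw [h.as_sum_range_C_mul_X_pow' hd]
  simp [Finset.sum_range_succ]

variable [CharP F 2]

theorem aeval_companionMatrix (t s : F) :
    aeval (companionMatrix t s) (palindromicQuartic t s) = 0 := by
  obtain ⟨e1, e2, e3, e4⟩ := companionMatrix_mulVec t s
  have hc : ∀ h : F[X], aeval (companionMatrix t s) h * companionMatrix t s =
      companionMatrix t s * aeval (companionMatrix t s) h := fun h => by
    have := congrArg (aeval (companionMatrix t s)) (mul_comm h X)
    simpa only [map_mul, aeval_X] using this
  apply eq_of_commute_companionMatrix (t := t) (s := s)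
  · exact hc _
  · simp
  · simp only [palindromicQuartic, map_add, map_mul, aeval_X, aeval_C, map_one, zero_mulVec,
      add_mulVec, pow_succ, pow_zero, one_mul, ← mulVec_mulVec, e1, e2, e3, e4, one_mulVec,
      Algebra.algebraMap_eq_smul_one, smul_mulVec]
    ext i
    have h2 : (2 : F) = 0 := CharTwo.two_eq_zero
    rcases i with i | i <;> fin_cases i <;> simp <;> grind

/-- The algebra generated by the companion matrix. -/
noncomputable def companionHom (t s : F) :
    AdjoinRoot (palindromicQuartic t s) →ₐ[F] Matrix (Fin 2 ⊕ Fin 2) (Fin 2 ⊕ Fin 2) F :=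
  Ideal.Quotient.liftₐ _ (aeval (companionMatrix t s)) (by
    intro a ha
    obtain ⟨b, rfl⟩ := Ideal.mem_span_singleton.mp ha
    rw [map_mul, aeval_companionMatrix, zero_mul])

theorem companionHom_mk (t s : F) (h : F[X]) :
    companionHom t s (AdjoinRoot.mk _ h) = aeval (companionMatrix t s) h := rfl

theorem companionHom_injective (t s : F) : Function.Injective (companionHom t s) := by
  rw [injective_iff_map_eq_zero]
  intro a ha
  obtain ⟨h, rfl⟩ := AdjoinRoot.mk_surjective a
  have hm := palindromicQuartic_monic t s
  rw [← AdjoinRoot.mk_leftInverse hm (AdjoinRoot.mk _ h)] at ha ⊢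
  rw [AdjoinRoot.modByMonicHom_mk] at ha ⊢
  set k := h %ₘ palindromicQuartic t s
  have hk : k.natDegree < 4 := by
    rw [← palindromicQuartic_natDegree t s]
    apply natDegree_modByMonic_lt _ hm
    intro h1
    have := palindromicQuartic_natDegree t s
    rw [h1] at this
    simp at this
  rw [companionHom_mk, eq_of_natDegree_lt_four hk] at ha
  have h0 := congrArg (· *ᵥ Pi.single (.inl 0) 1) ha
  simp only [aeval_companionMatrix_mulVec, zero_mulVec] at h0
  have c0 := congrFun h0 (.inl 0)
  have c1 := congrFun h0 (.inl 1)
  have c2 := congrFun h0 (.inr 0)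
  have c3 := congrFun h0 (.inr 1)
  simp at c0 c1 c2 c3
  rw [eq_of_natDegree_lt_four hk]
  simp [c0, c1, c2, c3]

theorem companionHom_commute (t s : F) (a : AdjoinRoot (palindromicQuartic t s)) :
    companionHom t s a * companionMatrix t s = companionMatrix t s * companionHom t s a := by
  have : companionMatrix t s = companionHom t s (AdjoinRoot.root _) := by
    rw [AdjoinRoot.root, companionHom_mk, aeval_X]
  rw [this, ← map_mul, ← map_mul, mul_comm]

theorem exists_companionHom_eq {t s : F} {P : Matrix (Fin 2 ⊕ Fin 2) (Fin 2 ⊕ Fin 2) F}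
    (hP : P * companionMatrix t s = companionMatrix t s * P) : ∃ a, companionHom t s a = P := by
  set w := P *ᵥ Pi.single (.inl 0) 1 with hw
  refine ⟨AdjoinRoot.mk _ (C (w (.inl 0)) + C (w (.inl 1)) * X + C (w (.inr 0)) * X ^ 2 +
    C (w (.inr 1)) * X ^ 3), eq_of_commute_companionMatrix (companionHom_commute t s _) hP ?_⟩
  rw [companionHom_mk, aeval_companionMatrix_mulVec, ← hw]
  ext i
  rcases i with i | i <;> fin_cases i <;> simp

theorem isUnit_companionHom_det [Finite F] {t s : F} {a : AdjoinRoot (palindromicQuartic t s)} :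
    IsUnit (companionHom t s a).det ↔ IsUnit a := by
  rw [← isUnit_iff_isUnit_det]
  refine ⟨fun h => ?_, fun h => h.map _⟩
  have : Finite (AdjoinRoot (palindromicQuartic t s)) :=
    Finite.of_injective _ (companionHom_injective t s)
  rw [isUnit_iff_mem_nonZeroDivisors_of_finite, mem_nonZeroDivisors_iff_right]
  intro x hx
  apply companionHom_injective t s
  have := congrArg (companionHom t s) hx
  rw [map_mul, map_zero] at this
  rw [map_zero]
  exact h.mul_left_eq_zero.mp this

theorem card_invertibleCentralizer_companionMatrix [Finite F] (t s : F) :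
    Nat.card (invertibleCentralizer (companionMatrix t s)) =
      Nat.card (AdjoinRoot (palindromicQuartic t s))ˣ := by
  symm
  refine Nat.card_congr (Equiv.ofBijective (fun a => ⟨companionHom t s a,
    isUnit_companionHom_det.mpr a.isUnit, companionHom_commute t s _⟩) ⟨?_, ?_⟩)
  · intro a b h
    exact Units.ext (companionHom_injective t s (congrArg Subtype.val h))
  · rintro ⟨P, hP, hc⟩
    obtain ⟨a, rfl⟩ := exists_companionHom_eq hc
    exact ⟨(isUnit_companionHom_det.mp hP).unit, rfl⟩

/-- An invariant form of the companion matrix is determined by the two coordinates `x` and `y`. -/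
theorem companionMatrix_invariant_iff (t s x y z c d e : F) :
    (companionMatrix t s)ᵀ * altMatrix x y z c d e * companionMatrix t s = altMatrix x y z c d e ↔
      c = x ∧ d = y ∧ e = x ∧ z = t * y + s * x + x := by
  have h2 : (2 : F) = 0 := CharTwo.two_eq_zero
  constructor
  · intro h
    have h01 := congrFun (congrFun h (.inl 0)) (.inl 1)
    have h02 := congrFun (congrFun h (.inl 0)) (.inr 0)
    have h12 := congrFun (congrFun h (.inl 1)) (.inr 0)
    have h23 := congrFun (congrFun h (.inr 0)) (.inr 1)
    simp [companionMatrix, altMatrix, Matrix.mul_apply] at h01 h02 h12 h23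
    refine ⟨h01, h02, by grind, by grind⟩
  · rintro ⟨rfl, rfl, rfl, rfl⟩
    ext i j
    rcases i with i | i <;> rcases j with j | j <;> fin_cases i <;> fin_cases j <;>
      simp [companionMatrix, altMatrix, Matrix.mul_apply] <;> grind

theorem card_invariantForms_companionMatrix (t s : F) :
    Nat.card (invariantForms (companionMatrix t s)) =
      Nat.card {v : F × F // v.2 ^ 2 + t * v.2 * v.1 + s * v.1 ^ 2 ≠ 0} := by
  have h2 : (2 : F) = 0 := CharTwo.two_eq_zero
  rw [Nat.card_congr (invariantFormsEquiv _)]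
  refine Nat.card_congr ⟨fun v => ⟨(v.1.1, v.1.2.1), ?_⟩, fun v => ⟨(v.1.1, v.1.2,
    t * v.1.2 + s * v.1.1 + v.1.1, v.1.1, v.1.2, v.1.1), ?_, ?_⟩, ?_, ?_⟩
  · obtain ⟨⟨x, y, z, c, d, e⟩, hv, hC⟩ := v
    simp only [companionMatrix_invariant_iff] at hC hv ⊢
    obtain ⟨rfl, rfl, rfl, rfl⟩ := hC
    grind
  · have := v.2
    simp only
    grind
  · rw [companionMatrix_invariant_iff]
    simp
  · rintro ⟨⟨x, y, z, c, d, e⟩, hv, hC⟩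
    simp only [companionMatrix_invariant_iff] at hC
    obtain ⟨rfl, rfl, rfl, rfl⟩ := hC
    rfl
  · intro v
    rfl

/-- A matrix whose minimal polynomial has degree four is conjugate to a companion matrix. -/
theorem exists_mul_eq_mul_companionMatrix {t s : F} {g : Matrix (Fin 2 ⊕ Fin 2) (Fin 2 ⊕ Fin 2) F}
    (hg : minpoly F g = palindromicQuartic t s) :
    ∃ P, IsUnit P.det ∧ g * P = P * companionMatrix t s := by
  obtain ⟨v, hv⟩ := g.exists_aeval_mulVec_eq_zero_imp
  rw [hg] at hv
  obtain ⟨e1, e2, e3, e4⟩ := companionMatrix_mulVec t s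
  -- the basis `v, gv, g²v, g³v` for a cyclic vector `v`
  let P : Matrix (Fin 2 ⊕ Fin 2) (Fin 2 ⊕ Fin 2) F :=
    Matrix.of fun i j => Sum.elim ![v, g *ᵥ v] ![g *ᵥ g *ᵥ v, g *ᵥ g *ᵥ g *ᵥ v] j i
  have p0 : P *ᵥ Pi.single (.inl 0) 1 = v := by ext; simp [P]
  have p1 : P *ᵥ Pi.single (.inl 1) 1 = g *ᵥ v := by ext; simp [P]
  have p2 : P *ᵥ Pi.single (.inr 0) 1 = g *ᵥ g *ᵥ v := by ext; simp [P]
  have p3 : P *ᵥ Pi.single (.inr 1) 1 = g *ᵥ g *ᵥ g *ᵥ v := by ext; simp [P]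
  refine ⟨P, ?_, ?_⟩
  · rw [isUnit_iff_ne_zero, Ne, ← exists_mulVec_eq_zero_iff]
    rintro ⟨w, hw, hPw⟩
    apply hw
    have hw' : w = w (.inl 0) • Pi.single (.inl 0) 1 + w (.inl 1) • Pi.single (.inl 1) 1 +
        w (.inr 0) • Pi.single (.inr 0) 1 + w (.inr 1) • Pi.single (.inr 1) 1 := by
      ext i
      rcases i with i | i <;> fin_cases i <;> simp
    rw [hw'] at hPw
    simp only [mulVec_add, mulVec_smul, p0, p1, p2, p3] at hPw
    set f : F[X] := C (w (.inl 0)) + C (w (.inl 1)) * X + C (w (.inr 0)) * X ^ 2 +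
      C (w (.inr 1)) * X ^ 3 with hf
    have hfd : f.degree < 4 := by
      rw [hf]
      refine lt_of_le_of_lt (b := ((3 : ℕ) : WithBot ℕ)) ?_ (by norm_num)
      compute_degree
      exact le_rfl
    have hdvd := hv f (by
      rw [← hPw, hf]
      simp [add_mulVec, pow_succ, ← mulVec_mulVec, Algebra.algebraMap_eq_smul_one, smul_mulVec])
    have hf0 : f = 0 := by
      apply Polynomial.eq_zero_of_dvd_of_degree_lt hdvd
      rw [degree_eq_natDegree (palindromicQuartic_monic t s).ne_zero, palindromicQuartic_natDegree]
      exact hfd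
    have c0 := congrArg (coeff · 0) hf0
    have c1 := congrArg (coeff · 1) hf0
    have c2 := congrArg (coeff · 2) hf0
    have c3 := congrArg (coeff · 3) hf0
    simp [hf, coeff_X, coeff_C, coeff_X_pow] at c0 c1 c2 c3
    rw [hw', c0, c1, c2, c3]
    simp
  · apply ext_mulVec_single <;> simp only [← mulVec_mulVec, e1, e2, e3, e4, p0, p1, p2, p3]
    have := minpoly.aeval F g
    rw [hg] at this
    have h0 := congrArg (· *ᵥ v) this
    simp [palindromicQuartic, add_mulVec, pow_succ, ← mulVec_mulVec,
      Algebra.algebraMap_eq_smul_one, smul_mulVec] at h0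
    simp only [mulVec_add, mulVec_smul, p0, p1, p2, p3]
    have h2 : (2 : F) = 0 := CharTwo.two_eq_zero
    ext i
    have := congrFun h0 i
    simp at this ⊢
    grind

theorem minpoly_companionMatrix (t s : F) :
    minpoly F (companionMatrix t s) = palindromicQuartic t s := by
  refine eq_of_monic_of_associated (minpoly.monic (Algebra.IsIntegral.isIntegral _))
    (palindromicQuartic_monic t s) (associated_of_dvd_dvd
      (minpoly.dvd _ _ (aeval_companionMatrix t s)) ?_)
  rw [← AdjoinRoot.mk_eq_zero]
  apply companionHom_injective t s
  rw [companionHom_mk, minpoly.aeval, map_zero]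

/-- The number of regular symplectic elements with a given minimal polynomial: the centralizer of
the companion matrix is the unit group of `F[X]/(p)`, and its invariant forms are parametrized by
the pairs at which a binary quadratic form does not vanish. -/
theorem card_minpoly_eq_palindromicQuartic_mul [Finite F] (t s : F) :
    Nat.card {g : symplecticGroup (Fin 2) F //
        minpoly F (g : Matrix (Fin 2 ⊕ Fin 2) (Fin 2 ⊕ Fin 2) F) = palindromicQuartic t s} *
      Nat.card (AdjoinRoot (palindromicQuartic t s))ˣ =
    Nat.card {v : F × F // v.2 ^ 2 + t * v.2 * v.1 + s * v.1 ^ 2 ≠ 0} *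
      Nat.card (symplecticGroup (Fin 2) F) := by
  rw [← card_invariantForms_companionMatrix, ← card_invertibleCentralizer_companionMatrix,
    ← card_symplecticSimilar_mul]
  congr 1
  refine Nat.card_congr (Equiv.subtypeEquivRight fun g => ?_)
  constructor
  · intro h
    exact exists_mul_eq_mul_companionMatrix h
  · rintro ⟨P, hP, h⟩
    exact (minpoly_eq_of_mul_eq_mul hP h).trans (minpoly_companionMatrix t s)

end

/-! ### Units of quotients of `F[X]` -/

theorem card_units_adjoinRoot_mul {F : Type*} [Field F] {f g : F[X]} (h : IsCoprime f g) :
    Nat.card (AdjoinRoot (f * g))ˣ = Nat.card (AdjoinRoot f)ˣ * Nat.card (AdjoinRoot g)ˣ := by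
  have hc : IsCoprime (Ideal.span {f}) (Ideal.span {g}) :=
    (Ideal.isCoprime_span_singleton_iff f g).mpr h
  have e1 : (F[X] ⧸ Ideal.span {f * g}) ≃+* (F[X] ⧸ Ideal.span {f}) × (F[X] ⧸ Ideal.span {g}) :=
    (Ideal.quotEquivOfEq (Ideal.span_singleton_mul_span_singleton f g).symm).trans
      (Ideal.quotientMulEquivQuotientProd _ _ hc)
  change Nat.card (F[X] ⧸ Ideal.span {f * g})ˣ =
    Nat.card (F[X] ⧸ Ideal.span {f})ˣ * Nat.card (F[X] ⧸ Ideal.span {g})ˣ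
  rw [← Nat.card_prod]
  exact Nat.card_congr ((Units.mapEquiv e1.toMulEquiv).trans MulEquiv.prodUnits).toEquiv

theorem card_adjoinRoot {F : Type*} [Field F] [Finite F] {f : F[X]} (hf : f ≠ 0) :
    Finite (AdjoinRoot f) ∧ Nat.card (AdjoinRoot f) = Nat.card F ^ f.natDegree := by
  have pb := AdjoinRoot.powerBasis hf
  have : Module.Finite F (AdjoinRoot f) := pb.finite
  have h1 : Finite (AdjoinRoot f) := Module.finite_of_finite F
  refine ⟨h1, ?_⟩
  rw [Module.natCard_eq_pow_finrank (K := F), (AdjoinRoot.powerBasis hf).finrank,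
    AdjoinRoot.powerBasis_dim]

/-- An element of `F[X]/(f ^ (k + 1))` is a unit exactly if its image in the field `F[X]/(f)` is
non-zero. -/
theorem card_units_adjoinRoot_pow {F : Type*} [Field F] [Finite F] {f : F[X]}
    (hf : Irreducible f) (k : ℕ) :
    Nat.card (AdjoinRoot (f ^ (k + 1)))ˣ =
      (Nat.card F ^ f.natDegree - 1) * Nat.card F ^ (k * f.natDegree) := by
  have := Fact.mk hf
  obtain ⟨hf1, hc1⟩ := card_adjoinRoot hf.ne_zero
  obtain ⟨hf2, hc2⟩ := card_adjoinRoot (pow_ne_zero (k + 1) hf.ne_zero)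
  let φ : AdjoinRoot (f ^ (k + 1)) →+* AdjoinRoot f :=
    Ideal.Quotient.factor (Ideal.span_singleton_le_span_singleton.mpr (dvd_pow_self f k.succ_ne_zero))
  have hφ : ∀ h : F[X], φ (AdjoinRoot.mk _ h) = AdjoinRoot.mk f h := fun h => rfl
  have hs : Function.Surjective φ := fun b => by
    obtain ⟨h, rfl⟩ := AdjoinRoot.mk_surjective b
    exact ⟨_, hφ h⟩
  have hfib : ∀ b, Nat.card {a // φ a = b} = Nat.card (RingHom.ker φ) := by
    intro b
    obtain ⟨w, rfl⟩ := hs b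
    exact Nat.card_congr ⟨fun v => ⟨v.1 - w, by simp [RingHom.mem_ker, v.2]⟩,
      fun v => ⟨v.1 + w, by rw [map_add, (RingHom.mem_ker).mp v.2, zero_add]⟩,
      fun v => by simp, fun v => by simp⟩
  have hu : ∀ a, IsUnit a ↔ φ a ≠ 0 := by
    intro a
    refine ⟨fun h => (h.map φ).ne_zero, fun h => ?_⟩
    obtain ⟨p, rfl⟩ := AdjoinRoot.mk_surjective a
    rw [hφ, Ne, AdjoinRoot.mk_eq_zero, ← hf.coprime_iff_not_dvd] at h
    obtain ⟨u, v, huv⟩ := (IsCoprime.pow_left h : IsCoprime (f ^ (k + 1)) p)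
    refine IsUnit.of_mul_eq_one (AdjoinRoot.mk _ v) ?_
    rw [← map_mul, ← map_one (AdjoinRoot.mk _), ← huv, mul_comm p, AdjoinRoot.mk_eq_mk]
    exact ⟨-u, by ring⟩
  have h1 := Nat.card_eq_mul_of_card_fiber φ _ hfib
  have h2 : Nat.card (AdjoinRoot (f ^ (k + 1)))ˣ =
      Nat.card {x : AdjoinRoot f // x ≠ 0} * Nat.card (RingHom.ker φ) := by
    have e : Nat.card (AdjoinRoot (f ^ (k + 1)))ˣ = Nat.card {a // φ a ≠ 0} :=
      Nat.card_congr ⟨fun a => ⟨a, (hu _).mp a.isUnit⟩, fun a => ((hu _).mpr a.2).unit,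
        fun a => Units.ext rfl, fun a => rfl⟩
    rw [e]
    apply Nat.card_eq_mul_of_card_fiber (fun v => (⟨φ v.1, v.2⟩ : {x : AdjoinRoot f // x ≠ 0}))
    rintro ⟨b, hb⟩
    rw [← hfib b]
    exact Nat.card_congr ⟨fun v => ⟨v.1.1, congrArg Subtype.val v.2⟩,
      fun v => ⟨⟨v.1, by rw [v.2]; exact hb⟩, Subtype.ext v.2⟩, fun v => by simp, fun v => by simp⟩
  rw [card_ne_zero, hc1] at h2
  rw [hc1, hc2, natDegree_pow] at h1
  rw [h2]
  congr 1
  apply Nat.eq_of_mul_eq_mul_left (pow_pos Nat.card_pos f.natDegree : 0 < Nat.card F ^ f.natDegree)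
  rw [← h1, ← pow_add]
  ring_nf

theorem card_units_adjoinRoot {F : Type*} [Field F] [Finite F] {f : F[X]}
    (hf : Irreducible f) :
    Nat.card (AdjoinRoot f)ˣ = Nat.card F ^ f.natDegree - 1 := by
  have := card_units_adjoinRoot_pow hf 0
  rwa [zero_add, pow_one, zero_mul, pow_zero, mul_one] at this

/-! ### Counting the values of a binary quadratic form -/

section
variable {F : Type*} [Field F]

theorem card_quadratic_ne_zero_of_no_root [Finite F] {t s : F}
    (h : ∀ x : F, x ^ 2 + t * x + s ≠ 0) :
    Nat.card {v : F × F // v.2 ^ 2 + t * v.2 * v.1 + s * v.1 ^ 2 ≠ 0} = Nat.card F ^ 2 - 1 := by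
  have : ∀ v : F × F, v.2 ^ 2 + t * v.2 * v.1 + s * v.1 ^ 2 ≠ 0 ↔ v ≠ 0 := by
    rintro ⟨a, b⟩
    constructor
    · intro h h0
      simp [Prod.mk_eq_zero.mp h0] at h
    · intro hv h0
      simp only at h0
      by_cases ha : a = 0
      · subst ha
        simp at h0
        simp [h0] at hv
      · apply h (b / a)
        field_simp
        linear_combination h0
  rw [Nat.card_congr (Equiv.subtypeEquivRight this)]
  have := Fintype.ofFinite F
  classical
  rw [Nat.card_eq_fintype_card, Fintype.card_subtype_compl]
  simp
  ring_nf

/-- The monic self-reciprocal quadratic `X² + yX + 1`. -/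
noncomputable def palindromicQuadratic {F : Type*} [CommRing F] (y : F) : F[X] :=
  X ^ 2 + C y * X + 1

theorem palindromicQuadratic_monic (y : F) : (palindromicQuadratic y).Monic := by
  unfold palindromicQuadratic
  monicity!

theorem palindromicQuadratic_natDegree (y : F) : (palindromicQuadratic y).natDegree = 2 := by
  unfold palindromicQuadratic
  compute_degree!

theorem isCoprime_palindromicQuadratic {y z : F} (h : y ≠ z) :
    IsCoprime (palindromicQuadratic y) (palindromicQuadratic z) := by
  have hyz : y - z ≠ 0 := sub_ne_zero.mpr h
  have hC : C (y - z)⁻¹ * (C y - C z) = 1 := by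
    rw [← C_sub, ← C_mul, inv_mul_cancel₀ hyz, C_1]
  refine ⟨1 - C (y - z)⁻¹ * (X + C y), C (y - z)⁻¹ * (X + C y), ?_⟩
  simp only [palindromicQuadratic]
  linear_combination (-X * (X + C y)) * hC

variable [CharP F 2]

theorem card_quadratic_ne_zero_of_ne [Finite F] {y z : F} (h : y ≠ z) :
    Nat.card {v : F × F // v.2 ^ 2 + (y + z) * v.2 * v.1 + (y * z) * v.1 ^ 2 ≠ 0} =
      (Nat.card F - 1) ^ 2 := by
  have h2 : (2 : F) = 0 := CharTwo.two_eq_zero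
  have hyz : y + z ≠ 0 := fun h' => h (by grind)
  rw [sq, ← card_ne_zero, ← Nat.card_prod]
  have hfac : ∀ a b : F, b ^ 2 + (y + z) * b * a + (y * z) * a ^ 2 = (b + y * a) * (b + z * a) :=
    fun a b => by ring
  refine Nat.card_congr ⟨fun v => (⟨v.1.2 + y * v.1.1, ?_⟩, ⟨v.1.2 + z * v.1.1, ?_⟩),
    fun w => ⟨((w.1.1 + w.2.1) / (y + z), (z * w.1.1 + y * w.2.1) / (y + z)), ?_⟩, ?_, ?_⟩
  · have := v.2; rw [hfac] at this; exact left_ne_zero_of_mul this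
  · have := v.2; rw [hfac] at this; exact right_ne_zero_of_mul this
  · rw [hfac]
    refine mul_ne_zero ?_ ?_
    · convert w.1.2 using 1
      field_simp
      grind
    · convert w.2.2 using 1
      field_simp
      grind
  · rintro ⟨⟨a, b⟩, h⟩
    simp only [Subtype.mk.injEq, Prod.mk.injEq]
    constructor <;> field_simp <;> grind
  · rintro ⟨⟨a, ha⟩, ⟨b, hb⟩⟩
    simp only [Subtype.mk.injEq, Prod.mk.injEq]
    constructor <;> field_simp <;> grind

theorem card_quadratic_ne_zero_of_eq [Finite F] (y : F) :
    Nat.card {v : F × F // v.2 ^ 2 + (y + y) * v.2 * v.1 + (y * y) * v.1 ^ 2 ≠ 0} =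
      Nat.card F * (Nat.card F - 1) := by
  have h2 : (2 : F) = 0 := CharTwo.two_eq_zero
  rw [← card_ne_zero, ← Nat.card_prod]
  have hfac : ∀ a b : F, b ^ 2 + (y + y) * b * a + (y * y) * a ^ 2 = (b + y * a) * (b + y * a) :=
    fun a b => by ring
  refine Nat.card_congr ⟨fun v => (v.1.1, ⟨v.1.2 + y * v.1.1, ?_⟩),
    fun w => ⟨(w.1, w.2.1 + y * w.1), ?_⟩, ?_, ?_⟩
  · have := v.2; rw [hfac] at this; exact left_ne_zero_of_mul this
  · have : w.2.1 + y * w.1 + y * w.1 = w.2.1 := by grind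
    rw [hfac, this]
    exact mul_ne_zero w.2.2 w.2.2
  · rintro ⟨⟨a, b⟩, h⟩
    simp only [Subtype.mk.injEq, Prod.mk.injEq, true_and]
    grind
  · rintro ⟨a, ⟨b, hb⟩⟩
    simp only [Subtype.mk.injEq, Prod.mk.injEq, true_and]
    grind

theorem palindromicQuadratic_mul (y z : F) :
    palindromicQuadratic y * palindromicQuadratic z = palindromicQuartic (y + z) (y * z) := by
  have h2 : (2 : F[X]) = 0 := CharTwo.two_eq_zero
  simp only [palindromicQuadratic, palindromicQuartic, map_add, map_mul]
  linear_combination (X ^ 2) * h2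

end

/-! ### Frobenius conjugates -/

section
variable {F K : Type*} [Field F] [Finite F] [Field K] [Algebra F K]

theorem aeval_pow_card_eq_zero {f : F[X]} {a : K} (h : aeval a f = 0) :
    aeval (a ^ Nat.card F) f = 0 := by
  have := Fintype.ofFinite F
  rw [Nat.card_eq_fintype_card]
  have h1 := aeval_algHom_apply (FiniteField.frobeniusAlgHom F K) a f
  rw [h, map_zero] at h1
  exact h1

theorem exists_algebraMap_eq_of_pow_card_eq {x : K} (h : x ^ Nat.card F = x) :
    ∃ a : F, algebraMap F K a = x := by
  have := Fintype.ofFinite F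
  have hcard : 1 < Fintype.card F := Fintype.one_lt_card
  have hm : (X ^ Fintype.card F - X : F[X]).Monic :=
    monic_X_pow_sub (by rw [degree_X]; exact_mod_cast hcard)
  have h1 := prod_multiset_X_sub_C_of_monic_of_roots_card_eq hm (by
    rw [FiniteField.roots_X_pow_card_sub_X, FiniteField.X_pow_card_sub_X_natDegree_eq F hcard]
    rfl)
  rw [FiniteField.roots_X_pow_card_sub_X] at h1
  have h2 := congrArg (aeval x) h1
  rw [Nat.card_eq_fintype_card] at h
  simp only [map_sub, map_pow, aeval_X, h, sub_self] at h2
  change aeval x (∏ a : F, (X - C a)) = 0 at h2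
  rw [map_prod, Finset.prod_eq_zero_iff] at h2
  obtain ⟨a, -, ha⟩ := h2
  refine ⟨a, ?_⟩
  simp at ha
  exact (sub_eq_zero.mp ha).symm

theorem algebraMap_pow_card (a : F) :
    (algebraMap F K a) ^ Nat.card F = algebraMap F K a := by
  have := Fintype.ofFinite F
  rw [Nat.card_eq_fintype_card, ← map_pow, FiniteField.pow_card]

/-- A monic polynomial of degree `n` over `F` is irreducible if it has a root `a` such that `a,
a^q, …, a^(q^(n-1))` are distinct, because these are all roots of the minimal polynomial. -/
theorem irreducible_of_conjugates_injOn {f : F[X]} (hf : f.Monic) {a : K} (ha : aeval a f = 0)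
    (hinj : Set.InjOn (fun i : ℕ => a ^ Nat.card F ^ i) (Finset.range f.natDegree)) :
    Irreducible f := by
  classical
  have hint : IsIntegral F a := ⟨f, hf, by rwa [← aeval_def]⟩
  have hr : ∀ i : ℕ, aeval (a ^ Nat.card F ^ i) (minpoly F a) = 0 := by
    intro i
    induction i with
    | zero => simp
    | succ i ih => rw [pow_succ, pow_mul]; exact aeval_pow_card_eq_zero ih
  have hne : minpoly F a ≠ 0 := minpoly.ne_zero hint
  have hle : f.natDegree ≤ (minpoly F a).natDegree := by
    calc f.natDegree = ((Finset.range f.natDegree).image (fun i : ℕ => a ^ Nat.card F ^ i)).card := by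
          rw [Finset.card_image_of_injOn hinj, Finset.card_range]
      _ ≤ ((minpoly F a).map (algebraMap F K)).roots.toFinset.card := by
          apply Finset.card_le_card
          intro x hx
          obtain ⟨i, -, rfl⟩ := Finset.mem_image.mp hx
          rw [Multiset.mem_toFinset, mem_roots (map_ne_zero hne), IsRoot.def, eval_map_algebraMap]
          exact hr i
      _ ≤ _ := Multiset.toFinset_card_le _
      _ ≤ _ := card_roots' _
      _ = _ := natDegree_map _
  have := eq_of_monic_of_dvd_of_natDegree_le (minpoly.monic hint) hf (minpoly.dvd F a ha) hle
  rw [this]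
  exact minpoly.irreducible hint

end

/-! ### The symplectic form and orthogonal decompositions -/

section
variable {F : Type*} [Field F]

/-- The standard symplectic form on `F⁴`. -/
def symplForm (u v : Fin 2 ⊕ Fin 2 → F) : F := u ⬝ᵥ (J (Fin 2) F *ᵥ v)

theorem symplForm_add_left (u u' v : Fin 2 ⊕ Fin 2 → F) :
    symplForm (u + u') v = symplForm u v + symplForm u' v := add_dotProduct _ _ _

theorem symplForm_add_right (u v v' : Fin 2 ⊕ Fin 2 → F) :
    symplForm u (v + v') = symplForm u v + symplForm u v' := by
  simp [symplForm, mulVec_add]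

theorem symplForm_smul_left (a : F) (u v : Fin 2 ⊕ Fin 2 → F) :
    symplForm (a • u) v = a * symplForm u v := by
  simp [symplForm]

theorem symplForm_smul_right (a : F) (u v : Fin 2 ⊕ Fin 2 → F) :
    symplForm u (a • v) = a * symplForm u v := by
  simp [symplForm, mulVec_smul]

theorem symplForm_self (u : Fin 2 ⊕ Fin 2 → F) : symplForm u u = 0 := by
  simp [symplForm, J, dotProduct, mulVec]
  ring

theorem symplForm_mulVec (g : symplecticGroup (Fin 2) F) (u v : Fin 2 ⊕ Fin 2 → F) :
    symplForm (g.1 *ᵥ u) (g.1 *ᵥ v) = symplForm u v := by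
  have := SymplecticGroup.mem_iff'.mp g.2
  conv_rhs => rw [symplForm, ← this]
  rw [symplForm, ← vecMul_transpose, ← dotProduct_mulVec, mulVec_mulVec, mulVec_mulVec]

theorem eq_zero_of_symplForm_eq_zero {v : Fin 2 ⊕ Fin 2 → F} (h : ∀ u, symplForm u v = 0) :
    v = 0 := by
  have h1 : J (Fin 2) F *ᵥ v = 0 := dotProduct_eq_zero _ fun u => by
    rw [dotProduct_comm]; exact h u
  have h2 : IsUnit (J (Fin 2) F) := (isUnit_iff_isUnit_det _).mpr (isUnit_det_J _ _)
  exact (mulVec_injective_iff_isUnit.mpr h2) (by rw [h1, mulVec_zero])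

theorem eq_zero_of_symplForm_mulVec_eq_zero {M : Matrix (Fin 2 ⊕ Fin 2) (Fin 2 ⊕ Fin 2) F}
    (h : ∀ u v, symplForm u (M *ᵥ v) = 0) : M = 0 := by
  apply ext_mulVec_single <;> rw [zero_mulVec] <;>
    exact eq_zero_of_symplForm_eq_zero fun u => h u _

theorem symplForm_mulVec_eq_zero_of_orthogonal {y : F} {g : symplecticGroup (Fin 2) F}
    {v w : Fin 2 ⊕ Fin 2 → F} (hv : g.1 *ᵥ g.1 *ᵥ v + y • g.1 *ᵥ v + v = 0)
    (h1 : symplForm v w = 0) (h2 : symplForm (g.1 *ᵥ v) w = 0) :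
    symplForm v (g.1 *ᵥ w) = 0 ∧ symplForm (g.1 *ᵥ v) (g.1 *ᵥ w) = 0 := by
  have h6 := congrArg (symplForm · (g.1 *ᵥ w)) hv
  simp only [symplForm_add_left, symplForm_smul_left, symplForm_mulVec, h1, h2] at h6
  have h7 : symplForm (0 : Fin 2 ⊕ Fin 2 → F) (g.1 *ᵥ w) = 0 := by simp [symplForm]
  refine ⟨by simpa [h7] using h6, by rw [symplForm_mulVec, h1]⟩

/-- The matrix with the four given columns. -/
def ofColumns (v₁ v₂ v₃ v₄ : Fin 2 ⊕ Fin 2 → F) : Matrix (Fin 2 ⊕ Fin 2) (Fin 2 ⊕ Fin 2) F :=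
  Matrix.of fun i j => Sum.elim ![v₁, v₂] ![v₃, v₄] j i

theorem ofColumns_mulVec_single (v₁ v₂ v₃ v₄ : Fin 2 ⊕ Fin 2 → F) :
    ofColumns v₁ v₂ v₃ v₄ *ᵥ Pi.single (.inl 0) 1 = v₁ ∧
    ofColumns v₁ v₂ v₃ v₄ *ᵥ Pi.single (.inl 1) 1 = v₂ ∧
    ofColumns v₁ v₂ v₃ v₄ *ᵥ Pi.single (.inr 0) 1 = v₃ ∧
    ofColumns v₁ v₂ v₃ v₄ *ᵥ Pi.single (.inr 1) 1 = v₄ := by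
  refine ⟨?_, ?_, ?_, ?_⟩ <;> ext <;> simp [ofColumns]

theorem transpose_mul_J_mul_apply (P : Matrix (Fin 2 ⊕ Fin 2) (Fin 2 ⊕ Fin 2) F) (i j : Fin 2 ⊕ Fin 2) :
    (Pᵀ * J (Fin 2) F * P) i j = symplForm (P *ᵥ Pi.single i 1) (P *ᵥ Pi.single j 1) := by
  simp only [symplForm, mulVec_single_one, Matrix.mul_assoc]
  rw [Matrix.mul_apply']
  congr 1

/-- The companion matrix of `X² + yX + 1` in characteristic two. -/
def quadCompanion (y : F) : Matrix (Fin 2) (Fin 2) F := !![0, 1; 1, y]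

theorem fromBlocks_quadCompanion_mulVec (y : F) (D : Matrix (Fin 2) (Fin 2) F) :
    fromBlocks (quadCompanion y) 0 0 D *ᵥ Pi.single (.inl 0) 1 = Pi.single (.inl 1) 1 ∧
    fromBlocks (quadCompanion y) 0 0 D *ᵥ Pi.single (.inl 1) 1 =
      Pi.single (.inl 0) 1 + y • Pi.single (.inl 1) 1 ∧
    fromBlocks (quadCompanion y) 0 0 D *ᵥ Pi.single (.inr 0) 1 =
      D 0 0 • Pi.single (.inr 0) 1 + D 1 0 • Pi.single (.inr 1) 1 ∧
    fromBlocks (quadCompanion y) 0 0 D *ᵥ Pi.single (.inr 1) 1 =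
      D 0 1 • Pi.single (.inr 0) 1 + D 1 1 • Pi.single (.inr 1) 1 := by
  refine ⟨?_, ?_, ?_, ?_⟩ <;>
  · ext i
    rcases i with i | i <;> fin_cases i <;> simp [quadCompanion]

theorem trace_eq_of_mul_eq_mul {g P C : Matrix (Fin 2 ⊕ Fin 2) (Fin 2 ⊕ Fin 2) F}
    (hP : IsUnit P.det) (h : g * P = P * C) : g.trace = C.trace := by
  have : g = P * C * P⁻¹ := by rw [← h, mul_nonsing_inv_cancel_right _ _ hP]
  rw [this, Matrix.trace_mul_comm, ← Matrix.mul_assoc, nonsing_inv_mul _ hP, one_mul]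

variable [CharP F 2]

theorem symplForm_comm (u v : Fin 2 ⊕ Fin 2 → F) : symplForm u v = symplForm v u := by
  have h := symplForm_self (u + v)
  rw [symplForm_add_left, symplForm_add_right, symplForm_add_right, symplForm_self,
    symplForm_self] at h
  have h2 : (2 : F) = 0 := CharTwo.two_eq_zero
  grind

/-- A hyperbolic pair `v₁, v₂` and a hyperbolic pair in its orthogonal complement form a basis. -/
theorem isUnit_det_ofColumns {v₁ v₂ v₃ v₄ : Fin 2 ⊕ Fin 2 → F}
    (h12 : symplForm v₁ v₂ ≠ 0) (h13 : symplForm v₁ v₃ = 0) (h14 : symplForm v₁ v₄ = 0)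
    (h23 : symplForm v₂ v₃ = 0) (h24 : symplForm v₂ v₄ = 0) (h34 : symplForm v₃ v₄ ≠ 0) :
    IsUnit (ofColumns v₁ v₂ v₃ v₄).det := by
  obtain ⟨e1, e2, e3, e4⟩ := ofColumns_mulVec_single v₁ v₂ v₃ v₄
  set P := ofColumns v₁ v₂ v₃ v₄
  have h : Pᵀ * J (Fin 2) F * P = altMatrix (symplForm v₁ v₂) 0 0 0 0 (symplForm v₃ v₄) := by
    have e : ∀ i j, (Pᵀ * J (Fin 2) F * P) i j = _ := transpose_mul_J_mul_apply P
    ext i j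
    rw [e]
    rcases i with i | i <;> rcases j with j | j <;> fin_cases i <;> fin_cases j <;>
      simp only [Fin.zero_eta, Fin.mk_one, e1, e2, e3, e4] <;>
      simp [altMatrix, symplForm_self, h13, h14, h23, h24, CharTwo.neg_eq, symplForm_comm v₂ v₁,
        symplForm_comm v₃ v₁, symplForm_comm v₃ v₂, symplForm_comm v₄ v₁, symplForm_comm v₄ v₂,
        symplForm_comm v₄ v₃]
  have hd := congrArg Matrix.det h
  rw [det_altMatrix, det_mul] at hd
  have : IsUnit ((Pᵀ * J (Fin 2) F).det * P.det) := by
    rw [hd]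
    simp [h12, h34]
  exact isUnit_of_mul_isUnit_right this

/-- The orthogonal complement of a hyperbolic pair contains a hyperbolic pair. -/
theorem exists_orthogonal_pair {v₁ v₂ : Fin 2 ⊕ Fin 2 → F} (h12 : symplForm v₁ v₂ ≠ 0) :
    ∃ v₃ v₄ : Fin 2 ⊕ Fin 2 → F, symplForm v₁ v₃ = 0 ∧ symplForm v₁ v₄ = 0 ∧
      symplForm v₂ v₃ = 0 ∧ symplForm v₂ v₄ = 0 ∧ symplForm v₃ v₄ = 1 := by
  have h2 : (2 : F) = 0 := CharTwo.two_eq_zero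
  let φ : (Fin 2 ⊕ Fin 2 → F) →ₗ[F] F × F :=
    { toFun := fun x => (symplForm v₁ x, symplForm v₂ x)
      map_add' := fun x y => by simp [symplForm_add_right]
      map_smul' := fun a x => by simp [symplForm_smul_right] }
  have hk : LinearMap.ker φ ≠ ⊥ := LinearMap.ker_ne_bot_of_finrank_lt (by simp)
  obtain ⟨w, hw, hw0⟩ := Submodule.exists_mem_ne_zero_of_ne_bot hk
  obtain ⟨hw1, hw2⟩ : symplForm v₁ w = 0 ∧ symplForm v₂ w = 0 := by
    simpa [φ] using hw
  obtain ⟨x, hx⟩ : ∃ x, symplForm x w ≠ 0 := by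
    by_contra! h
    exact hw0 (eq_zero_of_symplForm_eq_zero h)
  refine ⟨w, (symplForm x w)⁻¹ • (x + ((symplForm v₂ x / symplForm v₁ v₂) • v₁ +
    (symplForm v₁ x / symplForm v₁ v₂) • v₂)), hw1, ?_, hw2, ?_, ?_⟩
  · simp only [symplForm_smul_right, symplForm_add_right, symplForm_self]
    field_simp
    grind
  · simp only [symplForm_smul_right, symplForm_add_right, symplForm_self, symplForm_comm v₂ v₁]
    field_simp
    grind
  · simp only [symplForm_smul_right, symplForm_add_right, symplForm_comm w v₁, symplForm_comm w v₂,
      symplForm_comm w x, hw1, hw2]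
    field_simp
    simp

/-- Coordinates in the orthogonal complement of a hyperbolic pair. -/
theorem eq_of_orthogonal_pair {v₁ v₂ v₃ v₄ x : Fin 2 ⊕ Fin 2 → F}
    (h12 : symplForm v₁ v₂ ≠ 0) (h13 : symplForm v₁ v₃ = 0) (h14 : symplForm v₁ v₄ = 0)
    (h23 : symplForm v₂ v₃ = 0) (h24 : symplForm v₂ v₄ = 0) (h34 : symplForm v₃ v₄ = 1)
    (hx1 : symplForm v₁ x = 0) (hx2 : symplForm v₂ x = 0) :
    x = symplForm x v₄ • v₃ + symplForm v₃ x • v₄ := by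
  have h2 : (2 : F) = 0 := CharTwo.two_eq_zero
  have hP : IsUnit (ofColumns v₁ v₂ v₃ v₄).det :=
    isUnit_det_ofColumns h12 h13 h14 h23 h24 (by rw [h34]; exact one_ne_zero)
  obtain ⟨e1, e2, e3, e4⟩ := ofColumns_mulVec_single v₁ v₂ v₃ v₄
  set P := ofColumns v₁ v₂ v₃ v₄
  rw [← sub_eq_zero, CharTwo.sub_eq_add]
  set z := x + (symplForm x v₄ • v₃ + symplForm v₃ x • v₄) with hz
  have z1 : symplForm v₁ z = 0 := by
    simp [hz, symplForm_add_right, symplForm_smul_right, hx1, h13, h14]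
  have z2 : symplForm v₂ z = 0 := by
    simp [hz, symplForm_add_right, symplForm_smul_right, hx2, h23, h24]
  have z3 : symplForm v₃ z = 0 := by
    simp only [hz, symplForm_add_right, symplForm_smul_right, symplForm_self, h34]
    grind
  have z4 : symplForm v₄ z = 0 := by
    simp only [hz, symplForm_add_right, symplForm_smul_right, symplForm_self, h34,
      symplForm_comm v₄ v₃, symplForm_comm v₄ x]
    grind
  apply eq_zero_of_symplForm_eq_zero
  intro u
  obtain ⟨w, rfl⟩ := (mulVec_surjective_iff_isUnit.mpr ((isUnit_iff_isUnit_det _).mpr hP)) u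
  have hw' : w = w (.inl 0) • Pi.single (.inl 0) 1 + w (.inl 1) • Pi.single (.inl 1) 1 +
      w (.inr 0) • Pi.single (.inr 0) 1 + w (.inr 1) • Pi.single (.inr 1) 1 := by
    ext i
    rcases i with i | i <;> fin_cases i <;> simp
  rw [hw']
  simp only [mulVec_add, mulVec_smul, e1, e2, e3, e4, symplForm_add_left, symplForm_smul_left,
    z1, z2, z3, z4]
  simp

/-! ### The semisimple elements that are not regular -/

/-- The form `⟨w, g w⟩` is quadratic in `w` with polarization `y ⟨w, w'⟩`, so it does not vanish
identically on a plane that is not totally isotropic. -/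
theorem exists_symplForm_mulVec_ne_zero {y : F} (hy : y ≠ 0) {g : symplecticGroup (Fin 2) F}
    (hg : g.1 * g.1 + y • g.1 + 1 = 0) {w w' : Fin 2 ⊕ Fin 2 → F} (hw : symplForm w w' ≠ 0) :
    symplForm w (g.1 *ᵥ w) ≠ 0 ∨ symplForm w' (g.1 *ᵥ w') ≠ 0 ∨
      symplForm (w + w') (g.1 *ᵥ (w + w')) ≠ 0 := by
  have h2 : (2 : F) = 0 := CharTwo.two_eq_zero
  by_contra! h
  obtain ⟨h1, h2', h3⟩ := h
  rw [mulVec_add, symplForm_add_left, symplForm_add_right, symplForm_add_right, h1, h2'] at h3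
  have h4 : g.1 *ᵥ g.1 *ᵥ w + y • g.1 *ᵥ w + w = 0 := by
    have := congrArg (· *ᵥ w) hg
    simpa [add_mulVec, ← mulVec_mulVec, smul_mulVec] using this
  have h5 : symplForm w' (g.1 *ᵥ w) = symplForm (g.1 *ᵥ g.1 *ᵥ w) (g.1 *ᵥ w') := by
    rw [symplForm_mulVec, symplForm_comm]
  have h6 := congrArg (symplForm · (g.1 *ᵥ w')) h4
  simp only [symplForm_add_left, symplForm_smul_left, ← h5, symplForm_mulVec] at h6
  have h7 : symplForm (0 : Fin 2 ⊕ Fin 2 → F) (g.1 *ᵥ w') = 0 := by simp [symplForm]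
  have h8 : y * symplForm w w' = 0 := by grind
  exact (mul_ne_zero hy hw) h8

/-- Elements with `g² + yg + 1 = 0` form a single class in the general linear group. -/
theorem symplecticSimilar_quadCompanion_quadCompanion {y : F} (hy : y ≠ 0) :
    symplecticSimilar (fromBlocks (quadCompanion y) 0 0 (quadCompanion y)) =
      {g : symplecticGroup (Fin 2) F | g.1 * g.1 + y • g.1 + 1 = 0} := by
  have h2 : (2 : F) = 0 := CharTwo.two_eq_zero
  ext g
  constructor
  · rintro ⟨P, hP, h⟩
    have hU : IsUnit P := (isUnit_iff_isUnit_det _).mpr hP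
    have hC : fromBlocks (quadCompanion y) 0 0 (quadCompanion y) *
        fromBlocks (quadCompanion y) 0 0 (quadCompanion y) +
        y • fromBlocks (quadCompanion y) 0 0 (quadCompanion y) + 1 = 0 := by
      rw [fromBlocks_multiply, fromBlocks_smul, fromBlocks_add, ← fromBlocks_one, fromBlocks_add,
        ← fromBlocks_zero]
      congr 1 <;>
      · ext i j
        fin_cases i <;> fin_cases j <;> simp [quadCompanion] <;> grind
    set C := fromBlocks (quadCompanion y) 0 0 (quadCompanion y)
    have : (g.1 * g.1 + y • g.1 + 1) * P = P * (C * C + y • C + 1) := by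
      rw [add_mul, add_mul, Matrix.mul_assoc, h, ← Matrix.mul_assoc, h, smul_mul, h,
        Matrix.mul_assoc, mul_add, mul_add, Matrix.mul_smul]
      simp
    rw [hC, mul_zero] at this
    exact hU.mul_left_eq_zero.mp this
  · intro hg
    have hg2 : ∀ v, g.1 *ᵥ g.1 *ᵥ v + y • g.1 *ᵥ v + v = 0 := fun v => by
      have := congrArg (· *ᵥ v) hg
      simpa [add_mulVec, ← mulVec_mulVec, smul_mulVec] using this
    have hg3 : ∀ v, g.1 *ᵥ g.1 *ᵥ v = v + y • g.1 *ᵥ v := fun v => by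
      have h3 := hg2 v
      ext i
      have := congrFun h3 i
      simp at this ⊢
      grind
    obtain ⟨u, u', hu⟩ : ∃ u u' : Fin 2 ⊕ Fin 2 → F, symplForm u u' ≠ 0 := by
      by_contra! h
      have h1 := eq_zero_of_symplForm_eq_zero (v := Pi.single (.inl 0) (1 : F)) (fun u => h _ _)
      have := congrFun h1 (.inl 0)
      simp at this
    -- `F⁴` is the orthogonal sum of two `g`-invariant hyperbolic planes `⟨v, g v⟩` and `⟨w, g w⟩`
    obtain ⟨v, hv⟩ : ∃ v, symplForm v (g.1 *ᵥ v) ≠ 0 := by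
      rcases exists_symplForm_mulVec_ne_zero hy hg hu with h | h | h <;> exact ⟨_, h⟩
    obtain ⟨v₃, v₄, h13, h14, h23, h24, h34⟩ := exists_orthogonal_pair hv
    obtain ⟨w, hw, hw1, hw2⟩ : ∃ w, symplForm w (g.1 *ᵥ w) ≠ 0 ∧ symplForm v w = 0 ∧
        symplForm (g.1 *ᵥ v) w = 0 := by
      rcases exists_symplForm_mulVec_ne_zero hy hg (by rw [h34]; exact one_ne_zero) with h | h | h
      · exact ⟨_, h, h13, h23⟩
      · exact ⟨_, h, h14, h24⟩
      · exact ⟨_, h, by rw [symplForm_add_right, h13, h14, add_zero],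
          by rw [symplForm_add_right, h23, h24, add_zero]⟩
    obtain ⟨hw3, hw4⟩ := symplForm_mulVec_eq_zero_of_orthogonal (hg2 v) hw1 hw2
    refine ⟨ofColumns v (g.1 *ᵥ v) w (g.1 *ᵥ w), isUnit_det_ofColumns hv hw1 hw3 hw2 hw4 hw, ?_⟩
    obtain ⟨e1, e2, e3, e4⟩ := ofColumns_mulVec_single v (g.1 *ᵥ v) w (g.1 *ᵥ w)
    obtain ⟨f1, f2, f3, f4⟩ := fromBlocks_quadCompanion_mulVec y (quadCompanion y)
    apply ext_mulVec_single <;>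
      simp only [← mulVec_mulVec, f1, f2, f3, f4, e1, e2, e3, e4, mulVec_add, mulVec_smul] <;>
      simp [quadCompanion, hg3]

/-- If `⟨x, g² x⟩` vanished identically, polarization would give `g⁴ = 1`; but `X⁴ + 1 = (X + 1)⁴`
is coprime to `X² + yX + 1`, which would force `g = 1`. -/
theorem exists_symplForm_sq_mulVec_ne_zero {y : F} (hy : y ≠ 0) {g : symplecticGroup (Fin 2) F}
    (hf : aeval g.1 ((X ^ 2 + C y * X + 1) * (X + 1)) = 0) (h1 : g.1 ≠ 1) :
    ∃ x, symplForm x (g.1 *ᵥ g.1 *ᵥ x) ≠ 0 := by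
  have h2 : (2 : F) = 0 := CharTwo.two_eq_zero
  by_contra! h
  have key : g.1 * g.1 * g.1 * g.1 + 1 = 0 := by
    apply eq_zero_of_symplForm_mulVec_eq_zero
    intro u w
    obtain ⟨u', rfl⟩ : ∃ u', g.1 *ᵥ g.1 *ᵥ u' = u := by
      refine ⟨(g⁻¹).1 *ᵥ (g⁻¹).1 *ᵥ u, ?_⟩
      have e : g.1 * (g⁻¹).1 = 1 := congrArg Subtype.val (mul_inv_cancel g)
      rw [mulVec_mulVec ((g⁻¹).1 *ᵥ u), e, one_mulVec, mulVec_mulVec, e, one_mulVec]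
    have h3 := h (u' + w)
    simp only [mulVec_add, symplForm_add_left, symplForm_add_right, h] at h3
    simp only [add_mulVec, ← mulVec_mulVec, symplForm_add_right, symplForm_mulVec, one_mulVec]
    rw [symplForm_comm _ w]
    grind
  apply h1
  have hk : C y * C y⁻¹ = 1 := by rw [← C_mul, mul_inv_cancel₀ hy, C_1]
  have hX2 : (2 : F[X]) = 0 := CharTwo.two_eq_zero
  -- `X + 1` is the greatest common divisor of `X ^ 4 + 1` and `(X ^ 2 + y X + 1) (X + 1)`
  have bez : (X + 1 : F[X]) = (X ^ 2 + C y * X + 1) * (X + 1) * (C y⁻¹ + C y⁻¹ ^ 2 * (X + 1) ^ 2 +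
      C y⁻¹ * (X + 1) + C y⁻¹ * (X + 1) ^ 2) +
      (X ^ 4 + 1) * (C y⁻¹ * (C y⁻¹ * (X + 1) + 1) + C y⁻¹ + C y⁻¹ * (X + 1) + 1) := by
    grind
  have key' : aeval g.1 (X ^ 4 + 1 : F[X]) = 0 := by
    rw [← key]
    simp [pow_succ]
  have := congrArg (aeval g.1) bez
  rw [map_add, map_add, map_mul, map_mul (aeval g.1) (X ^ 4 + 1 : F[X]), hf, key', zero_mul,
    zero_mul, add_zero, aeval_X, map_one] at this
  ext i j
  have := congrFun (congrFun this i) j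
  simp at this
  grind

set_option maxHeartbeats 800000 in
/-- Elements with `(g + 1)(g² + yg + 1) = 0` and trace `y` form a single class in the general
linear group. -/
theorem symplecticSimilar_quadCompanion_one {y : F} (hy : y ≠ 0) :
    symplecticSimilar (fromBlocks (quadCompanion y) 0 0 1) =
      {g : symplecticGroup (Fin 2) F | (g.1 * g.1 + y • g.1 + 1) * (g.1 + 1) = 0 ∧ g.1.trace = y} := by
  have h2 : (2 : F) = 0 := CharTwo.two_eq_zero
  ext g
  constructor
  · rintro ⟨P, hP, h⟩
    have hU : IsUnit P := (isUnit_iff_isUnit_det _).mpr hP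
    refine ⟨?_, ?_⟩
    · have hC : ((fromBlocks (quadCompanion y) 0 0 1 : Matrix (Fin 2 ⊕ Fin 2) (Fin 2 ⊕ Fin 2) F) *
          fromBlocks (quadCompanion y) 0 0 1 +
          y • fromBlocks (quadCompanion y) 0 0 1 + 1) * (fromBlocks (quadCompanion y) 0 0 1 + 1)
          = 0 := by
        rw [fromBlocks_multiply, fromBlocks_smul, fromBlocks_add, ← fromBlocks_one, fromBlocks_add,
          fromBlocks_add, ← fromBlocks_zero, fromBlocks_multiply]
        congr 1 <;>
        · ext i j
          fin_cases i <;> fin_cases j <;> simp [quadCompanion, Matrix.mul_apply] <;> grind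
      set C : Matrix (Fin 2 ⊕ Fin 2) (Fin 2 ⊕ Fin 2) F := fromBlocks (quadCompanion y) 0 0 1
      have e1 : (g.1 + 1) * P = P * (C + 1) := by rw [add_mul, h, mul_add]; simp
      have e2 : (g.1 * g.1 + y • g.1 + 1) * P = P * (C * C + y • C + 1) := by
        rw [add_mul, add_mul, Matrix.mul_assoc, h, ← Matrix.mul_assoc, h, smul_mul, h,
          Matrix.mul_assoc, mul_add, mul_add, Matrix.mul_smul]
        simp
      have : (g.1 * g.1 + y • g.1 + 1) * (g.1 + 1) * P = 0 := by
        rw [Matrix.mul_assoc, e1, ← Matrix.mul_assoc, e2, Matrix.mul_assoc, hC, mul_zero]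
      exact hU.mul_left_eq_zero.mp this
    · rw [trace_eq_of_mul_eq_mul hP h]
      simp [quadCompanion, Matrix.trace]
      grind
  · rintro ⟨hg, ht⟩
    have hf : aeval g.1 ((X ^ 2 + C y * X + 1) * (X + 1)) = 0 := by
      rw [← hg]
      simp [sq, Algebra.algebraMap_eq_smul_one]
    have hcomm : (g.1 * g.1 * g.1 + y • (g.1 * g.1) + g.1) + (g.1 * g.1 + y • g.1 + 1) = 0 := by
      rw [← hg, mul_add, mul_one, add_mul, add_mul, smul_mul, one_mul]
    obtain ⟨x, hx⟩ := exists_symplForm_sq_mulVec_ne_zero hy hf (by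
      intro h4
      rw [h4, trace_one] at ht
      apply hy
      rw [← ht]
      simp
      grind)
    set v := g.1 *ᵥ x + x with hv
    have hv2 : g.1 *ᵥ g.1 *ᵥ v + y • g.1 *ᵥ v + v = 0 := by
      have := congrArg (· *ᵥ x) hcomm
      simp only [add_mulVec, ← mulVec_mulVec, smul_mulVec, one_mulVec, zero_mulVec] at this
      simp only [hv, mulVec_add, smul_add, ← this]
      abel
    have hvv : symplForm v (g.1 *ᵥ v) ≠ 0 := by
      rw [hv, mulVec_add, symplForm_add_left, symplForm_add_right, symplForm_add_right,
        symplForm_mulVec, symplForm_self]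
      convert hx using 1
      grind
    obtain ⟨v₃, v₄, h13, h14, h23, h24, h34⟩ := exists_orthogonal_pair hvv
    have hP : IsUnit (ofColumns v (g.1 *ᵥ v) v₃ v₄).det :=
      isUnit_det_ofColumns hvv h13 h14 h23 h24 (by rw [h34]; exact one_ne_zero)
    obtain ⟨i3, j3⟩ := symplForm_mulVec_eq_zero_of_orthogonal hv2 h13 h23
    obtain ⟨i4, j4⟩ := symplForm_mulVec_eq_zero_of_orthogonal hv2 h14 h24
    have g3 := eq_of_orthogonal_pair hvv h13 h14 h23 h24 h34 i3 j3
    have g4 := eq_of_orthogonal_pair hvv h13 h14 h23 h24 h34 i4 j4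
    set α := symplForm (g.1 *ᵥ v₃) v₄
    set β := symplForm v₃ (g.1 *ᵥ v₃)
    set γ := symplForm (g.1 *ᵥ v₄) v₄
    set δ := symplForm v₃ (g.1 *ᵥ v₄)
    obtain ⟨e1, e2, e3, e4⟩ := ofColumns_mulVec_single v (g.1 *ᵥ v) v₃ v₄
    have hPD : g.1 * ofColumns v (g.1 *ᵥ v) v₃ v₄ = ofColumns v (g.1 *ᵥ v) v₃ v₄ *
        fromBlocks (quadCompanion y) 0 0 !![α, γ; β, δ] := by
      obtain ⟨f1, f2, f3, f4⟩ := fromBlocks_quadCompanion_mulVec y !![α, γ; β, δ]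
      apply ext_mulVec_single <;>
        simp only [← mulVec_mulVec, f1, f2, f3, f4, e1, e2, e3, e4, mulVec_add, mulVec_smul]
      · ext i
        have := congrFun hv2 i
        simp at this ⊢
        grind
      · simpa using g3
      · simpa using g4
    have htr := trace_eq_of_mul_eq_mul hP hPD
    rw [ht] at htr
    simp [quadCompanion, Matrix.trace] at htr
    have hαδ : α = δ := by grind
    have hdet : α * δ + β * γ = 1 := by
      have h5 : symplForm (g.1 *ᵥ v₃) (g.1 *ᵥ v₄) = 1 := by rw [symplForm_mulVec, h34]
      rw [g3, g4] at h5
      simp only [symplForm_add_left, symplForm_add_right, symplForm_smul_left,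
        symplForm_smul_right, symplForm_self, h34, symplForm_comm v₄ v₃] at h5
      grind
    have fix : ∀ w, g.1 *ᵥ g.1 *ᵥ w = w → g.1 *ᵥ w = w := by
      intro w hw
      have h5 := congrArg (· *ᵥ w) hg
      simp only [add_mulVec, ← mulVec_mulVec, smul_mulVec, mulVec_add, one_mulVec, hw,
        zero_mulVec] at h5
      ext i
      have h6 := congrFun h5 i
      simp at h6
      have h7 : y * ((g.1 *ᵥ w) i + w i) = 0 := by grind
      have h8 := (mul_eq_zero.mp h7).resolve_left hy
      grind
    have f3 : g.1 *ᵥ v₃ = v₃ := fix _ (by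
      conv_lhs => rw [g3, mulVec_add, mulVec_smul, mulVec_smul, g3, g4]
      ext i
      simp
      grind)
    have f4 : g.1 *ᵥ v₄ = v₄ := fix _ (by
      conv_lhs => rw [g4, mulVec_add, mulVec_smul, mulVec_smul, g3, g4]
      ext i
      simp
      grind)
    refine ⟨ofColumns v (g.1 *ᵥ v) v₃ v₄, hP, ?_⟩
    obtain ⟨k1, k2, k3, k4⟩ := fromBlocks_quadCompanion_mulVec y (1 : Matrix (Fin 2) (Fin 2) F)
    apply ext_mulVec_single <;>
      simp only [← mulVec_mulVec, k1, k2, k3, k4, e1, e2, e3, e4, mulVec_add, mulVec_smul]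
    · ext i
      have := congrFun hv2 i
      simp at this ⊢
      grind
    · simpa using f3
    · simpa using f4

end

/-! ### Centralizers and invariant forms of the non-regular semisimple elements -/

section
variable {F : Type*} [Field F]

theorem card_det_isUnit_fin_two [Finite F] : Nat.card {P : Matrix (Fin 2) (Fin 2) F // IsUnit P.det} =
    (Nat.card F ^ 2 - 1) * (Nat.card F ^ 2 - Nat.card F) := by
  rw [card_det_isUnit (n := Fin 2) F (m := 2) rfl, Fin.prod_univ_two]
  simp

theorem mem_invertibleCentralizer_fromBlocks_diagonal {A D P₁₁ P₁₂ P₂₁ P₂₂ : Matrix (Fin 2) (Fin 2) F} :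
    fromBlocks P₁₁ P₁₂ P₂₁ P₂₂ ∈ invertibleCentralizer (fromBlocks A 0 0 D) ↔
      IsUnit (fromBlocks P₁₁ P₁₂ P₂₁ P₂₂).det ∧ P₁₁ * A = A * P₁₁ ∧ P₁₂ * D = A * P₁₂ ∧
        P₂₁ * A = D * P₂₁ ∧ P₂₂ * D = D * P₂₂ := by
  simp only [invertibleCentralizer, Set.mem_ofPred_eq, fromBlocks_multiply, fromBlocks_inj]
  simp

/-- If no non-zero block intertwines `A` and `D`, then the centralizer of the block diagonal matrix
is a product. -/
theorem card_invertibleCentralizer_fromBlocks_diagonal [Finite F] {A D : Matrix (Fin 2) (Fin 2) F}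
    (h1 : ∀ X, X * D = A * X → X = 0) (h2 : ∀ X, X * A = D * X → X = 0) :
    Nat.card (invertibleCentralizer (fromBlocks A 0 0 D)) =
      Nat.card (invertibleCentralizer A) * Nat.card (invertibleCentralizer D) := by
  rw [← Nat.card_prod]
  symm
  refine Nat.card_congr (Equiv.ofBijective (fun x => ⟨fromBlocks x.1.1 0 0 x.2.1, ?_⟩) ⟨?_, ?_⟩)
  · rw [mem_invertibleCentralizer_fromBlocks_diagonal, det_fromBlocks_zero₁₂]
    exact ⟨x.1.2.1.mul x.2.2.1, x.1.2.2, by simp, by simp, x.2.2.2⟩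
  · rintro ⟨⟨x, hx⟩, ⟨y, hy⟩⟩ ⟨⟨x', hx'⟩, ⟨y', hy'⟩⟩ h
    simp only [Subtype.mk.injEq, fromBlocks_inj] at h
    simp [h.1, h.2.2.2]
  · rintro ⟨P, hP⟩
    rw [← fromBlocks_toBlocks P, mem_invertibleCentralizer_fromBlocks_diagonal] at hP
    obtain ⟨hd, h11, h12, h21, h22⟩ := hP
    have e12 := h1 _ h12
    have e21 := h2 _ h21
    rw [e12, e21, det_fromBlocks_zero₁₂] at hd
    refine ⟨(⟨P.toBlocks₁₁, isUnit_of_mul_isUnit_left hd, h11⟩,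
      ⟨P.toBlocks₂₂, isUnit_of_mul_isUnit_right hd, h22⟩), ?_⟩
    apply Subtype.ext
    change fromBlocks P.toBlocks₁₁ 0 0 P.toBlocks₂₂ = P
    conv_rhs => rw [← fromBlocks_toBlocks P, e12, e21]

theorem invertibleCentralizer_smul_one (a : F) :
    invertibleCentralizer (a • (1 : Matrix (Fin 2) (Fin 2) F)) = {P | IsUnit P.det} := by
  ext P
  simp [invertibleCentralizer]

/-- An alternating form is invariant under a block diagonal matrix exactly if its restrictions to
the two planes and its pairing between them are invariant. -/
theorem transpose_fromBlocks_mul_altMatrix_mul (A D : Matrix (Fin 2) (Fin 2) F) (x y z c d e : F) :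
    (fromBlocks A 0 0 D)ᵀ * altMatrix x y z c d e * fromBlocks A 0 0 D =
        altMatrix x y z c d e ↔
      A.det * x = x ∧ D.det * e = e ∧ Aᵀ * !![y, z; c, d] * D = !![y, z; c, d] := by
  have ht : !![-y, -c; -z, -d] = - !![y, z; c, d]ᵀ := by
    ext i j
    fin_cases i <;> fin_cases j <;> simp
  have hx : ∀ (A : Matrix (Fin 2) (Fin 2) F) (x : F), Aᵀ * !![0, x; -x, 0] * A =
      !![0, x; -x, 0] ↔ A.det * x = x := by
    intro A x
    have : Aᵀ * !![0, x; -x, 0] * A = !![0, A.det * x; - (A.det * x), 0] := by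
      ext i j
      fin_cases i <;> fin_cases j <;> simp [Matrix.mul_apply, det_fin_two] <;> ring
    rw [this]
    constructor
    · intro h
      simpa using congrFun (congrFun h 0) 1
    · intro h
      rw [h]
  rw [altMatrix, ht, fromBlocks_transpose, fromBlocks_multiply, fromBlocks_multiply, fromBlocks_inj]
  simp only [transpose_zero, zero_mul, mul_zero, add_zero, zero_add, hx]
  constructor
  · rintro ⟨h1, h2, h3, h4⟩
    exact ⟨h1, h4, h2⟩
  · rintro ⟨h1, h2, h3⟩
    refine ⟨h1, h3, ?_, h2⟩
    have := congrArg Matrix.transpose h3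
    rw [mul_neg, neg_mul, neg_inj]
    conv_rhs => rw [← this]
    rw [transpose_mul, transpose_mul, transpose_transpose, Matrix.mul_assoc]

theorem card_prod_ne [Finite F] {k : F} (hk : k ≠ 0) :
    Nat.card {v : F × F // v.1 * v.2 ≠ k} = Nat.card F ^ 2 - (Nat.card F - 1) := by
  have h1 : Nat.card {v : F × F // v.1 * v.2 = k} = Nat.card F - 1 := by
    rw [← card_ne_zero]
    refine Nat.card_congr ⟨fun v => ⟨v.1.1, ?_⟩, fun x => ⟨(x.1, k / x.1), ?_⟩, ?_, ?_⟩
    · intro h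
      have := v.2
      rw [h, zero_mul] at this
      exact hk this.symm
    · have := x.2
      field_simp
    · rintro ⟨⟨a, b⟩, h⟩
      simp only [Subtype.mk.injEq, Prod.mk.injEq, true_and] at h ⊢
      have : a ≠ 0 := by
        rintro rfl
        rw [zero_mul] at h
        exact hk h.symm
      rw [← h]
      field_simp
    · intro x
      rfl
  have := Fintype.ofFinite F
  classical
  rw [← h1, Nat.card_eq_fintype_card, Nat.card_eq_fintype_card, Nat.card_eq_fintype_card,
    Fintype.card_subtype_compl, Fintype.card_prod, sq]

variable [CharP F 2]

theorem card_invertibleCentralizer_quadCompanion (y : F) :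
    Nat.card (invertibleCentralizer (quadCompanion y)) =
      Nat.card {v : F × F // v.2 ^ 2 + y * v.2 * v.1 + 1 * v.1 ^ 2 ≠ 0} := by
  have h2 : (2 : F) = 0 := CharTwo.two_eq_zero
  symm
  refine Nat.card_congr (Equiv.ofBijective
    (fun v => ⟨!![v.1.1, v.1.2; v.1.2, v.1.1 + y * v.1.2], ?_, ?_⟩) ⟨?_, ?_⟩)
  · rw [det_fin_two_of, isUnit_iff_ne_zero]
    convert v.2 using 1
    grind
  · ext i j
    fin_cases i <;> fin_cases j <;> simp [quadCompanion] <;> ring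
  · rintro ⟨⟨a, b⟩, h⟩ ⟨⟨a', b'⟩, h'⟩ hh
    have h0 := congrFun (congrFun (congrArg Subtype.val hh) 0) 0
    have h1 := congrFun (congrFun (congrArg Subtype.val hh) 0) 1
    simp at h0 h1
    simp [h0, h1]
  · rintro ⟨P, hP, hc⟩
    have c00 := congrFun (congrFun hc 0) 0
    have c01 := congrFun (congrFun hc 0) 1
    simp [quadCompanion, Matrix.mul_apply] at c00 c01
    have hPe : P = !![P 0 0, P 0 1; P 0 1, P 0 0 + y * P 0 1] := by
      ext i j
      fin_cases i <;> fin_cases j <;> simp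
      · exact c00.symm
      · rw [← c01]; ring
    refine ⟨⟨(P 0 0, P 0 1), ?_⟩, ?_⟩
    · rw [hPe, det_fin_two_of, isUnit_iff_ne_zero] at hP
      convert hP using 1
      simp only
      grind
    · exact Subtype.ext hPe.symm

/-- The centralizer of `diag(Q, 1)`, for `Q` the companion matrix of `X² + yX + 1`, is the product
of the unit group of `F[X]/(X² + yX + 1)` and `GL₂(q)`; an invariant form is an orthogonal sum of
forms on the two planes. -/
theorem card_trace_eq_mul [Finite F] {y : F} (hy : y ≠ 0) :
    Nat.card {g : symplecticGroup (Fin 2) F //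
        (g.1 * g.1 + y • g.1 + 1) * (g.1 + 1) = 0 ∧ g.1.trace = y} *
      (Nat.card {v : F × F // v.2 ^ 2 + y * v.2 * v.1 + 1 * v.1 ^ 2 ≠ 0} *
        ((Nat.card F ^ 2 - 1) * (Nat.card F ^ 2 - Nat.card F))) =
    (Nat.card F - 1) ^ 2 * Nat.card (symplecticGroup (Fin 2) F) := by
  have h2 : (2 : F) = 0 := CharTwo.two_eq_zero
  have key := card_symplecticSimilar_mul (fromBlocks (quadCompanion y) 0 0 1)
  have hk : ∀ a b : F, a = b → b = a + y * b → a = 0 ∧ b = 0 := by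
    intro a b h1 h3
    have : y * b = 0 := by grind
    have := (mul_eq_zero.mp this).resolve_left hy
    exact ⟨h1.trans this, this⟩
  rw [card_invertibleCentralizer_fromBlocks_diagonal, card_invertibleCentralizer_quadCompanion,
    ← one_smul F (1 : Matrix (Fin 2) (Fin 2) F), invertibleCentralizer_smul_one, one_smul,
    symplecticSimilar_quadCompanion_one hy] at key
  · have e : Nat.card {P : Matrix (Fin 2) (Fin 2) F | IsUnit P.det} = _ := card_det_isUnit_fin_two
    rw [e] at key
    rw [show Nat.card (invariantForms (fromBlocks (quadCompanion y) 0 0 1)) =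
      (Nat.card F - 1) ^ 2 from ?_] at key
    · exact key
    · rw [sq, ← card_ne_zero, ← Nat.card_prod, Nat.card_congr (invariantFormsEquiv _)]
      simp only [transpose_fromBlocks_mul_altMatrix_mul]
      have hX : ∀ a b c d : F, (quadCompanion y)ᵀ * !![a, b; c, d] * 1 = !![a, b; c, d] →
          a = 0 ∧ b = 0 ∧ c = 0 ∧ d = 0 := by
        intro a b c d h
        have c00 := congrFun (congrFun h 0) 0
        have c01 := congrFun (congrFun h 0) 1
        have c10 := congrFun (congrFun h 1) 0
        have c11 := congrFun (congrFun h 1) 1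
        simp [quadCompanion, Matrix.mul_apply] at c00 c01 c10 c11
        obtain ⟨k1, k2⟩ := hk a c c00.symm c10.symm
        obtain ⟨k3, k4⟩ := hk b d c01.symm c11.symm
        exact ⟨k1, k3, k2, k4⟩
      refine Nat.card_congr ⟨fun v => (⟨v.1.1, ?_⟩, ⟨v.1.2.2.2.2.2, ?_⟩),
        fun w => ⟨(w.1.1, 0, 0, 0, 0, w.2.1), ?_, ?_, ?_, ?_⟩, ?_, ?_⟩
      · obtain ⟨⟨a, b, c, d, e, f⟩, hv, -, -, h⟩ := v
        obtain ⟨rfl, rfl, rfl, rfl⟩ := hX _ _ _ _ h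
        simp at hv
        exact hv.1
      · obtain ⟨⟨a, b, c, d, e, f⟩, hv, -, -, h⟩ := v
        obtain ⟨rfl, rfl, rfl, rfl⟩ := hX _ _ _ _ h
        simp at hv
        exact hv.2
      · simpa using ⟨w.1.2, w.2.2⟩
      · simp [quadCompanion, det_fin_two, CharTwo.neg_eq]
      · simp
      · ext i j
        fin_cases i <;> fin_cases j <;> simp [Matrix.mul_apply]
      · rintro ⟨⟨a, b, c, d, e, f⟩, hv, -, -, h⟩
        obtain ⟨rfl, rfl, rfl, rfl⟩ := hX _ _ _ _ h
        rfl
      · intro w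
        rfl
  · intro X hX
    have c00 := congrFun (congrFun hX 0) 0
    have c01 := congrFun (congrFun hX 0) 1
    have c10 := congrFun (congrFun hX 1) 0
    have c11 := congrFun (congrFun hX 1) 1
    simp [quadCompanion, Matrix.mul_apply] at c00 c01 c10 c11
    obtain ⟨k1, k2⟩ := hk _ _ c00 c10
    obtain ⟨k3, k4⟩ := hk _ _ c01 c11
    ext i j
    fin_cases i <;> fin_cases j <;> assumption
  · intro X hX
    have c00 := congrFun (congrFun hX 0) 0
    have c01 := congrFun (congrFun hX 0) 1
    have c10 := congrFun (congrFun hX 1) 0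
    have c11 := congrFun (congrFun hX 1) 1
    simp [quadCompanion, Matrix.mul_apply] at c00 c01 c10 c11
    obtain ⟨k1, k2⟩ := hk _ _ c00.symm (by linear_combination -c01)
    obtain ⟨k3, k4⟩ := hk _ _ c10.symm (by linear_combination -c11)
    ext i j
    fin_cases i <;> fin_cases j <;> assumption

/-- In the split case the elements with `g² + yg + 1 = 0` are conjugate to `diag(α, α, β, β)`. The
centralizer is `GL₂(q) × GL₂(q)` and the invariant forms are the elements of `GL₂(q)`, because both
eigenspaces are totally isotropic. -/
theorem card_quadratic_split_mul [Finite F] {y α : F} (hy : y ≠ 0) (hα : α ^ 2 + y * α + 1 = 0) :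
    Nat.card {g : symplecticGroup (Fin 2) F // g.1 * g.1 + y • g.1 + 1 = 0} *
      ((Nat.card F ^ 2 - 1) * (Nat.card F ^ 2 - Nat.card F)) =
    Nat.card (symplecticGroup (Fin 2) F) := by
  have h2 : (2 : F) = 0 := CharTwo.two_eq_zero
  have hα0 : α ≠ 0 := by rintro rfl; simp at hα
  set β := α + y with hβ
  have hαβ : α * β = 1 := by grind
  have hβ0 : β ≠ 0 := right_ne_zero_of_mul_eq_one hαβ
  have hne : α ≠ β := by
    intro h
    apply hy
    grind
  have key := card_symplecticSimilar_mul
    (fromBlocks (α • (1 : Matrix (Fin 2) (Fin 2) F)) 0 0 (β • (1 : Matrix (Fin 2) (Fin 2) F)))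
  have e : Nat.card {P : Matrix (Fin 2) (Fin 2) F | IsUnit P.det} = _ := card_det_isUnit_fin_two
  have hsim : symplecticSimilar (fromBlocks (α • (1 : Matrix (Fin 2) (Fin 2) F)) 0 0
      (β • (1 : Matrix (Fin 2) (Fin 2) F))) = {g : symplecticGroup (Fin 2) F |
        g.1 * g.1 + y • g.1 + 1 = 0} := by
    rw [← symplecticSimilar_quadCompanion_quadCompanion hy]
    have hQ : fromBlocks (quadCompanion y) 0 0 (quadCompanion y) *
        fromBlocks !![1, 0; α, 0] !![1, 0; β, 0] !![0, 1; 0, α] !![0, 1; 0, β] =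
        fromBlocks !![1, 0; α, 0] !![1, 0; β, 0] !![0, 1; 0, α] !![0, 1; 0, β] *
        fromBlocks (α • (1 : Matrix (Fin 2) (Fin 2) F)) 0 0 (β • (1 : Matrix (Fin 2) (Fin 2) F)) := by
      rw [fromBlocks_multiply, fromBlocks_multiply]
      congr 1 <;>
      · ext i j
        fin_cases i <;> fin_cases j <;> (simp [quadCompanion]; try grind)
    have hQd : IsUnit (fromBlocks !![1, 0; α, 0] !![1, 0; β, 0] !![0, 1; 0, α] !![0, 1; 0, β]).det := by
      rw [det_fromBlocks_fin_two, det_fin_four, isUnit_iff_ne_zero]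
      simp
      have : (α - β) ^ 2 ≠ 0 := pow_ne_zero 2 (sub_ne_zero.mpr hne)
      convert this using 1
      grind
    set Q := fromBlocks !![1, 0; α, 0] !![1, 0; β, 0] !![0, 1; 0, α] !![0, 1; 0, β]
    ext g
    constructor
    · rintro ⟨P, hP, h⟩
      refine ⟨P * Q⁻¹, by rw [det_mul]; exact hP.mul (isUnit_nonsing_inv_det Q hQd), ?_⟩
      rw [← Matrix.mul_assoc, h, Matrix.mul_assoc, Matrix.mul_assoc]
      congr 1
      rw [← mul_nonsing_inv_cancel_right _ (fromBlocks (quadCompanion y) 0 0 (quadCompanion y)) hQd,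
        hQ]
      simp only [← Matrix.mul_assoc]
      rw [nonsing_inv_mul _ hQd, one_mul]
    · rintro ⟨P, hP, h⟩
      refine ⟨P * Q, by rw [det_mul]; exact hP.mul hQd, ?_⟩
      rw [← Matrix.mul_assoc, h, Matrix.mul_assoc, hQ, Matrix.mul_assoc]
  have hz : ∀ (γ δ : F), γ ≠ δ → ∀ X : Matrix (Fin 2) (Fin 2) F,
      X * (δ • (1 : Matrix (Fin 2) (Fin 2) F)) = (γ • (1 : Matrix (Fin 2) (Fin 2) F)) * X → X = 0 := by
    intro γ δ h X hX
    rw [Matrix.mul_smul, mul_one, smul_mul, one_mul] at hX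
    ext i j
    have h3 := congrFun (congrFun hX i) j
    simp at h3
    rcases h3 with h3 | h3
    · exact absurd h3.symm h
    · exact h3
  rw [hsim, card_invertibleCentralizer_fromBlocks_diagonal (hz _ _ hne) (hz _ _ hne.symm),
    invertibleCentralizer_smul_one, invertibleCentralizer_smul_one, e,
    show Nat.card (invariantForms (fromBlocks (α • (1 : Matrix (Fin 2) (Fin 2) F)) 0 0
      (β • (1 : Matrix (Fin 2) (Fin 2) F)))) = _ from ?_] at key
  rotate_left
  · exact (Nat.card F ^ 2 - 1) * (Nat.card F ^ 2 - Nat.card F)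
  · rw [← card_det_isUnit_fin_two, Nat.card_congr (invariantFormsEquiv _)]
    simp only [transpose_fromBlocks_mul_altMatrix_mul]
    have hsq : ∀ γ δ x : F, γ * δ = 1 → γ ≠ δ → (γ • (1 : Matrix (Fin 2) (Fin 2) F)).det * x = x →
        x = 0 := by
      intro γ δ x h1 h3 h4
      rw [det_smul, det_one, Fintype.card_fin, mul_one] at h4
      have h5 : γ * x * (γ - δ) = 0 := by linear_combination h4 - x * h1
      have h6 := (mul_eq_zero.mp h5).resolve_right (sub_ne_zero.mpr h3)
      exact (mul_eq_zero.mp h6).resolve_left (left_ne_zero_of_mul_eq_one h1)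
    refine Nat.card_congr ⟨fun v => ⟨!![v.1.2.1, v.1.2.2.1; v.1.2.2.2.1, v.1.2.2.2.2.1], ?_⟩,
      fun X => ⟨(0, X.1 0 0, X.1 0 1, X.1 1 0, X.1 1 1, 0), ?_, ?_, ?_, ?_⟩, ?_, ?_⟩
    · obtain ⟨⟨a, b, c, d, e, f⟩, hv, h1, h3, h⟩ := v
      obtain rfl := hsq _ _ _ hαβ hne h1
      simp only at hv
      rw [det_fin_two_of, isUnit_iff_ne_zero]
      grind
    · have h3 := X.2.ne_zero
      rw [det_fin_two] at h3
      simp only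
      grind
    · simp
    · simp
    · rw [show !![X.1 0 0, X.1 0 1; X.1 1 0, X.1 1 1] = X.1 from (eta_fin_two X.1).symm]
      simp [smul_smul, mul_comm β α, hαβ]
    · rintro ⟨⟨a, b, c, d, e, f⟩, hv, h1, h3, h⟩
      obtain rfl := hsq _ _ _ hαβ hne h1
      obtain rfl := hsq _ _ _ (by rw [mul_comm]; exact hαβ) hne.symm h3
      rfl
    · intro X
      exact Subtype.ext (eta_fin_two X.1).symm
  have hpos : 0 < (Nat.card F ^ 2 - 1) * (Nat.card F ^ 2 - Nat.card F) := by
    rw [← card_det_isUnit_fin_two (F := F)]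
    have : Nonempty {P : Matrix (Fin 2) (Fin 2) F // IsUnit P.det} := ⟨⟨1, by simp⟩⟩
    exact Nat.card_pos
  apply Nat.eq_of_mul_eq_mul_left hpos
  rw [← key]
  change _ = Nat.card {g : symplecticGroup (Fin 2) F // g.1 * g.1 + y • g.1 + 1 = 0} * _
  ring

end

section
variable {F : Type*} [Field F]

theorem card_mul_add_anisotropic_ne_zero [Finite F] (n : F × F → F) (hn : ∀ v, n v = 0 ↔ v = 0) :
    Nat.card {w : (F × F) × F × F // w.2.1 * w.2.2 - n w.1 ≠ 0} =
      (Nat.card F - 1) ^ 2 + (Nat.card F ^ 2 - 1) * (Nat.card F ^ 2 - (Nat.card F - 1)) := by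
  classical
  have := Fintype.ofFinite F
  have e : {w : (F × F) × F × F // w.2.1 * w.2.2 - n w.1 ≠ 0} ≃
      Σ v : F × F, {x : F × F // x.1 * x.2 ≠ n v} :=
    ⟨fun w => ⟨w.1.1, w.1.2, fun h => w.2 (sub_eq_zero.mpr h)⟩,
      fun w => ⟨(w.1, w.2.1), fun h => w.2.2 (sub_eq_zero.mp h)⟩, fun w => rfl, fun w => rfl⟩
  rw [Nat.card_congr e, Nat.card_sigma, ← Finset.add_sum_erase _ _ (Finset.mem_univ 0)]
  congr 1
  · rw [(hn 0).mpr rfl, sq, ← card_ne_zero, ← Nat.card_prod]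
    exact Nat.card_congr ⟨fun x => (⟨x.1.1, left_ne_zero_of_mul x.2⟩,
      ⟨x.1.2, right_ne_zero_of_mul x.2⟩), fun x => ⟨(x.1.1, x.2.1), mul_ne_zero x.1.2 x.2.2⟩,
      fun x => rfl, fun x => rfl⟩
  · rw [Finset.sum_congr rfl (fun v hv => card_prod_ne (fun h => Finset.ne_of_mem_erase hv
      ((hn v).mp h))), Finset.sum_const, Finset.card_erase_of_mem (Finset.mem_univ _),
      Finset.card_univ, Fintype.card_prod, smul_eq_mul, Nat.card_eq_fintype_card, ← sq]

variable [CharP F 2]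

/-- In the non-split case the centralizer is a general linear group over the quadratic extension,
whose elements are described here by the images of the first and third basis vectors. -/
theorem card_invertibleCentralizer_quadCompanion_quadCompanion [Finite F] {y : F}
    (hnr : ∀ x : F, x ^ 2 + y * x + 1 ≠ 0) :
    Nat.card (invertibleCentralizer (fromBlocks (quadCompanion y) 0 0 (quadCompanion y))) =
      (Nat.card F ^ 4 - 1) * (Nat.card F ^ 4 - Nat.card F ^ 2) := by
  classical
  have h2 : (2 : F) = 0 := CharTwo.two_eq_zero
  have := Fintype.ofFinite F
  obtain ⟨f1, f2, f3, f4⟩ := fromBlocks_quadCompanion_mulVec y (quadCompanion y)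
  have hn : ∀ a b : F, a ^ 2 + y * a * b + b ^ 2 = 0 → a = 0 ∧ b = 0 := by
    intro a b h
    by_cases hb : b = 0
    · subst hb
      simpa using h
    · exfalso
      apply hnr (a / b)
      field_simp
      linear_combination h
  have hD : ∀ v, fromBlocks (quadCompanion y) 0 0 (quadCompanion y) *ᵥ
      fromBlocks (quadCompanion y) 0 0 (quadCompanion y) *ᵥ v =
      v + y • fromBlocks (quadCompanion y) 0 0 (quadCompanion y) *ᵥ v := by
    have : fromBlocks (quadCompanion y) 0 0 (quadCompanion y) *
        fromBlocks (quadCompanion y) 0 0 (quadCompanion y) =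
        1 + y • fromBlocks (quadCompanion y) 0 0 (quadCompanion y) := by
      rw [fromBlocks_multiply, fromBlocks_smul, ← fromBlocks_one, fromBlocks_add]
      congr 1 <;>
      · ext i j
        fin_cases i <;> fin_cases j <;> simp [quadCompanion]
    intro v
    rw [mulVec_mulVec, this, add_mulVec, one_mulVec, smul_mulVec]
  set D := fromBlocks (quadCompanion y) 0 0 (quadCompanion y) with hDdef
  -- `(a + b D)(a + b y + b D)` is the scalar `a² + y a b + b²`
  have hinv : ∀ (a b : F) (v : Fin 2 ⊕ Fin 2 → F), (a + b * y) • (a • v + b • D *ᵥ v) +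
      b • D *ᵥ (a • v + b • D *ᵥ v) = (a ^ 2 + y * a * b + b ^ 2) • v := by
    intro a b v
    rw [mulVec_add, mulVec_smul, mulVec_smul, hD]
    ext i
    simp
    grind
  have hK0 : ∀ (a b : F) (v : Fin 2 ⊕ Fin 2 → F), v ≠ 0 → a • v + b • D *ᵥ v = 0 →
      a = 0 ∧ b = 0 := by
    intro a b v hv h
    have h3 := hinv a b v
    rw [h, mulVec_zero, smul_zero, smul_zero, add_zero] at h3
    exact hn a b ((smul_eq_zero.mp h3.symm).resolve_right hv)
  have hcard : ∀ v : Fin 2 ⊕ Fin 2 → F, v ≠ 0 →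
      Nat.card {w : Fin 2 ⊕ Fin 2 → F // ¬ w ∈ Set.range (fun x : F × F => x.1 • v + x.2 • D *ᵥ v)} =
      Nat.card F ^ 4 - Nat.card F ^ 2 := by
    intro v hv
    have hi : Function.Injective (fun x : F × F => x.1 • v + x.2 • D *ᵥ v) := by
      rintro ⟨a, b⟩ ⟨a', b'⟩ h
      simp only at h
      obtain ⟨k1, k2⟩ := hK0 (a - a') (b - b') v hv (by
        rw [sub_smul, sub_smul, sub_add_sub_comm, h, sub_self])
      rw [sub_eq_zero.mp k1, sub_eq_zero.mp k2]
    have hr := Set.card_range_of_injective hi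
    rw [Nat.card_eq_fintype_card, Fintype.card_subtype_compl, Nat.card_eq_fintype_card]
    congr 1
    · simp
    · refine Eq.trans ?_ (hr.trans ?_)
      · exact Fintype.card_congr (Equiv.refl _)
      · rw [Fintype.card_prod, sq]
  have hv0 : Nat.card {v : Fin 2 ⊕ Fin 2 → F // v ≠ 0} = Nat.card F ^ 4 - 1 := by
    rw [Nat.card_eq_fintype_card, Fintype.card_subtype_compl]
    simp
  have hcol : ∀ P : Matrix (Fin 2 ⊕ Fin 2) (Fin 2 ⊕ Fin 2) F, P * D = D * P →
      P = ofColumns (P *ᵥ Pi.single (.inl 0) 1) (D *ᵥ P *ᵥ Pi.single (.inl 0) 1)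
        (P *ᵥ Pi.single (.inr 0) 1) (D *ᵥ P *ᵥ Pi.single (.inr 0) 1) := by
    intro P hP
    obtain ⟨e1, e2, e3, e4⟩ := ofColumns_mulVec_single (P *ᵥ Pi.single (.inl 0) 1)
      (D *ᵥ P *ᵥ Pi.single (.inl 0) 1) (P *ᵥ Pi.single (.inr 0) 1) (D *ᵥ P *ᵥ Pi.single (.inr 0) 1)
    apply ext_mulVec_single
    · rw [e1]
    · rw [e2, mulVec_mulVec _ D P, ← hP, ← mulVec_mulVec, f1]
    · rw [e3]
    · rw [e4, mulVec_mulVec _ D P, ← hP, ← mulVec_mulVec, f3]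
      simp [quadCompanion]
  have hcomm : ∀ v w, ofColumns v (D *ᵥ v) w (D *ᵥ w) * D = D * ofColumns v (D *ᵥ v) w (D *ᵥ w) := by
    intro v w
    obtain ⟨e1, e2, e3, e4⟩ := ofColumns_mulVec_single v (D *ᵥ v) w (D *ᵥ w)
    apply ext_mulVec_single <;>
      simp only [← mulVec_mulVec, f1, f2, f3, f4, e1, e2, e3, e4, mulVec_add, mulVec_smul, hD] <;>
      simp [quadCompanion]
  have hunit : ∀ v w, IsUnit (ofColumns v (D *ᵥ v) w (D *ᵥ w)).det ↔
      v ≠ 0 ∧ w ∉ Set.range (fun x : F × F => x.1 • v + x.2 • D *ᵥ v) := by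
    intro v w
    obtain ⟨e1, e2, e3, e4⟩ := ofColumns_mulVec_single v (D *ᵥ v) w (D *ᵥ w)
    rw [isUnit_iff_ne_zero, Ne, ← exists_mulVec_eq_zero_iff]
    constructor
    · intro h
      refine ⟨?_, ?_⟩
      · rintro rfl
        exact h ⟨Pi.single (.inl 0) 1, by simp, e1⟩
      · rintro ⟨⟨a, b⟩, rfl⟩
        apply h
        refine ⟨a • Pi.single (.inl 0) 1 + b • Pi.single (.inl 1) 1 - Pi.single (.inr 0) 1, ?_, ?_⟩
        · intro h0
          have := congrFun h0 (.inr 0)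
          simp at this
        · rw [mulVec_sub, mulVec_add, mulVec_smul, mulVec_smul, e1, e2, e3, sub_self]
    · rintro ⟨hv, hw⟩ ⟨x, hx, hPx⟩
      have hx' : x = x (.inl 0) • Pi.single (.inl 0) 1 + x (.inl 1) • Pi.single (.inl 1) 1 +
          x (.inr 0) • Pi.single (.inr 0) 1 + x (.inr 1) • Pi.single (.inr 1) 1 := by
        ext i
        rcases i with i | i <;> fin_cases i <;> simp
      rw [hx'] at hPx
      simp only [mulVec_add, mulVec_smul, e1, e2, e3, e4] at hPx
      generalize x (.inl 0) = a at *
      generalize x (.inl 1) = b at *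
      generalize x (.inr 0) = c at *
      generalize x (.inr 1) = d at *
      have hcw : c • w + d • D *ᵥ w = -(a • v + b • D *ᵥ v) := by
        rw [← sub_eq_zero, ← hPx]
        abel
      by_cases hcd : c ^ 2 + y * c * d + d ^ 2 = 0
      · obtain ⟨rfl, rfl⟩ := hn c d hcd
        have h3 : a • v + b • D *ᵥ v = 0 := by
          rw [← neg_eq_zero, ← hcw]; simp
        obtain ⟨rfl, rfl⟩ := hK0 a b v hv h3
        apply hx
        rw [hx']
        simp
      · apply hw
        have h4 := hinv c d w
        rw [hcw, mulVec_neg, mulVec_add, mulVec_smul, mulVec_smul, hD] at h4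
        refine ⟨((c ^ 2 + y * c * d + d ^ 2)⁻¹ * ((c + d * y) * a + d * b),
          (c ^ 2 + y * c * d + d ^ 2)⁻¹ * ((c + d * y) * b + d * a + d * b * y)), ?_⟩
        simp only
        rw [← inv_smul_smul₀ hcd w, ← h4]
        ext i
        simp
        grind
  rw [← hv0]
  refine Nat.card_eq_mul_of_card_fiber (fun P => (⟨P.1 *ᵥ Pi.single (.inl 0) 1, ?_⟩ :
    {v : Fin 2 ⊕ Fin 2 → F // v ≠ 0})) _ ?_
  · have hP := P.2.1
    rw [hcol _ P.2.2, hunit] at hP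
    exact hP.1
  · rintro ⟨v, hv⟩
    rw [← hcard v hv]
    refine Nat.card_congr ⟨fun P => ⟨P.1.1 *ᵥ Pi.single (.inr 0) 1, ?_⟩,
      fun w => ⟨⟨ofColumns v (D *ᵥ v) w.1 (D *ᵥ w.1), (hunit _ _).mpr ⟨hv, w.2⟩, hcomm _ _⟩, ?_⟩, ?_, ?_⟩
    · obtain ⟨⟨P, hP, hPD⟩, hPv⟩ := P
      obtain rfl : P *ᵥ Pi.single (.inl 0) 1 = v := congrArg Subtype.val hPv
      rw [hcol _ hPD, hunit] at hP
      exact hP.2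
    · exact Subtype.ext (ofColumns_mulVec_single _ _ _ _).1
    · rintro ⟨⟨P, hP, hPD⟩, hPv⟩
      obtain rfl : P *ᵥ Pi.single (.inl 0) 1 = v := congrArg Subtype.val hPv
      exact Subtype.ext (Subtype.ext (hcol P hPD).symm)
    · intro w
      exact Subtype.ext (ofColumns_mulVec_single _ _ _ _).2.2.1

/-- In the non-split case the invariant forms are the non-degenerate hermitian forms in two
variables over the quadratic extension: two diagonal entries in `F` and one off-diagonal entry,
with its norm `a² + yab + b²`. -/
theorem card_quadratic_nonsplit_mul [Finite F] {y : F} (hnr : ∀ x : F, x ^ 2 + y * x + 1 ≠ 0) :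
    Nat.card {g : symplecticGroup (Fin 2) F // g.1 * g.1 + y • g.1 + 1 = 0} *
      ((Nat.card F ^ 4 - 1) * (Nat.card F ^ 4 - Nat.card F ^ 2)) =
    ((Nat.card F - 1) ^ 2 + (Nat.card F ^ 2 - 1) * (Nat.card F ^ 2 - (Nat.card F - 1))) *
      Nat.card (symplecticGroup (Fin 2) F) := by
  have h2 : (2 : F) = 0 := CharTwo.two_eq_zero
  have hy : y ≠ 0 := by
    rintro rfl
    apply hnr 1
    grind
  have key := card_symplecticSimilar_mul (fromBlocks (quadCompanion y) 0 0 (quadCompanion y))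
  rw [card_invertibleCentralizer_quadCompanion_quadCompanion hnr,
    symplecticSimilar_quadCompanion_quadCompanion hy] at key
  rw [show Nat.card (invariantForms (fromBlocks (quadCompanion y) 0 0 (quadCompanion y))) =
    _ from ?_] at key
  · exact key
  · rw [← card_mul_add_anisotropic_ne_zero (fun v : F × F => v.1 ^ 2 + y * v.1 * v.2 + v.2 ^ 2) ?_,
      Nat.card_congr (invariantFormsEquiv _)]
    · have hX : ∀ a b c d : F, (quadCompanion y)ᵀ * !![a, b; c, d] * quadCompanion y =
          !![a, b; c, d] ↔ c = b + y * a ∧ d = a := by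
        intro a b c d
        constructor
        · intro h
          have c00 := congrFun (congrFun h 0) 0
          have c01 := congrFun (congrFun h 0) 1
          simp [quadCompanion, Matrix.mul_apply] at c00 c01
          refine ⟨?_, c00⟩
          grind
        · rintro ⟨rfl, rfl⟩
          ext i j
          fin_cases i <;> fin_cases j <;> simp [quadCompanion, Matrix.mul_apply] <;> grind
      have hdet : ∀ x : F, (quadCompanion y).det * x = x := by
        intro x
        simp [quadCompanion, det_fin_two, CharTwo.neg_eq]
      simp only [transpose_fromBlocks_mul_altMatrix_mul, hX, hdet, true_and]
      refine Nat.card_congr ⟨fun v => ⟨((v.1.2.1, v.1.2.2.1), v.1.1, v.1.2.2.2.2.2), ?_⟩,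
        fun w => ⟨(w.1.2.1, w.1.1.1, w.1.1.2, w.1.1.2 + y * w.1.1.1, w.1.1.1, w.1.2.2), ?_, rfl, rfl⟩,
        ?_, fun w => rfl⟩
      · obtain ⟨⟨x, a, b, c, d, e⟩, hv, h1, h3⟩ := v
        simp only at hv h1 h3 ⊢
        subst h1 h3
        grind
      · have := w.2
        simp only
        grind
      · rintro ⟨⟨x, a, b, c, d, e⟩, hv, h1, h3⟩
        simp only at hv h1 h3
        subst h1 h3
        rfl
    · rintro ⟨a, b⟩
      simp only [Prod.mk_eq_zero]
      constructor
      · intro h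
        by_cases hb : b = 0
        · subst hb
          simpa using h
        · exfalso
          apply hnr (a / b)
          field_simp
          linear_combination h
      · rintro ⟨rfl, rfl⟩
        simp

end

/-! ### Elements of order two -/

section
variable {F : Type*} [Field F]

theorem symplForm_zero_right (v : Fin 2 ⊕ Fin 2 → F) : symplForm v 0 = 0 := by simp [symplForm]

theorem mem_symplecticGroup_of_symplForm {g : Matrix (Fin 2 ⊕ Fin 2) (Fin 2 ⊕ Fin 2) F}
    (h : ∀ u v, symplForm (g *ᵥ u) (g *ᵥ v) = symplForm u v) : g ∈ symplecticGroup (Fin 2) F := by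
  rw [SymplecticGroup.mem_iff']
  ext i j
  rw [transpose_mul_J_mul_apply, h]
  have := transpose_mul_J_mul_apply (1 : Matrix (Fin 2 ⊕ Fin 2) (Fin 2 ⊕ Fin 2) F) i j
  simpa only [transpose_one, Matrix.one_mul, Matrix.mul_one, one_mulVec] using this.symm

/-- The transvection `x ↦ x + ⟨m, x⟩ m`. -/
def transvectionMatrix (m : Fin 2 ⊕ Fin 2 → F) : Matrix (Fin 2 ⊕ Fin 2) (Fin 2 ⊕ Fin 2) F :=
  1 + vecMulVec m (m ᵥ* J (Fin 2) F)

theorem transvectionMatrix_mulVec (m x : Fin 2 ⊕ Fin 2 → F) :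
    transvectionMatrix m *ᵥ x = x + symplForm m x • m := by
  rw [transvectionMatrix, add_mulVec, one_mulVec]
  congr 1
  ext i
  simp [vecMulVec_mulVec, symplForm, dotProduct_mulVec, mul_comm]

theorem transvectionMatrix_mem (m : Fin 2 ⊕ Fin 2 → F) :
    transvectionMatrix m ∈ symplecticGroup (Fin 2) F := by
  apply mem_symplecticGroup_of_symplForm
  intro u v
  have h : symplForm u m = - symplForm m u := by
    have := symplForm_self (u + m)
    rw [symplForm_add_left, symplForm_add_right, symplForm_add_right, symplForm_self,
      symplForm_self] at this
    linear_combination this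
  simp only [transvectionMatrix_mulVec, symplForm_add_left, symplForm_add_right,
    symplForm_smul_left, symplForm_smul_right, symplForm_self, h]
  ring

theorem exists_symplForm_eq_one {m : Fin 2 ⊕ Fin 2 → F} (hm : m ≠ 0) :
    ∃ u, symplForm u m = 1 := by
  obtain ⟨u, hu⟩ : ∃ u, symplForm u m ≠ 0 := by
    by_contra! h
    exact hm (eq_zero_of_symplForm_eq_zero h)
  exact ⟨(symplForm u m)⁻¹ • u, by rw [symplForm_smul_left, inv_mul_cancel₀ hu]⟩

/-- For an involution `g` the map `g + 1` is self-adjoint. -/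
theorem symplForm_mulVec_add_self_of_mul_self {g : symplecticGroup (Fin 2) F} (hg : g.1 * g.1 = 1)
    (u v : Fin 2 ⊕ Fin 2 → F) :
    symplForm u (g.1 *ᵥ v + v) = symplForm (g.1 *ᵥ u + u) v := by
  have : symplForm u (g.1 *ᵥ v) = symplForm (g.1 *ᵥ u) v := by
    rw [← symplForm_mulVec g u, mulVec_mulVec, hg, one_mulVec]
  rw [symplForm_add_left, symplForm_add_right, this]

theorem fromBlocks_one_one_mulVec :
    (fromBlocks 1 1 0 1 : Matrix (Fin 2 ⊕ Fin 2) (Fin 2 ⊕ Fin 2) F) *ᵥ Pi.single (.inl 0) 1 =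
      Pi.single (.inl 0) 1 ∧
    (fromBlocks 1 1 0 1 : Matrix (Fin 2 ⊕ Fin 2) (Fin 2 ⊕ Fin 2) F) *ᵥ Pi.single (.inl 1) 1 =
      Pi.single (.inl 1) 1 ∧
    (fromBlocks 1 1 0 1 : Matrix (Fin 2 ⊕ Fin 2) (Fin 2 ⊕ Fin 2) F) *ᵥ Pi.single (.inr 0) 1 =
      Pi.single (.inr 0) 1 + Pi.single (.inl 0) 1 ∧
    (fromBlocks 1 1 0 1 : Matrix (Fin 2 ⊕ Fin 2) (Fin 2 ⊕ Fin 2) F) *ᵥ Pi.single (.inr 1) 1 =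
      Pi.single (.inr 1) 1 + Pi.single (.inl 1) 1 := by
  refine ⟨?_, ?_, ?_, ?_⟩ <;>
  · ext i
    rcases i with i | i <;> fin_cases i <;> simp

theorem card_invertibleCentralizer_fromBlocks_one_one [Finite F] :
    Nat.card (invertibleCentralizer (fromBlocks 1 1 0 1 : Matrix (Fin 2 ⊕ Fin 2) (Fin 2 ⊕ Fin 2) F)) =
      (Nat.card F ^ 2 - 1) * (Nat.card F ^ 2 - Nat.card F) * Nat.card F ^ 4 := by
  have := Fintype.ofFinite F
  have hM : Nat.card (Matrix (Fin 2) (Fin 2) F) = Nat.card F ^ 4 := by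
    change Nat.card (Fin 2 → Fin 2 → F) = _
    simp [← pow_mul]
  rw [← card_det_isUnit_fin_two, ← hM, ← Nat.card_prod]
  symm
  have hmem : ∀ A B C D : Matrix (Fin 2) (Fin 2) F, fromBlocks A B C D * fromBlocks 1 1 0 1 =
      fromBlocks 1 1 0 1 * fromBlocks A B C D ↔ C = 0 ∧ D = A := by
    intro A B C D
    rw [fromBlocks_multiply, fromBlocks_multiply, fromBlocks_inj]
    simp only [mul_one, one_mul, zero_mul, mul_zero, add_zero, zero_add]
    constructor
    · rintro ⟨h1, h2, h3, h4⟩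
      refine ⟨by simpa using h1, ?_⟩
      rw [add_comm B D] at h2
      exact (add_right_cancel h2).symm
    · rintro ⟨rfl, rfl⟩
      simp [add_comm]
  refine Nat.card_congr (Equiv.ofBijective (fun x => ⟨fromBlocks x.1.1 x.2 0 x.1.1, ?_, ?_⟩) ⟨?_, ?_⟩)
  · rw [det_fromBlocks_zero₂₁]
    exact x.1.2.mul x.1.2
  · rw [hmem]
    simp
  · rintro ⟨⟨x, hx⟩, y⟩ ⟨⟨x', hx'⟩, y'⟩ h
    have h3 := congrArg Subtype.val h
    simp only [fromBlocks_inj] at h3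
    obtain rfl := h3.1
    obtain rfl := h3.2.1
    rfl
  · rintro ⟨P, hP, hc⟩
    rw [← fromBlocks_toBlocks P, hmem] at hc
    rw [← fromBlocks_toBlocks P, hc.1, hc.2, det_fromBlocks_zero₂₁] at hP
    refine ⟨(⟨P.toBlocks₁₁, isUnit_of_mul_isUnit_left hP⟩, P.toBlocks₁₂), Subtype.ext ?_⟩
    change fromBlocks P.toBlocks₁₁ P.toBlocks₁₂ 0 P.toBlocks₁₁ = P
    conv_rhs => rw [← fromBlocks_toBlocks P, hc.1, hc.2]

variable [CharP F 2]

/-- In characteristic two `m` is determined by its transvection, because `c² = 1` implies `c = 1`.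
-/
theorem transvectionMatrix_injOn :
    Set.InjOn (transvectionMatrix (F := F)) {m | m ≠ 0} := by
  intro m hm m' hm' h
  have key : ∀ y, symplForm m y • m = symplForm m' y • m' := by
    intro y
    have h1 := transvectionMatrix_mulVec m y
    rw [h, transvectionMatrix_mulVec] at h1
    exact (add_left_cancel h1).symm
  obtain ⟨u, hu⟩ := exists_symplForm_eq_one hm
  obtain ⟨u', hu'⟩ := exists_symplForm_eq_one hm'
  rw [symplForm_comm] at hu hu'
  have h1 := key u
  rw [hu, one_smul] at h1
  set c := symplForm m' u
  have h2 := key u'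
  rw [hu', one_smul, h1, symplForm_smul_left, hu', mul_one, smul_smul] at h2
  have h3 : (c * c - 1) • m' = 0 := by rw [sub_smul, h2, one_smul, sub_self]
  have h4 := (smul_eq_zero.mp h3).resolve_right hm'
  have h5 : c = 1 := by
    have h6 : (c - 1) ^ 2 = 0 := by
      have h2 : (2 : F) = 0 := CharTwo.two_eq_zero
      linear_combination h4 + (1 - c) * h2
    exact sub_eq_zero.mp (pow_eq_zero_iff (two_ne_zero) |>.mp h6)
  rw [h1, h5, one_smul]

/-- An involution is a transvection or is conjugate to the involution with two Jordan blocks,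
according to the rank of `g + 1`. -/
theorem transvection_or_similar_of_mul_self [Finite F] {g : symplecticGroup (Fin 2) F}
    (hg : g.1 * g.1 = 1) (h1 : g.1 ≠ 1) :
    (∃ m, m ≠ 0 ∧ transvectionMatrix m = g.1) ∨
      g ∈ symplecticSimilar (fromBlocks 1 1 0 1 : Matrix (Fin 2 ⊕ Fin 2) (Fin 2 ⊕ Fin 2) F) := by
  have h2 : (2 : F) = 0 := CharTwo.two_eq_zero
  have hNN : ∀ v, g.1 *ᵥ (g.1 *ᵥ v + v) = g.1 *ᵥ v + v := fun v => by
    rw [mulVec_add, mulVec_mulVec, hg, one_mulVec, add_comm]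
  by_cases hind : ∃ x x', ∀ a b : F, a • (g.1 *ᵥ x + x) + b • (g.1 *ᵥ x' + x') = 0 → a = 0 ∧ b = 0
  · right
    obtain ⟨x, x', hx⟩ := hind
    obtain ⟨e1, e2, e3, e4⟩ := ofColumns_mulVec_single (g.1 *ᵥ x + x) (g.1 *ᵥ x' + x') x x'
    refine ⟨ofColumns (g.1 *ᵥ x + x) (g.1 *ᵥ x' + x') x x', ?_, ?_⟩
    · rw [isUnit_iff_ne_zero, Ne, ← exists_mulVec_eq_zero_iff]
      rintro ⟨w, hw, hPw⟩
      apply hw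
      have hw' : w = w (.inl 0) • Pi.single (.inl 0) 1 + w (.inl 1) • Pi.single (.inl 1) 1 +
          w (.inr 0) • Pi.single (.inr 0) 1 + w (.inr 1) • Pi.single (.inr 1) 1 := by
        ext i
        rcases i with i | i <;> fin_cases i <;> simp
      rw [hw'] at hPw ⊢
      simp only [mulVec_add, mulVec_smul, e1, e2, e3, e4] at hPw
      have h3 := congrArg (g.1 *ᵥ ·) hPw
      simp only [mulVec_add, mulVec_smul, mulVec_zero, mulVec_mulVec, hg, one_mulVec] at h3
      obtain ⟨k1, k2⟩ := hx (w (.inr 0)) (w (.inr 1)) (by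
        ext i
        have i1 := congrFun h3 i
        have i2 := congrFun hPw i
        simp at i1 i2 ⊢
        grind)
      rw [k1, k2, zero_smul, zero_smul, add_zero, add_zero] at hPw
      obtain ⟨k3, k4⟩ := hx _ _ hPw
      rw [k1, k2, k3, k4]
      simp
    · obtain ⟨f1, f2, f3, f4⟩ := fromBlocks_one_one_mulVec (F := F)
      apply ext_mulVec_single <;>
        simp only [← mulVec_mulVec, f1, f2, f3, f4, e1, e2, e3, e4, mulVec_add _ (Pi.single _ _), hNN]
      · ext i; simp; grind
      · ext i; simp; grind
  · left
    push Not at hind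
    obtain ⟨x, hx⟩ : ∃ x, g.1 *ᵥ x + x ≠ 0 := by
      by_contra! h
      apply h1
      apply Matrix.ext_of_mulVec_single
      intro i
      have := h (Pi.single i 1)
      rw [one_mulVec]
      ext j
      have := congrFun this j
      simp at this ⊢
      grind
    set n := g.1 *ᵥ x + x with hn
    have hc : ∀ y, ∃ c : F, g.1 *ᵥ y + y = c • n := by
      intro y
      obtain ⟨a, b, hab, hne⟩ := hind x y
      have hb : b ≠ 0 := by
        rintro rfl
        rw [zero_smul, add_zero] at hab
        exact hne ((smul_eq_zero.mp hab).resolve_right hx) rfl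
      refine ⟨- a / b, ?_⟩
      rw [← inv_smul_smul₀ hb (g.1 *ᵥ y + y), eq_neg_of_add_eq_zero_right hab, ← hn]
      rw [← neg_smul, smul_smul]
      congr 1
      field_simp
    choose c hc using hc
    obtain ⟨u, hu⟩ := exists_symplForm_eq_one hx
    have hcy : ∀ y, c y = c u * symplForm n y := by
      intro y
      have := symplForm_mulVec_add_self_of_mul_self hg u y
      rwa [hc, hc, symplForm_smul_right, hu, mul_one, symplForm_smul_left] at this
    -- `g` is the map `y ↦ y + c ⟨n, y⟩ n`, and `c` is absorbed into `n` as it is a square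
    obtain ⟨μ, hμ⟩ := FiniteField.isSquare_of_char_two (ringChar.eq F 2) (c u)
    have hμ0 : μ ≠ 0 := by
      rintro rfl
      rw [mul_zero] at hμ
      have := hc x
      rw [hcy, hμ, zero_mul, zero_smul] at this
      exact hx this
    refine ⟨μ • n, smul_ne_zero hμ0 hx, ?_⟩
    apply Matrix.ext_of_mulVec_single
    intro i
    rw [transvectionMatrix_mulVec]
    have h3 := hc (Pi.single i 1)
    rw [hcy, hμ] at h3
    rw [symplForm_smul_left, smul_smul, mul_right_comm, ← h3]
    ext j
    simp
    grind

theorem mul_self_of_transvection {g : symplecticGroup (Fin 2) F} {m : Fin 2 ⊕ Fin 2 → F}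
    (hm : m ≠ 0) (h : transvectionMatrix m = g.1) : g.1 * g.1 = 1 ∧ g.1 ≠ 1 ∧
      g ∉ symplecticSimilar (fromBlocks 1 1 0 1 : Matrix (Fin 2 ⊕ Fin 2) (Fin 2 ⊕ Fin 2) F) := by
  have h2 : (2 : F) = 0 := CharTwo.two_eq_zero
  refine ⟨?_, ?_, ?_⟩
  · rw [← h]
    apply Matrix.ext_of_mulVec_single
    intro i
    rw [← mulVec_mulVec, one_mulVec]
    simp only [transvectionMatrix_mulVec, symplForm_add_right, symplForm_smul_right, symplForm_self]
    ext j
    simp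
    grind
  · intro h1
    obtain ⟨u, hu⟩ := exists_symplForm_eq_one hm
    have h3 := transvectionMatrix_mulVec m u
    rw [h, h1, one_mulVec, symplForm_comm, hu, one_smul] at h3
    exact hm (by simpa using h3.symm)
  · rintro ⟨P, hP, hg⟩
    obtain ⟨f1, f2, f3, f4⟩ := fromBlocks_one_one_mulVec (F := F)
    have g3 := congrArg (· *ᵥ Pi.single (.inr 0) 1) hg
    have g4 := congrArg (· *ᵥ Pi.single (.inr 1) 1) hg
    simp only [← mulVec_mulVec, f3, f4, ← h, transvectionMatrix_mulVec, mulVec_add] at g3 g4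
    have k3 := add_left_cancel g3
    have k4 := add_left_cancel g4
    set a := symplForm m (P *ᵥ Pi.single (.inr 0) 1)
    set b := symplForm m (P *ᵥ Pi.single (.inr 1) 1)
    rw [isUnit_iff_ne_zero, Ne, ← exists_mulVec_eq_zero_iff] at hP
    have k5 : P *ᵥ (b • Pi.single (.inl 0) 1 - a • Pi.single (.inl 1) 1) = 0 := by
      rw [mulVec_sub, mulVec_smul, mulVec_smul, ← k3, ← k4, smul_smul, smul_smul, mul_comm, sub_self]
    have ha : a = 0 := by
      by_contra ha
      exact hP ⟨_, fun h0 => ha (by simpa using congrFun h0 (.inl 1)), k5⟩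
    rw [ha, zero_smul] at k3
    exact hP ⟨_, fun h0 => by simpa using congrFun h0 (.inl 0), k3.symm⟩

/-- The number of invertible symmetric `2 × 2` matrices in characteristic two. -/
theorem card_symmetric_ne_zero [Finite F] :
    Nat.card {v : (F × F) × F // v.2 ^ 2 ≠ v.1.1 * v.1.2} = Nat.card F ^ 2 * (Nat.card F - 1) := by
  rw [sq, ← Nat.card_prod]
  apply Nat.card_eq_mul_of_card_fiber (fun v => v.1.1)
  rintro ⟨a, b⟩
  obtain ⟨μ, hμ⟩ := FiniteField.isSquare_of_char_two (ringChar.eq F 2) (a * b)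
  have h2 : (2 : F) = 0 := CharTwo.two_eq_zero
  have hiff : ∀ z : F, z ^ 2 = a * b ↔ z - μ = 0 := by
    intro z
    rw [hμ, ← pow_eq_zero_iff (two_ne_zero) (a := z - μ)]
    grind
  rw [← card_ne_zero]
  refine Nat.card_congr ⟨fun v => ⟨v.1.1.2 - μ, ?_⟩, fun x => ⟨⟨((a, b), x.1 + μ), ?_⟩, rfl⟩, ?_, ?_⟩
  · obtain ⟨⟨⟨⟨a', b'⟩, z⟩, hz⟩, h⟩ := v
    obtain ⟨rfl, rfl⟩ := Prod.mk.inj h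
    rw [Ne, ← hiff]
    exact hz
  · rw [Ne, hiff]
    simpa using x.2
  · rintro ⟨⟨⟨⟨a', b'⟩, z⟩, hz⟩, h⟩
    obtain ⟨rfl, rfl⟩ := Prod.mk.inj h
    simp
  · intro x
    simp

theorem card_invariantForms_fromBlocks_one_one [Finite F] :
    Nat.card (invariantForms (fromBlocks 1 1 0 1 : Matrix (Fin 2 ⊕ Fin 2) (Fin 2 ⊕ Fin 2) F)) =
      Nat.card F ^ 2 * (Nat.card F - 1) * Nat.card F := by
  have h2 : (2 : F) = 0 := CharTwo.two_eq_zero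
  have hiff : ∀ x y z c d e : F, (fromBlocks 1 1 0 1 : Matrix (Fin 2 ⊕ Fin 2) (Fin 2 ⊕ Fin 2) F)ᵀ *
      altMatrix x y z c d e * fromBlocks 1 1 0 1 = altMatrix x y z c d e ↔ x = 0 ∧ c = z := by
    intro x y z c d e
    constructor
    · intro h
      have h1 := congrFun (congrFun h (.inl 0)) (.inr 1)
      have h3 := congrFun (congrFun h (.inr 0)) (.inr 1)
      simp [altMatrix, Matrix.mul_apply, fromBlocks_transpose, Matrix.one_apply] at h1 h3
      constructor <;> grind
    · rintro ⟨rfl, rfl⟩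
      ext i j
      rcases i with i | i <;> rcases j with j | j <;> fin_cases i <;> fin_cases j <;>
        simp [altMatrix, Matrix.mul_apply, Matrix.one_apply]
  rw [← card_symmetric_ne_zero, ← Nat.card_prod, Nat.card_congr (invariantFormsEquiv _)]
  simp only [hiff]
  refine Nat.card_congr ⟨fun v => (⟨((v.1.2.1, v.1.2.2.2.2.1), v.1.2.2.1), ?_⟩, v.1.2.2.2.2.2),
    fun w => ⟨(0, w.1.1.1.1, w.1.1.2, w.1.1.2, w.1.1.1.2, w.2), ?_, rfl, rfl⟩, ?_, fun w => rfl⟩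
  · obtain ⟨⟨x, a, b, c, d, e⟩, hv, h1, h3⟩ := v
    simp only at hv h1 h3 ⊢
    subst h1 h3
    grind
  · have := w.1.2
    simp only
    grind
  · rintro ⟨⟨x, a, b, c, d, e⟩, hv, h1, h3⟩
    simp only at hv h1 h3
    subst h1 h3
    rfl

/-- There are `q⁴ - 1` transvections, one for each non-zero vector, and `q² (q⁴ - 1)` involutions
with two Jordan blocks. -/
theorem card_involutions [Finite F] :
    (Nat.card {g : symplecticGroup (Fin 2) F // g.1 * g.1 = 1 ∧ g.1 ≠ 1} : ℚ) =
      ((Nat.card F : ℚ) ^ 2 + 1) * ((Nat.card F : ℚ) ^ 4 - 1) := by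
  classical
  have := Fintype.ofFinite F
  have h2 : (2 : F) = 0 := CharTwo.two_eq_zero
  let C₀ : Matrix (Fin 2 ⊕ Fin 2) (Fin 2 ⊕ Fin 2) F := fromBlocks 1 1 0 1
  have e : Nat.card {g : symplecticGroup (Fin 2) F // g.1 * g.1 = 1 ∧ g.1 ≠ 1} =
      Nat.card {m : Fin 2 ⊕ Fin 2 → F // m ≠ 0} + Nat.card (symplecticSimilar C₀) := by
    rw [← Nat.card_sum]
    symm
    have hC : ∀ g ∈ symplecticSimilar C₀, g.1 * g.1 = 1 ∧ g.1 ≠ 1 := by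
      rintro g ⟨P, hP, hg⟩
      have hU : IsUnit P := (isUnit_iff_isUnit_det _).mpr hP
      have hCC : C₀ * C₀ = 1 := by
        simp only [C₀]
        rw [fromBlocks_multiply, ← fromBlocks_one]
        congr 1 <;>
        · ext i j
          fin_cases i <;> fin_cases j <;> simp <;> grind
      refine ⟨?_, ?_⟩
      · rw [← hU.mul_left_inj, one_mul, Matrix.mul_assoc, hg, ← Matrix.mul_assoc, hg,
          Matrix.mul_assoc, hCC, mul_one]
      · intro h1
        rw [h1, one_mul, eq_comm, hU.mul_eq_left] at hg
        have := congrFun (congrFun hg (.inl 0)) (.inr 0)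
        simp [C₀] at this
    refine Nat.card_congr (Equiv.ofBijective (Sum.elim
      (fun m => ⟨⟨_, transvectionMatrix_mem m.1⟩, ?_⟩) (fun g => ⟨g.1, hC _ g.2⟩)) ⟨?_, ?_⟩)
    · have := mul_self_of_transvection (g := ⟨_, transvectionMatrix_mem m.1⟩) m.2 rfl
      exact ⟨this.1, this.2.1⟩
    · rintro (m | g) (m' | g') h
      · have h3 := congrArg (fun x => x.1.1) h
        simp only [Sum.elim_inl] at h3
        rw [Subtype.ext (transvectionMatrix_injOn m.2 m'.2 h3)]
      · have h3 := congrArg (fun x => x.1.1) h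
        simp only [Sum.elim_inl, Sum.elim_inr] at h3
        exact absurd g'.2 (mul_self_of_transvection m.2 h3).2.2
      · have h3 := congrArg (fun x => x.1.1) h
        simp only [Sum.elim_inl, Sum.elim_inr] at h3
        exact absurd g.2 (mul_self_of_transvection m'.2 h3.symm).2.2
      · have h3 := congrArg (fun x => x.1) h
        simp only [Sum.elim_inr] at h3
        rw [Subtype.ext h3]
    · rintro ⟨g, hg, h1⟩
      rcases transvection_or_similar_of_mul_self hg h1 with ⟨m, hm, h⟩ | h
      · exact ⟨.inl ⟨m, hm⟩, Subtype.ext (Subtype.ext h)⟩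
      · exact ⟨.inr ⟨g, h⟩, rfl⟩
  have hv0 : Nat.card {v : Fin 2 ⊕ Fin 2 → F // v ≠ 0} = Nat.card F ^ 4 - 1 := by
    rw [Nat.card_eq_fintype_card, Fintype.card_subtype_compl]
    simp
  have key := card_symplecticSimilar_mul C₀
  rw [card_invertibleCentralizer_fromBlocks_one_one, card_invariantForms_fromBlocks_one_one] at key
  have hG := card_symplecticGroup_fin_two F
  have hq : 1 < Nat.card F := Finite.one_lt_card
  rw [e, hv0]
  generalize Nat.card (symplecticGroup (Fin 2) F) = G at *
  generalize Nat.card (symplecticSimilar C₀) = N at *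
  generalize Nat.card F = q at *
  have e1 : 1 ≤ q ^ 4 := Nat.one_le_pow _ _ (by omega)
  have e2 : 1 ≤ q ^ 2 := Nat.one_le_pow _ _ (by omega)
  have e3 : q ≤ q ^ 2 := Nat.le_self_pow (by norm_num) _
  have key' := congrArg (Nat.cast : ℕ → ℚ) key
  push_cast [Nat.cast_sub e1, Nat.cast_sub e2, Nat.cast_sub e3, Nat.cast_sub hq.le] at key' ⊢
  rw [hG] at key'
  have hq' : (1 : ℚ) < q := by exact_mod_cast hq
  have n1 : (q : ℚ) - 1 ≠ 0 := by linarith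
  have n2 : (q : ℚ) ^ 2 - 1 ≠ 0 := by nlinarith
  have n3 : (q : ℚ) ≠ 0 := by linarith
  have hN : (N : ℚ) = q ^ 2 * (q ^ 4 - 1) := by
    apply mul_right_cancel₀ (b := ((q : ℚ) ^ 2 - 1) * (q * (q - 1)) * q ^ 4) (by positivity)
    linear_combination key'
  rw [hN]
  ring

/-! ### Elements of order four -/

/-- A symplectic unipotent element in characteristic two cannot have a single Jordan block of size
three. With `N = g + 1` and `N³ = 0` the form `⟨u, N² v⟩` is alternating, so if `N²` is non-zero,
it has rank at least two and there are two blocks of size three, which do not fit into dimension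
four. -/
theorem sq_eq_one_of_add_one_pow_three_eq_zero {g : symplecticGroup (Fin 2) F} (h4 : g.1 ^ 4 = 1)
    (h3 : (g.1 + 1) ^ 3 = 0) : g.1 ^ 2 = 1 := by
  have h2 : (2 : F) = 0 := CharTwo.two_eq_zero
  by_contra hne
  have hX2 : (2 : F[X]) = 0 := CharTwo.two_eq_zero
  have hM : g.1 ^ 2 + 1 = (g.1 + 1) ^ 2 := by
    have := congrArg (aeval g.1) (show (X ^ 2 + 1 : F[X]) = (X + 1) ^ 2 by grind)
    simpa using this
  have hcub : g.1 ^ 3 + g.1 ^ 2 + g.1 + 1 = 0 := by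
    rw [← h3]
    have := congrArg (aeval g.1) (show (X ^ 3 + X ^ 2 + X + 1 : F[X]) = (X + 1) ^ 3 by grind)
    simpa using this
  set N := g.1 + 1 with hN
  have hM0 : N ^ 2 ≠ 0 := by
    rw [← hM]
    intro h
    apply hne
    ext i j
    have := congrFun (congrFun h i) j
    simp at this
    grind
  have hpow : ∀ (n : ℕ) (u v), symplForm (g.1 ^ n *ᵥ u) (g.1 ^ n *ᵥ v) = symplForm u v := by
    intro n u v
    have := symplForm_mulVec (g ^ n) u v
    simpa using this
  have hsymm : ∀ u v, symplForm u (N ^ 2 *ᵥ v) = symplForm (N ^ 2 *ᵥ u) v := by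
    intro u v
    rw [← hM, add_mulVec, add_mulVec, symplForm_add_left, symplForm_add_right, one_mulVec, one_mulVec,
      ← hpow 2 u, mulVec_mulVec, ← pow_add, h4, one_mulVec]
  have halt : ∀ x, symplForm x (N ^ 2 *ᵥ x) = 0 := by
    intro x
    rw [← hM, add_mulVec, symplForm_add_right, one_mulVec, symplForm_self, add_zero]
    have i1 : symplForm x (g.1 ^ 3 *ᵥ x) = symplForm x (g.1 *ᵥ x) := by
      rw [← hpow 1 x, mulVec_mulVec, ← pow_add, h4, one_mulVec, pow_one, symplForm_comm]
    have i2 := congrArg (fun M => symplForm x (M *ᵥ x)) hcub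
    simp only [add_mulVec, symplForm_add_right, one_mulVec, symplForm_self, zero_mulVec,
      symplForm_zero_right, i1] at i2
    grind
  obtain ⟨x, hx⟩ : ∃ x, N ^ 2 *ᵥ x ≠ 0 := by
    by_contra! h
    exact hM0 (Matrix.ext_of_mulVec_single fun i => by rw [h, zero_mulVec])
  obtain ⟨u, hu⟩ := exists_symplForm_eq_one hx
  have hind : ∀ a b : F, a • N ^ 2 *ᵥ x + b • N ^ 2 *ᵥ u = 0 → a = 0 ∧ b = 0 := by
    intro a b h
    have i1 := congrArg (symplForm u) h
    have i2 := congrArg (symplForm x) h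
    simp only [symplForm_add_right, symplForm_smul_right, hu, halt, symplForm_zero_right] at i1 i2
    rw [hsymm, symplForm_comm, hu] at i2
    exact ⟨by simpa using i1, by simpa using i2⟩
  have hNM : N * N ^ 2 = 0 := by rw [← pow_succ', h3]
  have hMN : N ^ 2 * N = 0 := by rw [← pow_succ, h3]
  have hMM : N ^ 2 * N ^ 2 = 0 := by rw [← pow_add, pow_succ, h3, zero_mul]
  have hNN : N * N = N ^ 2 := (sq N).symm
  -- six linearly independent vectors in a space of dimension four
  let φ : (F × F) × (F × F) × F × F →ₗ[F] (Fin 2 ⊕ Fin 2 → F) :=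
    { toFun := fun v => v.1.1 • x + v.1.2 • u + v.2.1.1 • N *ᵥ x + v.2.1.2 • N *ᵥ u +
        v.2.2.1 • N ^ 2 *ᵥ x + v.2.2.2 • N ^ 2 *ᵥ u
      map_add' := fun v w => by simp only [Prod.fst_add, Prod.snd_add, add_smul]; abel
      map_smul' := fun a v => by simp [smul_add, smul_smul] }
  have hφ : Function.Injective φ := by
    rw [← LinearMap.ker_eq_bot, LinearMap.ker_eq_bot']
    rintro ⟨⟨a, b⟩, ⟨c, d⟩, e, f⟩ h
    change a • x + b • u + c • N *ᵥ x + d • N *ᵥ u + e • N ^ 2 *ᵥ x + f • N ^ 2 *ᵥ u = 0 at h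
    have i1 := congrArg (N ^ 2 *ᵥ ·) h
    simp only [mulVec_add, mulVec_smul, mulVec_mulVec, hMN, hMM, zero_mulVec, smul_zero, add_zero,
      mulVec_zero] at i1
    obtain ⟨rfl, rfl⟩ := hind _ _ i1
    have i2 := congrArg (N *ᵥ ·) h
    simp only [mulVec_add, mulVec_smul, mulVec_mulVec, hNN, hNM, zero_mulVec, smul_zero, add_zero,
      zero_smul, zero_add, mulVec_zero] at i2
    obtain ⟨rfl, rfl⟩ := hind _ _ i2
    simp only [zero_smul, zero_add] at h
    obtain ⟨rfl, rfl⟩ := hind _ _ h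
    rfl
  have := LinearMap.finrank_le_finrank_of_injective hφ
  simp at this

/-- The elements of order four are those with minimal polynomial `(X + 1)⁴`. -/
theorem minpoly_eq_of_pow_four {g : symplecticGroup (Fin 2) F} :
    minpoly F g.1 = palindromicQuartic 0 0 ↔ g.1 ^ 4 = 1 ∧ g.1 ^ 2 ≠ 1 := by
  have hX2 : (2 : F[X]) = 0 := CharTwo.two_eq_zero
  have hp : palindromicQuartic (0 : F) 0 = (X - C 1) ^ 4 := by
    simp only [palindromicQuartic, map_zero, map_one]
    grind
  have hadd : ∀ M : Matrix (Fin 2 ⊕ Fin 2) (Fin 2 ⊕ Fin 2) F, M + 1 = 0 ↔ M = 1 := by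
    intro M
    rw [add_eq_zero_iff_eq_neg, CharTwo.neg_eq]
  constructor
  · intro h
    refine ⟨?_, ?_⟩
    · have := minpoly.aeval F g.1
      rw [h] at this
      simp [palindromicQuartic] at this
      exact (hadd _).mp this
    · intro h1
      have h3 : minpoly F g.1 ∣ X ^ 2 - C 1 := minpoly.dvd _ _ (by simp [h1])
      have h4 := natDegree_le_of_dvd h3 (X_pow_sub_C_ne_zero (by norm_num) 1)
      rw [h, palindromicQuartic_natDegree, natDegree_X_pow_sub_C] at h4
      norm_num at h4
  · rintro ⟨h4, h1⟩
    have h3 : minpoly F g.1 ∣ (X - C 1) ^ 4 := minpoly.dvd _ _ (by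
      rw [← hp]
      simp only [palindromicQuartic, map_add, map_mul, aeval_C, map_zero, zero_mul, add_zero, map_one,
        map_pow, aeval_X]
      exact (hadd _).mpr h4)
    obtain ⟨k, hk, ha⟩ := (dvd_prime_pow (prime_X_sub_C (1 : F)) _).mp h3
    have hm : minpoly F g.1 = (X - C 1) ^ k :=
      eq_of_monic_of_associated (minpoly.monic (Algebra.IsIntegral.isIntegral _))
        ((monic_X_sub_C 1).pow k) ha
    obtain rfl | hk3 : k = 4 ∨ k ≤ 3 := by omega
    · rw [hm, hp]
    · exfalso
      apply h1
      apply sq_eq_one_of_add_one_pow_three_eq_zero h4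
      have h5 : aeval g.1 ((X - C (1 : F)) ^ k) = 0 := by rw [← hm, minpoly.aeval]
      rw [← Nat.sub_add_cancel hk3, pow_add]
      have h6 : g.1 + 1 = aeval g.1 (X - C (1 : F)) := by
        simp [sub_eq_add_neg, CharTwo.neg_eq]
      rw [h6, ← map_pow _ _ k, h5, mul_zero]

theorem card_order_four [Finite F] :
    (Nat.card {g : symplecticGroup (Fin 2) F // g.1 ^ 4 = 1 ∧ g.1 ^ 2 ≠ 1} : ℚ) =
      (Nat.card F : ℚ) ^ 2 * ((Nat.card F : ℚ) ^ 2 - 1) * ((Nat.card F : ℚ) ^ 4 - 1) := by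
  have key := card_minpoly_eq_palindromicQuartic_mul (0 : F) 0
  rw [Nat.card_congr (Equiv.subtypeEquivRight fun g => minpoly_eq_of_pow_four)] at key
  have hX2 : (2 : F[X]) = 0 := CharTwo.two_eq_zero
  have hp : palindromicQuartic (0 : F) 0 = (X - C 1) ^ (3 + 1) := by
    simp only [palindromicQuartic, map_zero, map_one]
    grind
  have h0 := card_quadratic_ne_zero_of_eq (0 : F)
  rw [add_zero, mul_zero] at h0
  rw [h0, hp, card_units_adjoinRoot_pow (irreducible_X_sub_C 1), natDegree_X_sub_C] at key
  have hG := card_symplecticGroup_fin_two F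
  have hq : 1 < Nat.card F := Finite.one_lt_card
  generalize Nat.card (symplecticGroup (Fin 2) F) = G at *
  generalize Nat.card {g : symplecticGroup (Fin 2) F // g.1 ^ 4 = 1 ∧ g.1 ^ 2 ≠ 1} = N at *
  generalize Nat.card F = q at *
  have key' := congrArg (Nat.cast : ℕ → ℚ) key
  push_cast [Nat.cast_sub hq.le, pow_one] at key'
  rw [hG] at key'
  have hq' : (1 : ℚ) < q := by exact_mod_cast hq
  have n1 : (q : ℚ) - 1 ≠ 0 := by linarith
  have n3 : (q : ℚ) ≠ 0 := by linarith
  apply mul_right_cancel₀ (b := (q - 1) * (q : ℚ) ^ 3) (by positivity)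
  linear_combination key'

end

/-! ### Eigenvalues of symplectic matrices -/

section
variable {F : Type*} [Field F]

/-- A symplectic matrix is conjugate to the inverse of its transpose, so its characteristic
polynomial is self-reciprocal. -/
theorem exists_charpoly_eq_palindromicQuartic (g : symplecticGroup (Fin 2) F) :
    ∃ t s, g.1.charpoly = palindromicQuartic t s := by
  have hdet := SymplecticGroup.det_eq_one g.2
  have h1 : (g⁻¹).1.charpoly = g.1.charpoly := by
    rw [SymplecticGroup.coe_inv, charpoly_mul_comm, ← Matrix.mul_assoc, Matrix.mul_neg, J_squared,
      neg_neg, Matrix.one_mul, charpoly_transpose]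
  have hu : IsUnit g.1 := (isUnit_iff_isUnit_det _).mpr (by simp [hdet])
  have hd : g.1.charpoly.natDegree = 4 := by rw [charpoly_natDegree_eq_dim]; simp
  have h2 : g.1.charpoly = g.1.charpoly.reverse := by
    conv_lhs => rw [← h1, SymplecticGroup.coe_inv', charpoly_inv _ hu, hdet]
    rw [reverse_charpoly]
    simp only [Fintype.card_sum, Fintype.card_fin, Ring.inverse_one, C_1, mul_one]
    ring
  have h3 : ∀ i, g.1.charpoly.coeff i = g.1.charpoly.coeff (revAt 4 i) := by
    intro i
    conv_lhs => rw [h2, coeff_reverse, hd]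
  have hm := charpoly_monic g.1
  have h4 : g.1.charpoly.coeff 4 = 1 := by rw [← hd]; exact hm
  refine ⟨g.1.charpoly.coeff 3, g.1.charpoly.coeff 2, ?_⟩
  refine g.1.charpoly.as_sum_range_C_mul_X_pow.trans ?_
  rw [hd]
  have h5 := h3 0
  have h6 := h3 1
  rw [revAt_le (by norm_num)] at h5 h6
  simp only [Finset.sum_range_succ, Finset.sum_range_zero, h4, h5, h6, palindromicQuartic]
  simp
  ring

/-- An eigenvalue is a root of every polynomial that annihilates the matrix. -/
theorem aeval_eq_zero_of_isRoot_charpoly {n K : Type*} [Fintype n] [DecidableEq n] [Field K]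
    [Algebra F K] {g : Matrix n n F} {a : K} (ha : aeval a g.charpoly = 0) {p : F[X]}
    (hp : aeval g p = 0) : aeval a p = 0 := by
  have h1 := charpoly_map g (algebraMap F K)
  have h2 : eval a (g.map (algebraMap F K)).charpoly = 0 := by
    rw [h1, eval_map_algebraMap, ha]
  rw [eval_charpoly] at h2
  obtain ⟨v, hv, h3⟩ := exists_mulVec_eq_zero_iff.mpr h2
  set A := g.map (algebraMap F K) with hA
  have h4 : A *ᵥ v = a • v := by
    rw [sub_mulVec, sub_eq_zero] at h3
    rw [← h3]
    ext i
    simp [scalar_apply, mulVec_diagonal]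
  have h5 : ∀ p : K[X], aeval A p *ᵥ v = eval a p • v := by
    intro p
    induction p using Polynomial.induction_on' with
    | add p q hp hq => rw [map_add, add_mulVec, hp, hq, eval_add, add_smul]
    | monomial k c =>
      have : ∀ k : ℕ, A ^ k *ᵥ v = a ^ k • v := fun k => by
        induction k with
        | zero => simp
        | succ k ih => rw [pow_succ, ← mulVec_mulVec, h4, mulVec_smul, ih, smul_smul, pow_succ, mul_comm]
      rw [aeval_monomial, eval_monomial, ← mulVec_mulVec, this, mulVec_smul, mul_smul, smul_comm]
      congr 1
      rw [Matrix.algebraMap_eq_diagonal]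
      ext i
      simp [mulVec_diagonal]
  have h6 : aeval A (p.map (algebraMap F K)) = 0 := by
    rw [aeval_map_algebraMap]
    have := aeval_algHom_apply (Algebra.ofId F K).mapMatrix g p
    rw [hp, map_zero] at this
    exact this
  have h7 := h5 (p.map (algebraMap F K))
  rw [h6, zero_mulVec, eval_map_algebraMap] at h7
  exact (smul_eq_zero.mp h7.symm).resolve_right hv

/-- A symplectic matrix and its inverse are annihilated by the same polynomials. -/
theorem aeval_inv_eq_zero {g : symplecticGroup (Fin 2) F} {p : F[X]} (hp : aeval g.1 p = 0) :
    aeval (g⁻¹).1 p = 0 := by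
  have hJ : IsUnit (J (Fin 2) F).det := isUnit_det_J _ _
  have h1 : (g.1)ᵀ * J (Fin 2) F = J (Fin 2) F * (g⁻¹).1 := by
    have := SymplecticGroup.mem_iff'.mp g.2
    conv_rhs => rw [← this]
    have h2 : g.1 * (g⁻¹).1 = 1 := congrArg Subtype.val (mul_inv_cancel g)
    rw [Matrix.mul_assoc, Matrix.mul_assoc, h2, Matrix.mul_one]
  have h2 := minpoly_eq_of_mul_eq_mul hJ h1
  have h3 : ∀ p : F[X], aeval (g.1)ᵀ p = (aeval g.1 p)ᵀ := by
    intro p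
    induction p using Polynomial.induction_on' with
    | add p q hp hq => rw [map_add, map_add, transpose_add, hp, hq]
    | monomial k c =>
      rw [aeval_monomial, aeval_monomial, ← transpose_pow, transpose_mul,
        Matrix.algebraMap_eq_diagonal, diagonal_transpose, ← Matrix.algebraMap_eq_diagonal,
        Algebra.commutes]
  rw [← minpoly.dvd_iff, ← h2, minpoly.dvd_iff, h3, hp, transpose_zero]

variable {K : Type*} [Field K]

theorem palindromicQuartic_map [Algebra F K] (t s : F) :
    (palindromicQuartic t s).map (algebraMap F K) =
      palindromicQuartic (algebraMap F K t) (algebraMap F K s) := by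
  simp [palindromicQuartic]

theorem palindromicQuadratic_map [Algebra F K] (y : F) :
    (palindromicQuadratic y).map (algebraMap F K) = palindromicQuadratic (algebraMap F K y) := by
  simp [palindromicQuadratic]

theorem palindromicQuartic_inj {t s t' s' : K} (h : palindromicQuartic t s = palindromicQuartic t' s') :
    t = t' ∧ s = s' := by
  have h1 := congrArg (fun p => coeff p 3) h
  have h2 := congrArg (fun p => coeff p 2) h
  simp only [palindromicQuartic, coeff_add, coeff_X_pow, coeff_C_mul, coeff_one, coeff_X] at h1 h2
  norm_num at h1 h2
  exact ⟨h1, h2⟩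

theorem add_inv_eq_add_inv_iff {a b : K} (ha : a ≠ 0) (hb : b ≠ 0) :
    a + a⁻¹ = b + b⁻¹ ↔ b = a ∨ b = a⁻¹ := by
  constructor
  · intro h
    field_simp at h
    have : (b - a) * (b * a - 1) = 0 := by linear_combination -h
    rcases mul_eq_zero.mp this with h | h
    · exact Or.inl (sub_eq_zero.mp h)
    · exact Or.inr (eq_inv_of_mul_eq_one_left (sub_eq_zero.mp h))
  · rintro (rfl | rfl)
    · rfl
    · rw [inv_inv, add_comm]

variable [CharP K 2]

theorem add_inv_eq_zero_iff {a : K} (ha : a ≠ 0) : a + a⁻¹ = 0 ↔ a = 1 := by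
  have h2 : (2 : K) = 0 := CharTwo.two_eq_zero
  have : (1 : K) + 1⁻¹ = 0 := by rw [inv_one]; linear_combination h2
  rw [← this, eq_comm, add_inv_eq_add_inv_iff one_ne_zero ha]
  simp

theorem eval_palindromicQuadratic_eq_zero_iff {a y : K} (ha : a ≠ 0) :
    eval a (palindromicQuadratic y) = 0 ↔ y = a + a⁻¹ := by
  have h2 : (2 : K) = 0 := CharTwo.two_eq_zero
  simp only [palindromicQuadratic, eval_add, eval_pow, eval_X, eval_mul, eval_C, eval_one]
  have : a ^ 2 + y * a + 1 = a * (y - (a + a⁻¹)) := by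
    field_simp
    linear_combination (a ^ 2 + 1) * h2
  rw [this, mul_eq_zero, sub_eq_zero]
  simp [ha]

theorem palindromicQuadratic_add_inv {a : K} (ha : a ≠ 0) :
    palindromicQuadratic (a + a⁻¹) = (X - C a) * (X - C a⁻¹) := by
  have h2 : (2 : K[X]) = 0 := CharTwo.two_eq_zero
  have h3 : C a * C a⁻¹ = (1 : K[X]) := by rw [← C_mul, mul_inv_cancel₀ ha, C_1]
  rw [palindromicQuadratic, map_add]
  linear_combination (-1 : K[X]) * h3 + (X * C a + X * C a⁻¹) * h2

theorem exists_add_inv_eq [IsAlgClosed K] (y : K) : ∃ a : K, a ≠ 0 ∧ a + a⁻¹ = y := by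
  obtain ⟨a, ha⟩ := IsAlgClosed.exists_root (palindromicQuadratic y) (by
    rw [degree_eq_natDegree (palindromicQuadratic_monic y).ne_zero, palindromicQuadratic_natDegree]
    norm_num)
  have h0 : a ≠ 0 := by
    rintro rfl
    simp [palindromicQuadratic] at ha
  exact ⟨a, h0, ((eval_palindromicQuadratic_eq_zero_iff h0).mp ha).symm⟩

/-- `a, a⁻¹, b, b⁻¹` are the eigenvalues of `M` with multiplicity, for `p = (a, b)`; this is
expressed in characteristic two, where `(X - a)(X - a⁻¹) = X² + (a + a⁻¹)X + 1`. -/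
def IsEigenvaluePair {n : Type*} [Fintype n] [DecidableEq n] [Algebra F K] (M : Matrix n n F)
    (p : K × K) : Prop :=
  p.1 ≠ 0 ∧ p.2 ≠ 0 ∧ M.charpoly.map (algebraMap F K) =
    palindromicQuadratic (p.1 + p.1⁻¹) * palindromicQuadratic (p.2 + p.2⁻¹)

/-- The four elements `a, a⁻¹, b, b⁻¹` are distinct, for `p = (a, b)` with nonzero entries; this is
expressed in characteristic two, where `a = a⁻¹` means `a + a⁻¹ = 0`. -/
def GenericPair (p : K × K) : Prop :=
  p.1 + p.1⁻¹ ≠ 0 ∧ p.2 + p.2⁻¹ ≠ 0 ∧ p.1 + p.1⁻¹ ≠ p.2 + p.2⁻¹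

/-- With `y = a + a⁻¹` and `z = b + b⁻¹`, the characteristic polynomial `X⁴ + tX³ + sX² + tX + 1`
splits if `y + z = t` and `yz = s`. -/
theorem exists_isEigenvaluePair [IsAlgClosed K] [Algebra F K] (g : symplecticGroup (Fin 2) F) :
    ∃ p : K × K, IsEigenvaluePair g.1 p := by
  have h2 : (2 : K) = 0 := CharTwo.two_eq_zero
  obtain ⟨t, s, h⟩ := exists_charpoly_eq_palindromicQuartic g
  set t' := algebraMap F K t
  set s' := algebraMap F K s
  obtain ⟨y, hy⟩ := IsAlgClosed.exists_root (X ^ 2 + C t' * X + C s' : K[X]) (by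
    have : (X ^ 2 + C t' * X + C s' : K[X]).degree = 2 := by compute_degree!
    rw [this]; norm_num)
  simp [IsRoot] at hy
  obtain ⟨a, ha, rfl⟩ := exists_add_inv_eq y
  obtain ⟨b, hb, hz⟩ := exists_add_inv_eq (a + a⁻¹ + t')
  refine ⟨(a, b), ha, hb, ?_⟩
  rw [h, palindromicQuartic_map, palindromicQuadratic_mul]
  simp only [hz]
  congr 1
  · linear_combination -(a + a⁻¹) * h2
  · linear_combination s' * h2 - hy

theorem isEigenvaluePair_iff [Algebra F K] {g : symplecticGroup (Fin 2) F} {t s : F} {p : K × K}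
    (h1 : p.1 ≠ 0) (h2 : p.2 ≠ 0)
    (ht : algebraMap F K t = (p.1 + p.1⁻¹) + (p.2 + p.2⁻¹))
    (hs : algebraMap F K s = (p.1 + p.1⁻¹) * (p.2 + p.2⁻¹)) :
    IsEigenvaluePair g.1 p ↔ g.1.charpoly = palindromicQuartic t s := by
  rw [IsEigenvaluePair, palindromicQuadratic_mul, ← ht, ← hs, ← palindromicQuartic_map,
    (map_injective _ (algebraMap F K).injective).eq_iff]
  tauto

/-- The sum and the product of `a + a⁻¹` and `b + b⁻¹` are coefficients of the characteristic
polynomial, hence lie in the field of definition. -/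
theorem IsEigenvaluePair.exists_coeff [Algebra F K] {g : symplecticGroup (Fin 2) F} {p : K × K}
    (h : IsEigenvaluePair g.1 p) : ∃ t s : F, algebraMap F K t = (p.1 + p.1⁻¹) + (p.2 + p.2⁻¹) ∧
      algebraMap F K s = (p.1 + p.1⁻¹) * (p.2 + p.2⁻¹) ∧ g.1.charpoly = palindromicQuartic t s := by
  obtain ⟨t, s, hc⟩ := exists_charpoly_eq_palindromicQuartic g
  have := h.2.2
  rw [hc, palindromicQuadratic_mul, palindromicQuartic_map] at this
  obtain ⟨h1, h2⟩ := palindromicQuartic_inj this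
  exact ⟨t, s, h1, h2, hc⟩

theorem IsEigenvaluePair.aeval_eq_zero [Algebra F K] {g : symplecticGroup (Fin 2) F} {p : K × K}
    (h : IsEigenvaluePair g.1 p) {f : F[X]} (hf : aeval g.1 f = 0) :
    aeval p.1 f = 0 ∧ aeval p.2 f = 0 ∧ aeval p.1⁻¹ f = 0 ∧ aeval p.2⁻¹ f = 0 := by
  obtain ⟨h1, h2, h3⟩ := h
  have key : ∀ x : K, eval x (palindromicQuadratic (p.1 + p.1⁻¹) *
      palindromicQuadratic (p.2 + p.2⁻¹)) = 0 → aeval x f = 0 := by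
    intro x hx
    rw [← h3, eval_map_algebraMap] at hx
    exact aeval_eq_zero_of_isRoot_charpoly hx hf
  rw [palindromicQuadratic_add_inv h1, palindromicQuadratic_add_inv h2] at key
  refine ⟨key _ ?_, key _ ?_, key _ ?_, key _ ?_⟩ <;> simp

theorem IsEigenvaluePair.pow_eq_one [Algebra F K] {g : symplecticGroup (Fin 2) F} {p : K × K}
    (h : IsEigenvaluePair g.1 p) {m : ℕ} (hm : g ^ m = 1) : p.1 ^ m = 1 ∧ p.2 ^ m = 1 := by
  have h1 : aeval g.1 (X ^ m - 1 : F[X]) = 0 := by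
    have := congrArg Subtype.val hm
    simp only [SubmonoidClass.coe_pow] at this
    simp [this]
  have := h.aeval_eq_zero h1
  simp only [map_sub, map_pow, aeval_X, map_one, sub_eq_zero] at this
  exact ⟨this.1, this.2.1⟩

/-- In the generic case the four distinct factors `X - a`, `X - a⁻¹`, `X - b`, `X - b⁻¹` together
divide every polynomial that vanishes at the eigenvalues. -/
theorem GenericPair.dvd {p : K × K} (hp : GenericPair p) (h1 : p.1 ≠ 0) (h2 : p.2 ≠ 0) {f : K[X]}
    (hf : eval p.1 f = 0 ∧ eval p.2 f = 0 ∧ eval p.1⁻¹ f = 0 ∧ eval p.2⁻¹ f = 0) :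
    palindromicQuadratic (p.1 + p.1⁻¹) * palindromicQuadratic (p.2 + p.2⁻¹) ∣ f := by
  obtain ⟨ha, hb, hab⟩ := hp
  have key : ∀ x : K, x ≠ 0 → x + x⁻¹ ≠ 0 → eval x f = 0 → eval x⁻¹ f = 0 →
      palindromicQuadratic (x + x⁻¹) ∣ f := by
    intro x hx0 hx h1 h2
    rw [palindromicQuadratic_add_inv hx0]
    refine IsCoprime.mul_dvd ?_ (dvd_iff_isRoot.mpr h1) (dvd_iff_isRoot.mpr h2)
    apply isCoprime_X_sub_C_of_isUnit_sub
    rw [CharTwo.sub_eq_add]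
    exact hx.isUnit
  exact (isCoprime_palindromicQuadratic hab).mul_dvd (key _ h1 ha hf.1 hf.2.2.1)
    (key _ h2 hb hf.2.1 hf.2.2.2)

theorem GenericPair.minpoly_eq [Algebra F K] {g : symplecticGroup (Fin 2) F} {p : K × K}
    (hp : GenericPair p) (h : IsEigenvaluePair g.1 p) : minpoly F g.1 = g.1.charpoly := by
  have h1 := hp.dvd h.1 h.2.1 (f := (minpoly F g.1).map (algebraMap F K)) (by
    simpa only [eval_map_algebraMap] using h.aeval_eq_zero (minpoly.aeval F g.1))
  rw [← h.2.2, map_dvd_map' (algebraMap F K)] at h1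
  exact eq_of_monic_of_associated (minpoly.monic (Algebra.IsIntegral.isIntegral _))
    (charpoly_monic _) (associated_of_dvd_dvd (minpoly_dvd_charpoly _) h1)

theorem GenericPair.pow_eq_one_iff [Algebra F K] {g : symplecticGroup (Fin 2) F} {p : K × K}
    (hp : GenericPair p) (h : IsEigenvaluePair g.1 p) {m : ℕ} :
    g ^ m = 1 ↔ p.1 ^ m = 1 ∧ p.2 ^ m = 1 := by
  refine ⟨h.pow_eq_one, fun ⟨ha, hb⟩ => ?_⟩
  have h1 := hp.dvd h.1 h.2.1 (f := (X ^ m - 1 : F[X]).map (algebraMap F K)) (by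
    simp [ha, hb])
  rw [← h.2.2, map_dvd_map' (algebraMap F K)] at h1
  obtain ⟨c, hc⟩ := h1
  have h2 := congrArg (aeval g.1) hc
  rw [map_mul, aeval_self_charpoly, zero_mul] at h2
  simp only [map_sub, map_pow, aeval_X, map_one, sub_eq_zero] at h2
  exact Subtype.ext (by simpa using h2)

theorem GenericPair.orderOf_eq [Algebra F K] {g : symplecticGroup (Fin 2) F} {p : K × K}
    (hp : GenericPair p) (h : IsEigenvaluePair g.1 p) :
    orderOf g = (orderOf p.1).lcm (orderOf p.2) := by
  have key : ∀ m, orderOf g ∣ m ↔ (orderOf p.1).lcm (orderOf p.2) ∣ m := by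
    intro m
    rw [orderOf_dvd_iff_pow_eq_one, hp.pow_eq_one_iff h, Nat.lcm_dvd_iff, orderOf_dvd_iff_pow_eq_one,
      orderOf_dvd_iff_pow_eq_one]
  exact Nat.dvd_antisymm ((key _).mpr dvd_rfl) ((key _).mp dvd_rfl)

end

/-! ### Counting elements with generic eigenvalues -/

/-- The rational form of `Nat.card_eq_mul_of_card_fiber`. -/
theorem Nat.cast_card_eq_mul_of_card_fiber {α β : Type*} [Finite α] [Finite β] (f : α → β) (k : ℚ)
    (h : ∀ b, (Nat.card {a // f a = b} : ℚ) = k) : (Nat.card α : ℚ) = Nat.card β * k := by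
  rcases isEmpty_or_nonempty β with hβ | ⟨⟨b⟩⟩
  · have : IsEmpty α := ⟨fun a => hβ.false (f a)⟩
    simp
  · rw [← h b, ← Nat.cast_mul, Nat.card_eq_mul_of_card_fiber f (Nat.card {a // f a = b})]
    intro b'
    exact_mod_cast (h b').trans (h b).symm

section
variable {F K : Type*} [Field F] [Field K] [CharP K 2] [Algebra F K]

/-- The eight eigenvalue pairs of an element with four distinct eigenvalues arise from one another
by inverting and exchanging the entries. -/
theorem card_isEigenvaluePair {g : symplecticGroup (Fin 2) F} {p : K × K} (hp : GenericPair p)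
    (h : IsEigenvaluePair g.1 p) : Nat.card {p' : K × K // IsEigenvaluePair g.1 p'} = 8 := by
  classical
  obtain ⟨a, b⟩ := p
  have ha := h.1
  have hb := h.2.1
  obtain ⟨h1, h2, h3⟩ := hp
  simp only at ha hb h1 h2 h3
  have hne : ∀ x : K, x ≠ 0 → x + x⁻¹ ≠ 0 → x ≠ x⁻¹ := by
    intro x hx0 hx he
    rw [← he, CharTwo.add_self_eq_zero] at hx
    exact hx rfl
  have hiff : ∀ p' : K × K, IsEigenvaluePair g.1 p' ↔
      p' ∈ ({a, a⁻¹} ×ˢ {b, b⁻¹} ∪ {b, b⁻¹} ×ˢ {a, a⁻¹} : Finset (K × K)) := by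
    rintro ⟨a', b'⟩
    have hq : IsEigenvaluePair g.1 (a', b') ↔ a' ≠ 0 ∧ b' ≠ 0 ∧
        ((a + a⁻¹ = a' + a'⁻¹ ∧ b + b⁻¹ = b' + b'⁻¹) ∨
          (b + b⁻¹ = a' + a'⁻¹ ∧ a + a⁻¹ = b' + b'⁻¹)) := by
      simp only [IsEigenvaluePair, h.2.2]
      refine and_congr_right fun _ => and_congr_right fun _ => ⟨fun he => ?_, ?_⟩
      · rw [palindromicQuadratic_mul, palindromicQuadratic_mul] at he
        obtain ⟨e1, e2⟩ := palindromicQuartic_inj he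
        have : ((a + a⁻¹) - (a' + a'⁻¹)) * ((b + b⁻¹) - (a' + a'⁻¹)) = 0 := by
          linear_combination e2 - (a' + a'⁻¹) * e1
        rcases mul_eq_zero.mp this with e | e
        · refine Or.inl ⟨sub_eq_zero.mp e, ?_⟩
          linear_combination e1 - e
        · refine Or.inr ⟨sub_eq_zero.mp e, ?_⟩
          linear_combination e1 - e
      · rintro (⟨e1, e2⟩ | ⟨e1, e2⟩)
        · rw [e1, e2]
        · rw [e1, e2, mul_comm]
    rw [hq]
    simp only [Finset.mem_union, Finset.mem_product, Finset.mem_insert, Finset.mem_singleton]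
    constructor
    · rintro ⟨ha', hb', hh⟩
      rwa [add_inv_eq_add_inv_iff ha ha', add_inv_eq_add_inv_iff hb hb',
        add_inv_eq_add_inv_iff hb ha', add_inv_eq_add_inv_iff ha hb'] at hh
    · intro hh
      have ha' : a' ≠ 0 := by
        rcases hh with ⟨rfl | rfl, -⟩ | ⟨rfl | rfl, -⟩ <;> simp [ha, hb]
      have hb' : b' ≠ 0 := by
        rcases hh with ⟨-, rfl | rfl⟩ | ⟨-, rfl | rfl⟩ <;> simp [ha, hb]
      refine ⟨ha', hb', ?_⟩
      rwa [add_inv_eq_add_inv_iff ha ha', add_inv_eq_add_inv_iff hb hb',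
        add_inv_eq_add_inv_iff hb ha', add_inv_eq_add_inv_iff ha hb']
  rw [Nat.card_congr (Equiv.subtypeEquivRight hiff), Nat.card_eq_fintype_card, Fintype.card_coe,
    Finset.card_union_of_disjoint, Finset.card_product, Finset.card_product,
    Finset.card_pair (hne a ha h1), Finset.card_pair (hne b hb h2)]
  rw [Finset.disjoint_left]
  rintro ⟨x, y⟩ hx hy
  simp only [Finset.mem_product, Finset.mem_insert, Finset.mem_singleton] at hx hy
  apply h3
  rcases hx.1 with rfl | rfl
  · exact (add_inv_eq_add_inv_iff ha hb).mpr (by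
      rcases hy.1 with e | e
      · exact Or.inl e.symm
      · exact Or.inr (by rw [e, inv_inv]))
  · exact (add_inv_eq_add_inv_iff ha hb).mpr (by
      rcases hy.1 with e | e
      · exact Or.inr e.symm
      · exact Or.inl (inv_injective e).symm)

theorem finite_pair_pow_eq_one (K : Type*) [Field K] {m : ℕ} (hm : m ≠ 0) :
    Finite {p : K × K // p.1 ^ m = 1 ∧ p.2 ^ m = 1} := by
  have : NeZero m := ⟨hm⟩
  have hf : {x : K | x ^ m = 1}.Finite := by
    classical
    refine (nthRootsFinset m (1 : K)).finite_toSet.subset fun x hx => ?_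
    simpa [mem_nthRootsFinset (Nat.pos_of_ne_zero hm)] using hx
  exact (hf.prod hf).to_subtype

/-- A generic pair `(a, b)` such that `(X - a)(X - a⁻¹)(X - b)(X - b⁻¹)` has coefficients in `F`; in
characteristic two these are determined by the sum and the product of `a + a⁻¹` and `b + b⁻¹`. -/
def IsRationalPair (F : Type*) {K : Type*} [Field F] [Field K] [Algebra F K] (p : K × K) : Prop :=
  p.1 ≠ 0 ∧ p.2 ≠ 0 ∧ GenericPair p ∧
    ∃ t s : F, algebraMap F K t = (p.1 + p.1⁻¹) + (p.2 + p.2⁻¹) ∧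
      algebraMap F K s = (p.1 + p.1⁻¹) * (p.2 + p.2⁻¹)

theorem IsRationalPair.genericPair {L : Type*} [Field L] [Algebra F L] {p : L × L}
    (h : IsRationalPair F p) : GenericPair p := h.2.2.1

/-- A rational pair belongs to exactly one minimal polynomial of regular symplectic elements. -/
theorem IsRationalPair.exists_iff {p : K × K} (h : IsRationalPair F p) :
    ∃ t s : F, algebraMap F K t = (p.1 + p.1⁻¹) + (p.2 + p.2⁻¹) ∧
      algebraMap F K s = (p.1 + p.1⁻¹) * (p.2 + p.2⁻¹) ∧ ∀ g : symplecticGroup (Fin 2) F,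
        IsEigenvaluePair g.1 p ↔ minpoly F g.1 = palindromicQuartic t s := by
  obtain ⟨h1, h2, h3, t, s, ht, hs⟩ := h
  refine ⟨t, s, ht, hs, fun g => ?_⟩
  refine ⟨fun he => ?_, fun he => ?_⟩
  · rw [h3.minpoly_eq he]
    exact (isEigenvaluePair_iff h1 h2 ht hs).mp he
  · rw [isEigenvaluePair_iff h1 h2 ht hs, ← he]
    refine (eq_of_monic_of_dvd_of_natDegree_le (minpoly.monic (Algebra.IsIntegral.isIntegral _))
      (charpoly_monic _) (minpoly_dvd_charpoly _) ?_)
    rw [he, palindromicQuartic_natDegree, charpoly_natDegree_eq_dim]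
    simp

/-- Double counting of the elements of order `m` with generic eigenvalues: each of them has eight
eigenvalue pairs, each of which is shared by a class of `n` elements. -/
theorem card_orderOf_generic_mul [Finite F] {m : ℕ} (hm : m ≠ 0) {n : ℚ}
    (hn : ∀ p : K × K, IsRationalPair F p → (orderOf p.1).lcm (orderOf p.2) = m →
      (Nat.card {g : symplecticGroup (Fin 2) F // IsEigenvaluePair g.1 p} : ℚ) = n) :
    (Nat.card {g : symplecticGroup (Fin 2) F // orderOf g = m ∧
        ∃ p : K × K, GenericPair p ∧ IsEigenvaluePair g.1 p} : ℚ) * 8 =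
      Nat.card {p : K × K // IsRationalPair F p ∧ (orderOf p.1).lcm (orderOf p.2) = m} * n := by
  have hfin := finite_pair_pow_eq_one K hm
  have hpow : ∀ p : K × K, (orderOf p.1).lcm (orderOf p.2) = m → p.1 ^ m = 1 ∧ p.2 ^ m = 1 := by
    rintro p rfl
    exact ⟨orderOf_dvd_iff_pow_eq_one.mp (Nat.dvd_lcm_left _ _),
      orderOf_dvd_iff_pow_eq_one.mp (Nat.dvd_lcm_right _ _)⟩
  have : Finite {p : K × K // IsRationalPair F p ∧ (orderOf p.1).lcm (orderOf p.2) = m} :=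
    Finite.of_injective (fun p => (⟨p.1, hpow _ p.2.2⟩ : {p : K × K // p.1 ^ m = 1 ∧ p.2 ^ m = 1}))
      (fun p p' h => Subtype.ext (congrArg Subtype.val h :))
  have hgen : ∀ (g : symplecticGroup (Fin 2) F) (p p' : K × K), GenericPair p →
      IsEigenvaluePair g.1 p → IsEigenvaluePair g.1 p' → GenericPair p' := by
    intro g p p' hp h h'
    have e := h.2.2.symm.trans h'.2.2
    rw [palindromicQuadratic_mul, palindromicQuadratic_mul] at e
    obtain ⟨e1, e2⟩ := palindromicQuartic_inj e
    obtain ⟨a1, a2, a3⟩ := hp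
    have h2 : (2 : K) = 0 := CharTwo.two_eq_zero
    refine ⟨?_, ?_, ?_⟩
    · intro h0
      rw [h0, zero_mul] at e2
      exact (mul_ne_zero a1 a2) e2
    · intro h0
      rw [h0, mul_zero] at e2
      exact (mul_ne_zero a1 a2) e2
    · intro h0
      apply sub_ne_zero.mpr a3
      rw [← h0] at e1
      linear_combination e1 + (p'.1 + p'.1⁻¹ - (p.2 + p.2⁻¹)) * h2
  let T := {x : symplecticGroup (Fin 2) F × {p : K × K // IsRationalPair F p ∧
    (orderOf p.1).lcm (orderOf p.2) = m} // IsEigenvaluePair x.1.1 x.2.1}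
  have hord : ∀ x : T, orderOf x.1.1 = m := fun x => by
    rw [x.1.2.2.1.genericPair.orderOf_eq x.2, x.1.2.2.2]
  have e1 : (Nat.card T : ℚ) = Nat.card {g : symplecticGroup (Fin 2) F // orderOf g = m ∧
        ∃ p : K × K, GenericPair p ∧ IsEigenvaluePair g.1 p} * 8 := by
    refine Nat.cast_card_eq_mul_of_card_fiber (fun x : T => ⟨x.1.1, hord x, x.1.2.1, x.1.2.2.1.genericPair, x.2⟩)
      8 ?_
    · rintro ⟨g, hg, p, hp, he⟩
      rw [show (8 : ℚ) = ((8 : ℕ) : ℚ) by norm_num, ← card_isEigenvaluePair hp he]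
      congr 1
      refine Nat.card_congr ⟨fun x => ⟨x.1.1.2.1, ?_⟩, fun p' => ⟨⟨⟨g, p'.1, ?_, ?_⟩, p'.2⟩, rfl⟩, ?_,
        fun _ => rfl⟩
      · have h1 : x.1.1.1 = g := congrArg Subtype.val x.2
        have := x.1.2
        rwa [h1] at this
      · obtain ⟨t, s, ht, hs, -⟩ := p'.2.exists_coeff
        exact ⟨p'.2.1, p'.2.2.1, hgen g p p'.1 hp he p'.2, t, s, ht, hs⟩
      · rw [← (hgen g p p'.1 hp he p'.2).orderOf_eq p'.2, hg]
      · rintro ⟨⟨⟨g', p'⟩, h'⟩, e⟩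
        obtain rfl : g' = g := congrArg Subtype.val e
        rfl
  rw [← e1]
  refine Nat.cast_card_eq_mul_of_card_fiber (fun x : T => x.1.2) n ?_
  rintro ⟨p, hp⟩
  rw [← hn p hp.1 hp.2]
  congr 1
  refine Nat.card_congr ⟨fun x => ⟨x.1.1.1, ?_⟩, fun g => ⟨⟨(g.1, ⟨p, hp⟩), g.2⟩, rfl⟩, ?_, fun _ => rfl⟩
  · have := x.1.2
    rwa [x.2] at this
  · rintro ⟨⟨⟨g', p'⟩, h'⟩, e⟩
    obtain rfl : p' = ⟨p, hp⟩ := e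
    rfl

end

/-! ### Sizes of the generic classes -/

section
variable {F K : Type*} [Field F] [Field K] [CharP F 2] [CharP K 2] [Algebra F K] [Finite F]

/-- The class of a rational pair when `a + a⁻¹` and `b + b⁻¹` both lie in `F`. -/
theorem card_isEigenvaluePair_mul_of_algebraMap {p : K × K} (h : IsRationalPair F p) {y z : F}
    (hy : algebraMap F K y = p.1 + p.1⁻¹) (hz : algebraMap F K z = p.2 + p.2⁻¹) :
    Nat.card {g : symplecticGroup (Fin 2) F // IsEigenvaluePair g.1 p} *
      (Nat.card (AdjoinRoot (palindromicQuadratic y))ˣ *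
        Nat.card (AdjoinRoot (palindromicQuadratic z))ˣ) =
      (Nat.card F - 1) ^ 2 * Nat.card (symplecticGroup (Fin 2) F) := by
  obtain ⟨t, s, ht, hs, hiff⟩ := h.exists_iff
  have hyz : y ≠ z := by
    rintro rfl
    exact h.2.2.1.2.2 (hy.symm.trans hz)
  rw [← hy, ← hz, ← map_add] at ht
  rw [← hy, ← hz, ← map_mul] at hs
  obtain rfl := (algebraMap F K).injective ht
  obtain rfl := (algebraMap F K).injective hs
  rw [Nat.card_congr (Equiv.subtypeEquivRight hiff),
    ← card_units_adjoinRoot_mul (isCoprime_palindromicQuadratic hyz), palindromicQuadratic_mul,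
    card_minpoly_eq_palindromicQuartic_mul, card_quadratic_ne_zero_of_ne hyz]

/-- The class of a rational pair when `a + a⁻¹` and `b + b⁻¹` are conjugate over `F` and not in
`F`, so that the quadratic form attached to the class is anisotropic. -/
theorem card_isEigenvaluePair_mul_of_conj {p : K × K} (h : IsRationalPair F p)
    (hF : (p.1 + p.1⁻¹) ^ Nat.card F = p.2 + p.2⁻¹) :
    ∃ t s : F, algebraMap F K t = (p.1 + p.1⁻¹) + (p.2 + p.2⁻¹) ∧
      algebraMap F K s = (p.1 + p.1⁻¹) * (p.2 + p.2⁻¹) ∧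
    Nat.card {g : symplecticGroup (Fin 2) F // IsEigenvaluePair g.1 p} *
      Nat.card (AdjoinRoot (palindromicQuartic t s))ˣ =
      (Nat.card F ^ 2 - 1) * Nat.card (symplecticGroup (Fin 2) F) := by
  obtain ⟨t, s, ht, hs, hiff⟩ := h.exists_iff
  refine ⟨t, s, ht, hs, ?_⟩
  rw [Nat.card_congr (Equiv.subtypeEquivRight hiff), card_minpoly_eq_palindromicQuartic_mul,
    card_quadratic_ne_zero_of_no_root]
  intro x hx
  have h2 : (2 : K) = 0 := CharTwo.two_eq_zero
  have h3 := congrArg (algebraMap F K) hx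
  simp only [map_add, map_mul, map_pow, map_zero, ht, hs] at h3
  have h4 : (p.1 + p.1⁻¹ - algebraMap F K x) * (p.2 + p.2⁻¹ - algebraMap F K x) = 0 := by
    linear_combination h3 - algebraMap F K x * (p.1 + p.1⁻¹ + (p.2 + p.2⁻¹)) * h2
  have hxq := algebraMap_pow_card (K := K) x
  apply h.2.2.1.2.2
  rcases mul_eq_zero.mp h4 with h5 | h5
  · have h5 := sub_eq_zero.mp h5
    rw [← hF, h5, hxq]
  · have h5 := sub_eq_zero.mp h5
    rw [h5, ← hxq] at hF
    rw [h5]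
    have := Fintype.ofFinite F
    rw [Nat.card_eq_fintype_card] at hF
    exact (FiniteField.frobeniusAlgHom F K).injective hF

end

/-! ### Frobenius action on eigenvalues -/

/-- The number of elements satisfying one of two incompatible conditions. -/
theorem Nat.card_subtype_or {α : Type*} {P Q : α → Prop} [Finite {x // P x}] [Finite {x // Q x}]
    (h : ∀ x, P x → ¬ Q x) :
    Nat.card {x // P x ∨ Q x} = Nat.card {x // P x} + Nat.card {x // Q x} := by
  classical
  rw [← Nat.card_sum]
  exact Nat.card_congr (subtypeOrEquiv P Q (Pi.disjoint_iff.mpr fun x => by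
    simpa [Prop.disjoint_iff] using h x))

section
variable {F K : Type*} [Field F] [Finite F] [Field K] [Algebra F K]

theorem add_pow_card (F : Type*) {K : Type*} [Field F] [Finite F] [Field K] [Algebra F K] (x y : K) :
    (x + y) ^ Nat.card F = x ^ Nat.card F + y ^ Nat.card F := by
  have := Fintype.ofFinite F
  rw [Nat.card_eq_fintype_card]
  exact map_add (FiniteField.frobeniusAlgHom F K) x y

theorem pow_card_injective (F : Type*) {K : Type*} [Field F] [Finite F] [Field K] [Algebra F K] :
    Function.Injective (fun x : K => x ^ Nat.card F) := by
  have := Fintype.ofFinite F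
  rw [Nat.card_eq_fintype_card]
  exact (FiniteField.frobeniusAlgHom F K).injective

theorem orderOf_dvd_sub_one_of_pow_eq {a : K} {n : ℕ} (ha : a ≠ 0) (hn : 1 ≤ n) :
    orderOf a ∣ n - 1 ↔ a ^ n = a := by
  rw [orderOf_dvd_iff_pow_eq_one]
  obtain ⟨k, rfl⟩ := Nat.exists_eq_add_of_le' hn
  rw [Nat.add_sub_cancel, pow_succ]
  constructor
  · intro h
    rw [h, one_mul]
  · intro h
    exact mul_right_cancel₀ ha (h.trans (one_mul a).symm)

theorem orderOf_dvd_add_one_of_pow_eq {a : K} {n : ℕ} (ha : a ≠ 0) :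
    orderOf a ∣ n + 1 ↔ a ^ n = a⁻¹ := by
  rw [orderOf_dvd_iff_pow_eq_one, pow_succ]
  exact ⟨eq_inv_of_mul_eq_one_left, fun h => by rw [h, inv_mul_cancel₀ ha]⟩

theorem add_inv_pow_card (F : Type*) {K : Type*} [Field F] [Finite F] [Field K] [Algebra F K]
    (a : K) : (a + a⁻¹) ^ Nat.card F = a ^ Nat.card F + (a ^ Nat.card F)⁻¹ := by
  rw [add_pow_card, inv_pow]

/-- `a + a⁻¹` lies in `F` exactly if the order of `a` divides `q - 1` or `q + 1`. -/
theorem add_inv_pow_card_eq_iff {a : K} (ha : a ≠ 0) :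
    (a + a⁻¹) ^ Nat.card F = a + a⁻¹ ↔
      orderOf a ∣ Nat.card F - 1 ∨ orderOf a ∣ Nat.card F + 1 := by
  rw [add_inv_pow_card, eq_comm, add_inv_eq_add_inv_iff ha (pow_ne_zero _ ha),
    orderOf_dvd_sub_one_of_pow_eq ha Nat.card_pos, orderOf_dvd_add_one_of_pow_eq ha]

/-- Frobenius permutes the two roots of a quadratic polynomial over `F`. -/
theorem pow_card_eq_or {y z : K} {t s : F} (ht : algebraMap F K t = y + z)
    (hs : algebraMap F K s = y * z) :
    (y ^ Nat.card F = y ∧ z ^ Nat.card F = z) ∨ (y ^ Nat.card F = z ∧ z ^ Nat.card F = y) := by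
  have h1 := algebraMap_pow_card (K := K) t
  have h2 := algebraMap_pow_card (K := K) s
  rw [ht, add_pow_card] at h1
  rw [hs, mul_pow] at h2
  set y' := y ^ Nat.card F
  set z' := z ^ Nat.card F
  have h3 : (y' - y) * (y' - z) = 0 := by linear_combination y' * h1 - h2
  rcases mul_eq_zero.mp h3 with h | h
  · exact Or.inl ⟨sub_eq_zero.mp h, by linear_combination h1 - h⟩
  · exact Or.inr ⟨sub_eq_zero.mp h, by linear_combination h1 - h⟩

variable [CharP K 2]

/-- Frobenius fixes both of `a + a⁻¹` and `b + b⁻¹` or exchanges them; if it does not fix them, the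
pair is generic. -/
theorem IsEigenvaluePair.pow_card_eq_or {g : symplecticGroup (Fin 2) F} {p : K × K}
    (h : IsEigenvaluePair g.1 p) :
    ((p.1 + p.1⁻¹) ^ Nat.card F = p.1 + p.1⁻¹ ∧ (p.2 + p.2⁻¹) ^ Nat.card F = p.2 + p.2⁻¹) ∨
      (GenericPair p ∧ (p.1 + p.1⁻¹) ^ Nat.card F = p.2 + p.2⁻¹) := by
  obtain ⟨t, s, ht, hs, -⟩ := h.exists_coeff
  rcases _root_.pow_card_eq_or ht hs with h1 | h1
  · exact Or.inl h1
  · by_cases h2 : (p.1 + p.1⁻¹) ^ Nat.card F = p.1 + p.1⁻¹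
    · rw [h1.1] at h2
      rw [h2] at h1 ⊢
      exact Or.inl ⟨h1.1, h1.1⟩
    · refine Or.inr ⟨⟨fun h0 => h2 ?_, fun h0 => h2 ?_, fun h0 => h2 ?_⟩, h1.1⟩
      · rw [h0, zero_pow Nat.card_pos.ne']
      · rw [h0, zero_pow Nat.card_pos.ne'] at h1
        rw [← h1.2, zero_pow Nat.card_pos.ne']
      · rw [h1.1, h0]

end

section
variable {F K : Type*} [Field F] [Field K] [CharP F 2] [CharP K 2] [Algebra F K]

/-- The `k`-th power of an element whose eigenvalues are `k`-th roots of unity is unipotent, and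
unipotent matrices of size four in characteristic two have order dividing four. -/
theorem IsEigenvaluePair.pow_four_mul_eq_one {g : symplecticGroup (Fin 2) F} {p : K × K}
    (h : IsEigenvaluePair g.1 p) {k : ℕ} (h1 : p.1 ^ k = 1) (h2 : p.2 ^ k = 1) : g ^ (4 * k) = 1 := by
  have key : ∀ x : K, x ≠ 0 → x ^ k = 1 → palindromicQuadratic (x + x⁻¹) ∣ (X ^ k - 1) ^ 2 := by
    intro x hx0 hx
    rw [palindromicQuadratic_add_inv hx0, sq]
    refine mul_dvd_mul (dvd_iff_isRoot.mpr ?_) (dvd_iff_isRoot.mpr ?_) <;> simp [hx]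
  have h3 := mul_dvd_mul (key _ h.1 h1) (key _ h.2.1 h2)
  have hX : (2 : F[X]) = 0 := CharTwo.two_eq_zero
  rw [← h.2.2, ← pow_add, show ((X ^ k - 1) ^ (2 + 2) : K[X]) =
    ((X ^ k - 1) ^ (2 + 2) : F[X]).map (algebraMap F K) by simp, map_dvd_map' (algebraMap F K),
    show ((X ^ k - 1) ^ (2 + 2) : F[X]) = X ^ (4 * k) - 1 by
      rw [mul_comm 4 k, pow_mul]
      linear_combination (-2 * (X ^ k) ^ 3 + 3 * (X ^ k) ^ 2 - 2 * X ^ k + 1) * hX] at h3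
  obtain ⟨c, hc⟩ := h3
  have h4 := congrArg (aeval g.1) hc
  rw [map_mul, aeval_self_charpoly, zero_mul] at h4
  simp only [map_sub, map_pow, aeval_X, map_one, sub_eq_zero] at h4
  exact Subtype.ext (by simpa using h4)

theorem IsEigenvaluePair.lcm_orderOf_eq {g : symplecticGroup (Fin 2) F} {p : K × K}
    (h : IsEigenvaluePair g.1 p) (hg : Odd (orderOf g)) :
    (orderOf p.1).lcm (orderOf p.2) = orderOf g := by
  have h1 := h.pow_eq_one (pow_orderOf_eq_one g)
  apply Nat.dvd_antisymm
  · rw [Nat.lcm_dvd_iff, orderOf_dvd_iff_pow_eq_one, orderOf_dvd_iff_pow_eq_one]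
    exact h1
  · have h2 := orderOf_dvd_iff_pow_eq_one.mpr (h.pow_four_mul_eq_one
      (orderOf_dvd_iff_pow_eq_one.mp (Nat.dvd_lcm_left (orderOf p.1) (orderOf p.2)))
      (orderOf_dvd_iff_pow_eq_one.mp (Nat.dvd_lcm_right (orderOf p.1) (orderOf p.2))))
    refine Nat.Coprime.dvd_of_dvd_mul_left ?_ h2
    exact Nat.Coprime.pow_right 2 hg.coprime_two_right

end

/-! ### Unit groups of the quotient algebras -/

section
theorem irreducible_palindromicQuadratic {k : Type*} [Field k] {y : k} (h : ∀ x : k, x ^ 2 + y * x + 1 ≠ 0) :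
    Irreducible (palindromicQuadratic y) := by
  rw [irreducible_iff_roots_eq_zero_of_degree_le_three
    (by rw [palindromicQuadratic_natDegree]) (by rw [palindromicQuadratic_natDegree]; norm_num)]
  refine Multiset.eq_zero_of_forall_notMem fun x hx => h x ?_
  have := (mem_roots'.mp hx).2
  simpa [palindromicQuadratic] using this

variable {F K : Type*} [Field F] [Field K] [CharP K 2] [Algebra F K] [Finite F]

theorem exists_root_of_pow_card_eq {a : K} (h0 : a ≠ 0) (ha : a ^ Nat.card F = a) {y : F}
    (hy : algebraMap F K y = a + a⁻¹) : ∃ α : F, α ^ 2 + y * α + 1 = 0 := by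
  obtain ⟨α, rfl⟩ := exists_algebraMap_eq_of_pow_card_eq ha
  refine ⟨α, (algebraMap F K).injective ?_⟩
  have := (eval_palindromicQuadratic_eq_zero_iff h0).mpr hy
  simpa [palindromicQuadratic] using this

theorem card_units_palindromicQuartic_of_pow_card_sq_eq_inv {a : K} (h0 : a ≠ 0)
    (hp : GenericPair (a, a ^ Nat.card F)) (ha : a ^ Nat.card F ^ 2 = a⁻¹) {t s : F}
    (ht : algebraMap F K t = (a + a⁻¹) + (a ^ Nat.card F + (a ^ Nat.card F)⁻¹))
    (hs : algebraMap F K s = (a + a⁻¹) * (a ^ Nat.card F + (a ^ Nat.card F)⁻¹)) :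
    Nat.card (AdjoinRoot (palindromicQuartic t s))ˣ = Nat.card F ^ 4 - 1 := by
  have hc0 : a ^ Nat.card F ≠ 0 := pow_ne_zero _ h0
  have h3 : a ^ Nat.card F ^ 3 = (a ^ Nat.card F)⁻¹ := by
    rw [pow_succ, pow_mul, ha, inv_pow]
  have hself : ∀ x : K, x + x⁻¹ ≠ 0 → x ≠ x⁻¹ := by
    intro x hx he
    rw [← he, CharTwo.add_self_eq_zero] at hx
    exact hx rfl
  obtain ⟨e1, e2, e3⟩ := hp
  simp only [ne_eq] at e1 e2 e3
  rw [add_inv_eq_add_inv_iff h0 hc0, not_or] at e3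
  have k1 := hself _ e1
  have k2 := hself _ e2
  have k3 : a⁻¹ ≠ (a ^ Nat.card F)⁻¹ := fun h => e3.1 (inv_injective h).symm
  have k4 : a ≠ (a ^ Nat.card F)⁻¹ := fun h => e3.2 (by rw [h, inv_inv, ← h])
  have k5 : a⁻¹ ≠ a ^ Nat.card F := fun h => e3.2 h.symm
  have k6 : a ≠ a ^ Nat.card F := fun h => e3.1 h.symm
  have hi : Irreducible (palindromicQuartic t s) := by
    refine irreducible_of_conjugates_injOn (palindromicQuartic_monic _ _) (a := a) ?_ ?_
    · rw [← eval_map_algebraMap, palindromicQuartic_map, ht, hs, ← palindromicQuadratic_mul,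
        palindromicQuadratic_add_inv h0]
      simp
    · rw [palindromicQuartic_natDegree]
      intro i hi j hj hij
      simp only [Finset.coe_range, Set.mem_Iio] at hi hj
      simp only at hij
      have q0 : a ^ Nat.card F ^ 0 = a := by simp
      have q1 : a ^ Nat.card F ^ 1 = a ^ Nat.card F := by simp
      interval_cases i <;> interval_cases j <;> simp only [q0, q1, ha, h3] at hij <;>
        first
        | rfl
        | exact absurd hij (by assumption)
        | exact absurd hij.symm (by assumption)
  rw [card_units_adjoinRoot hi, palindromicQuartic_natDegree]

theorem card_units_palindromicQuadratic_of_no_root {y : F} (h : ∀ x : F, x ^ 2 + y * x + 1 ≠ 0) :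
    Nat.card (AdjoinRoot (palindromicQuadratic y))ˣ = Nat.card F ^ 2 - 1 := by
  rw [card_units_adjoinRoot (irreducible_palindromicQuadratic h), palindromicQuadratic_natDegree]

/-- If `a` lies in the quadratic extension of `F`, then the polynomial with roots
`a, a⁻¹, a^q, a^(-q)` is the product of the minimal polynomials of `a` and `a⁻¹`. -/
theorem card_units_palindromicQuartic_of_pow_card_sq_eq {a : K} (h0 : a ≠ 0)
    (hp : GenericPair (a, a ^ Nat.card F)) (ha : a ^ Nat.card F ^ 2 = a) {t s : F}
    (ht : algebraMap F K t = (a + a⁻¹) + (a ^ Nat.card F + (a ^ Nat.card F)⁻¹))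
    (hs : algebraMap F K s = (a + a⁻¹) * (a ^ Nat.card F + (a ^ Nat.card F)⁻¹)) :
    Nat.card (AdjoinRoot (palindromicQuartic t s))ˣ =
      (Nat.card F ^ 2 - 1) * (Nat.card F ^ 2 - 1) := by
  have hc0 : a ^ Nat.card F ≠ 0 := pow_ne_zero _ h0
  have hcq : (a ^ Nat.card F) ^ Nat.card F = a := by rw [← pow_mul, ← sq, ha]
  have key : ∀ x : K, (x ^ Nat.card F) ^ Nat.card F = x → x ^ Nat.card F ≠ x → ∃ f : F[X],
      f.map (algebraMap F K) = (X - C x) * (X - C (x ^ Nat.card F)) ∧ Irreducible f ∧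
        f.natDegree = 2 := by
    intro x hx hne
    obtain ⟨u, hu⟩ := exists_algebraMap_eq_of_pow_card_eq (F := F) (x := x + x ^ Nat.card F) (by
      rw [add_pow_card, hx, add_comm])
    obtain ⟨v, hv⟩ := exists_algebraMap_eq_of_pow_card_eq (F := F) (x := x * x ^ Nat.card F) (by
      rw [mul_pow, hx, mul_comm])
    have hd : (X ^ 2 - C u * X + C v : F[X]).natDegree = 2 := by compute_degree!
    have hf : (X ^ 2 - C u * X + C v : F[X]).map (algebraMap F K) =
        (X - C x) * (X - C (x ^ Nat.card F)) := by
      simp only [Polynomial.map_add, Polynomial.map_sub, Polynomial.map_mul, Polynomial.map_pow,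
        map_X, map_C, hu, hv, C_add, C_mul]
      ring
    refine ⟨_, hf, irreducible_of_conjugates_injOn (by monicity!) (a := x) ?_ ?_, hd⟩
    · rw [← eval_map_algebraMap, hf]
      simp
    · rw [hd]
      intro i hi j hj hij
      simp only [Finset.coe_range, Set.mem_Iio] at hi hj
      simp only at hij
      have q0 : x ^ Nat.card F ^ 0 = x := by simp
      have q1 : x ^ Nat.card F ^ 1 = x ^ Nat.card F := by simp
      interval_cases i <;> interval_cases j <;> simp only [q0, q1] at hij <;>
        first
        | rfl
        | exact absurd hij hne
        | exact absurd hij.symm hne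
  have hne : a ^ Nat.card F ≠ a := fun h => hp.2.2 (by simp only [h])
  obtain ⟨f₁, hf₁, hi₁, hd₁⟩ := key a hcq hne
  obtain ⟨f₂, hf₂, hi₂, hd₂⟩ := key a⁻¹ (by rw [inv_pow, inv_pow, hcq]) (by
    rw [inv_pow]
    exact fun h => hne (inv_injective h))
  have hmul : palindromicQuartic t s = f₁ * f₂ := by
    apply map_injective (algebraMap F K) (algebraMap F K).injective
    rw [palindromicQuartic_map, ht, hs, ← palindromicQuadratic_mul, palindromicQuadratic_add_inv h0,
      palindromicQuadratic_add_inv hc0, Polynomial.map_mul, hf₁, hf₂, inv_pow]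
    ring
  have hcop : IsCoprime f₁ f₂ := by
    rw [← isCoprime_map (algebraMap F K), hf₁, hf₂, inv_pow]
    have hu : ∀ x y : K, x ≠ y → IsCoprime (X - C x) (X - C y) := fun x y h =>
      isCoprime_X_sub_C_of_isUnit_sub (sub_ne_zero.mpr h).isUnit
    obtain ⟨e1, e2, e3⟩ := hp
    simp only [ne_eq] at e1 e2 e3
    rw [add_inv_eq_add_inv_iff h0 hc0, not_or] at e3
    have hself : ∀ x : K, x + x⁻¹ ≠ 0 → x ≠ x⁻¹ := by
      intro x hx he
      rw [← he, CharTwo.add_self_eq_zero] at hx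
      exact hx rfl
    refine IsCoprime.mul_left (IsCoprime.mul_right ?_ ?_) (IsCoprime.mul_right ?_ ?_)
    · exact hu _ _ (hself _ e1)
    · exact hu _ _ fun h => e3.2 (by rw [h, inv_inv, ← h])
    · exact hu _ _ e3.2
    · exact hu _ _ (hself _ e2)
  rw [hmul, card_units_adjoinRoot_mul hcop, card_units_adjoinRoot hi₁, card_units_adjoinRoot hi₂,
    hd₁, hd₂]

variable [CharP F 2]

theorem card_units_palindromicQuadratic_of_root {α y : F} (hy : y ≠ 0)
    (hα : α ^ 2 + y * α + 1 = 0) :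
    Nat.card (AdjoinRoot (palindromicQuadratic y))ˣ = (Nat.card F - 1) * (Nat.card F - 1) := by
  have h0 : α ≠ 0 := by
    rintro rfl
    simp at hα
  have h1 : y = α + α⁻¹ := (eval_palindromicQuadratic_eq_zero_iff h0).mp (by
    simpa [palindromicQuadratic] using hα)
  rw [h1, palindromicQuadratic_add_inv h0, card_units_adjoinRoot_mul
    (isCoprime_X_sub_C_of_isUnit_sub (by rw [CharTwo.sub_eq_add, ← h1]; exact hy.isUnit)),
    card_units_adjoinRoot (irreducible_X_sub_C _), card_units_adjoinRoot (irreducible_X_sub_C _)]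
  simp

theorem no_root_of_pow_card_eq_inv {a : K} (h0 : a ≠ 0) (ha : a ^ Nat.card F = a⁻¹) {y : F}
    (hy : algebraMap F K y = a + a⁻¹) (hy0 : y ≠ 0) : ∀ x : F, x ^ 2 + y * x + 1 ≠ 0 := by
  intro x hx
  have hx0 : x ≠ 0 := by
    rintro rfl
    simp at hx
  have h1 := congrArg (algebraMap F K) ((eval_palindromicQuadratic_eq_zero_iff hx0).mp (by
    simpa [palindromicQuadratic] using hx))
  rw [hy, map_add, map_inv₀, add_inv_eq_add_inv_iff h0 (by simpa using hx0)] at h1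
  have h2 := algebraMap_pow_card (K := K) x
  have h3 : a = a⁻¹ := by
    rcases h1 with h1 | h1
    · rw [h1, ha] at h2
      exact h2.symm
    · rw [h1, inv_pow, ha, inv_inv] at h2
      exact h2
  rw [← h3, CharTwo.add_self_eq_zero] at hy
  exact hy0 ((map_eq_zero _).mp hy)

end

/-! ### Pairs of roots of unity -/

section
variable {K : Type*} [Field K] [CharP K 2]

theorem card_orderOf_eq_totient (K : Type*) [Field K] [CharP K 2] [IsAlgClosed K] {m : ℕ}
    (hm : Odd m) : Nat.card {a : K // orderOf a = m} = m.totient := by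
  have : NeZero (m : K) := ⟨fun h => by
    rw [CharP.cast_eq_zero_iff K 2] at h
    exact Nat.not_even_iff_odd.mpr hm (even_iff_two_dvd.mpr h)⟩
  obtain ⟨ζ, hζ⟩ := HasEnoughRootsOfUnity.exists_primitiveRoot K m
  rw [← hζ.card_primitiveRoots]
  refine Nat.subtype_card _ fun x => ?_
  rw [mem_primitiveRoots hm.pos, IsPrimitiveRoot.iff_orderOf]

theorem card_orderOf_prod [IsAlgClosed K] {r s : ℕ} (hr : Odd r) (hs : Odd s) :
    Nat.card {p : K × K // orderOf p.1 = r ∧ orderOf p.2 = s} = r.totient * s.totient := by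
  rw [← card_orderOf_eq_totient K hr, ← card_orderOf_eq_totient K hs, ← Nat.card_prod]
  exact Nat.card_congr ⟨fun p => (⟨p.1.1, p.2.1⟩, ⟨p.1.2, p.2.2⟩),
    fun p => ⟨(p.1.1, p.2.1), p.1.2, p.2.2⟩, fun _ => rfl, fun _ => rfl⟩

theorem Nat.finite_of_card_pos {α : Type*} (h : 0 < Nat.card α) : Finite α :=
  Nat.finite_of_card_ne_zero h.ne'

/-- For `f` preserving nontriviality, every `a` of order `m` belongs to the two pairs
`(a, f a)` and `(a, (f a)⁻¹)`. -/
theorem card_orderOf_graph [IsAlgClosed K] {m : ℕ} (hm : Odd m) (f : K → K)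
    (hf : ∀ a, orderOf a = m → f a ≠ 0 ∧ f a ≠ 1) :
    Nat.card {p : K × K // orderOf p.1 = m ∧ (p.2 = f p.1 ∨ p.2 = (f p.1)⁻¹)} = m.totient * 2 := by
  classical
  rw [← card_orderOf_eq_totient K hm]
  have hfin : Finite {a : K // orderOf a = m} := Nat.finite_of_card_pos (by
    rw [card_orderOf_eq_totient K hm]; exact Nat.totient_pos.mpr hm.pos)
  have hfib : ∀ b : {a : K // orderOf a = m}, Nat.card {x : K // x = f b.1 ∨ x = (f b.1)⁻¹} = 2 := by
    rintro ⟨a, ha⟩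
    have hne : f a ≠ (f a)⁻¹ := by
      intro h
      apply (hf a ha).2
      rw [← add_inv_eq_zero_iff (hf a ha).1, ← h, CharTwo.add_self_eq_zero]
    rw [← Finset.card_pair hne]
    exact Nat.subtype_card _ fun x => by simp
  have e : {p : K × K // orderOf p.1 = m ∧ (p.2 = f p.1 ∨ p.2 = (f p.1)⁻¹)} ≃
      Σ b : {a : K // orderOf a = m}, {x : K // x = f b.1 ∨ x = (f b.1)⁻¹} :=
    ⟨fun p => ⟨⟨p.1.1, p.2.1⟩, ⟨p.1.2, p.2.2⟩⟩, fun p => ⟨(p.1.1, p.2.1), p.1.2, p.2.2⟩,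
      fun _ => rfl, fun _ => rfl⟩
  have := Fintype.ofFinite {a : K // orderOf a = m}
  have : ∀ b : {a : K // orderOf a = m}, Finite {x : K // x = f b.1 ∨ x = (f b.1)⁻¹} := fun b =>
    Nat.finite_of_card_pos (by rw [hfib]; norm_num)
  rw [Nat.card_congr e, Nat.card_sigma, Finset.sum_congr rfl fun b _ => hfib b, Finset.sum_const,
    Finset.card_univ, smul_eq_mul, Nat.card_eq_fintype_card]

end

/-! ### Orders dividing `q² + 1` and products of divisors of `q - 1` and `q + 1` -/

section
variable {F K : Type*} [Field F] [Field K] [Algebra F K]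

theorem ne_zero_of_odd_orderOf {a : K} (h : Odd (orderOf a)) : a ≠ 0 := by
  rintro rfl
  simp at h

theorem IsRationalPair.swap {p : K × K} (h : IsRationalPair F p) : IsRationalPair F p.swap := by
  obtain ⟨h1, h2, ⟨h3, h4, h5⟩, t, s, ht, hs⟩ := h
  exact ⟨h2, h1, ⟨h4, h3, h5.symm⟩, t, s, ht.trans (add_comm _ _), hs.trans (mul_comm _ _)⟩

/-- Conjugate eigenvalue pairs may be normalised to `(a, a ^ q)`. -/
theorem IsRationalPair.conj {p : K × K} (h : IsRationalPair F p)
    (hp : p.2 = p.1 ^ Nat.card F ∨ p.2 = (p.1 ^ Nat.card F)⁻¹) :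
    p.2 + p.2⁻¹ = p.1 ^ Nat.card F + (p.1 ^ Nat.card F)⁻¹ ∧
      GenericPair (p.1, p.1 ^ Nat.card F) := by
  have hz : p.2 + p.2⁻¹ = p.1 ^ Nat.card F + (p.1 ^ Nat.card F)⁻¹ := by
    rw [eq_comm, add_inv_eq_add_inv_iff (pow_ne_zero _ h.1) h.2.1]
    exact hp
  have := h.genericPair
  unfold GenericPair at this ⊢
  rw [hz] at this
  exact ⟨hz, this⟩

theorem IsEigenvaluePair.swap {g : symplecticGroup (Fin 2) F} {p : K × K}
    (h : IsEigenvaluePair g.1 p) : IsEigenvaluePair g.1 p.swap :=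
  ⟨h.2.1, h.1, h.2.2.trans (mul_comm _ _)⟩

variable [Finite F]

theorem even_natCard (F : Type*) [Field F] [Finite F] [CharP F 2] : Even (Nat.card F) := by
  have := Fintype.ofFinite F
  rw [Nat.card_eq_fintype_card, Nat.even_iff, ← FiniteField.even_card_iff_char_two]
  exact ringChar.eq F 2

theorem IsRationalPair.pow_card_eq_or {p : K × K} (h : IsRationalPair F p) :
    ((p.1 + p.1⁻¹) ^ Nat.card F = p.1 + p.1⁻¹ ∧ (p.2 + p.2⁻¹) ^ Nat.card F = p.2 + p.2⁻¹) ∨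
      (p.2 = p.1 ^ Nat.card F ∨ p.2 = (p.1 ^ Nat.card F)⁻¹) := by
  obtain ⟨h1, h2, -, t, s, ht, hs⟩ := h
  refine (_root_.pow_card_eq_or ht hs).imp id fun h3 => ?_
  rw [← add_inv_eq_add_inv_iff (pow_ne_zero _ h1) h2, ← add_inv_pow_card, h3.1]

theorem isRationalPair_of_pow_card_eq {p : K × K} (h1 : p.1 ≠ 0) (h2 : p.2 ≠ 0)
    (hp : GenericPair p) (h3 : (p.1 + p.1⁻¹) ^ Nat.card F = p.1 + p.1⁻¹)
    (h4 : (p.2 + p.2⁻¹) ^ Nat.card F = p.2 + p.2⁻¹) : IsRationalPair F p := by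
  obtain ⟨y, hy⟩ := exists_algebraMap_eq_of_pow_card_eq h3
  obtain ⟨z, hz⟩ := exists_algebraMap_eq_of_pow_card_eq h4
  exact ⟨h1, h2, hp, y + z, y * z, by rw [map_add, hy, hz], by rw [map_mul, hy, hz]⟩

/-- Conversely a pair `(a, a^q)`, up to inversion of the second entry, is rational if `a + a⁻¹`
lies in the quadratic extension of `F` but not in `F`. -/
theorem isRationalPair_conj {p : K × K} (h0 : p.1 ≠ 0)
    (ha : p.1 ^ Nat.card F ^ 2 = p.1 ∨ p.1 ^ Nat.card F ^ 2 = p.1⁻¹)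
    (hp : p.2 = p.1 ^ Nat.card F ∨ p.2 = (p.1 ^ Nat.card F)⁻¹)
    (hne : (p.1 + p.1⁻¹) ^ Nat.card F ≠ p.1 + p.1⁻¹) : IsRationalPair F p := by
  have hc : p.1 ^ Nat.card F ≠ 0 := pow_ne_zero _ h0
  have h2 : p.2 ≠ 0 := by
    rcases hp with h | h <;> rw [h]
    · exact hc
    · exact inv_ne_zero hc
  have hz : p.2 + p.2⁻¹ = (p.1 + p.1⁻¹) ^ Nat.card F := by
    rw [add_inv_pow_card, eq_comm, add_inv_eq_add_inv_iff hc h2]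
    exact hp
  have hzq : (p.2 + p.2⁻¹) ^ Nat.card F = p.1 + p.1⁻¹ := by
    rw [hz, add_inv_pow_card, add_inv_pow_card, ← pow_mul, ← sq]
    rcases ha with h | h <;> rw [h]
    rw [inv_inv, add_comm]
  refine ⟨h0, h2, ⟨fun h => hne ?_, fun h => hne ?_, fun h => hne ?_⟩, ?_⟩
  · rw [h, zero_pow Nat.card_pos.ne']
  · rw [h, zero_pow Nat.card_pos.ne'] at hzq
    rw [← hzq, zero_pow Nat.card_pos.ne']
  · rw [h, hzq, h]
  · obtain ⟨t, ht⟩ := exists_algebraMap_eq_of_pow_card_eq (F := F)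
      (x := (p.1 + p.1⁻¹) + (p.2 + p.2⁻¹)) (by rw [add_pow_card, hzq, ← hz, add_comm])
    obtain ⟨s, hs⟩ := exists_algebraMap_eq_of_pow_card_eq (F := F)
      (x := (p.1 + p.1⁻¹) * (p.2 + p.2⁻¹)) (by rw [mul_pow, hzq, ← hz, mul_comm])
    exact ⟨t, s, ht, hs⟩

variable [CharP K 2]

variable [CharP F 2]

/-- All elements of order `r ∣ q² + 1` are generic, with eigenvalue pairs `(a, a^q)` and `(a,
a^(-q))` for `a` of order `r`. -/
theorem card_orderOf_eq_of_dvd_sq_add_one {r : ℕ} (hr1 : r ≠ 1) (hr : r ∣ Nat.card F ^ 2 + 1) :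
    (Nat.card {g : symplecticGroup (Fin 2) F // orderOf g = r} : ℚ) =
      1 / 4 * (r.totient : ℚ) * (Nat.card F : ℚ) ^ 4 * ((Nat.card F : ℚ) ^ 2 - 1) ^ 2 := by
  let K := AlgebraicClosure F
  have hqe := even_natCard F
  have hq1 : 1 < Nat.card F := Finite.one_lt_card
  have hodd1 : Odd (Nat.card F ^ 2 + 1) := (hqe.pow_of_ne_zero two_ne_zero).add_one
  have hodd : Odd r := Odd.of_dvd_nat hodd1 hr
  -- an order dividing both `r` and `q² - 1` is trivial
  have hcop : ∀ k, k ∣ r → k ∣ Nat.card F - 1 ∨ k ∣ Nat.card F + 1 → k = 1 := by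
    intro k hk h
    have h1 : k ∣ Nat.card F ^ 2 - 1 := by
      have : Nat.card F ^ 2 - 1 = (Nat.card F + 1) * (Nat.card F - 1) := by
        rw [← Nat.sq_sub_sq, one_pow]
      rw [this]
      rcases h with h | h
      · exact Dvd.dvd.mul_left h _
      · exact Dvd.dvd.mul_right h _
    have h2 : k ∣ 2 := by
      have h3 := Nat.dvd_sub (hk.trans hr) h1
      have h4 : 1 ≤ Nat.card F ^ 2 := Nat.one_le_pow _ _ (by omega)
      rwa [show Nat.card F ^ 2 + 1 - (Nat.card F ^ 2 - 1) = 2 by omega] at h3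
    rcases (Nat.dvd_prime Nat.prime_two).mp h2 with h | h
    · exact h
    · subst h
      exact absurd (Odd.of_dvd_nat hodd hk) (by decide)
  have hfix : ∀ a : K, orderOf a ∣ r → (a + a⁻¹) ^ Nat.card F = a + a⁻¹ → orderOf a = 1 := by
    intro a ha h
    have h0 := ne_zero_of_odd_orderOf (Odd.of_dvd_nat hodd ha)
    exact hcop _ ha ((add_inv_pow_card_eq_iff h0).mp h)
  have hS : ∀ p : K × K, (IsRationalPair F p ∧ (orderOf p.1).lcm (orderOf p.2) = r) ↔
      orderOf p.1 = r ∧ (p.2 = p.1 ^ Nat.card F ∨ p.2 = (p.1 ^ Nat.card F)⁻¹) := by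
    intro p
    constructor
    · rintro ⟨h, hl⟩
      have hA : orderOf p.1 ∣ r := hl ▸ Nat.dvd_lcm_left _ _
      have hB : orderOf p.2 ∣ r := hl ▸ Nat.dvd_lcm_right _ _
      rcases h.pow_card_eq_or with h1 | h1
      · rw [hfix _ hA h1.1, hfix _ hB h1.2] at hl
        exact absurd hl.symm hr1
      · refine ⟨?_, h1⟩
        rw [← hl, eq_comm, Nat.lcm_eq_left_iff_dvd, orderOf_dvd_iff_pow_eq_one]
        rcases h1 with h1 | h1 <;>
          simp [h1, ← pow_mul, mul_comm (Nat.card F), pow_mul _ (orderOf p.1)]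
    · rintro ⟨hA, h1⟩
      have h0 := ne_zero_of_odd_orderOf (hA ▸ hodd)
      have h2 : p.1 ^ Nat.card F ^ 2 = p.1⁻¹ := (orderOf_dvd_add_one_of_pow_eq h0).mp (hA ▸ hr)
      refine ⟨isRationalPair_conj h0 (Or.inr h2) h1 fun h => hr1 ?_, ?_⟩
      · rw [← hA, hfix _ hA.dvd h]
      · rw [← hA, Nat.lcm_eq_left_iff_dvd, orderOf_dvd_iff_pow_eq_one]
        rcases h1 with h1 | h1 <;>
          simp [h1, ← pow_mul, mul_comm (Nat.card F), pow_mul _ (orderOf p.1)]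
  have hgen : ∀ g : symplecticGroup (Fin 2) F, orderOf g = r ↔
      orderOf g = r ∧ ∃ p : K × K, GenericPair p ∧ IsEigenvaluePair g.1 p := by
    intro g
    refine ⟨fun hg => ⟨hg, ?_⟩, And.left⟩
    obtain ⟨p, hp⟩ := exists_isEigenvaluePair (K := K) g
    have hl := hp.lcm_orderOf_eq (hg ▸ hodd)
    rw [hg] at hl
    rcases hp.pow_card_eq_or with h1 | h1
    · rw [hfix _ (hl ▸ Nat.dvd_lcm_left _ _) h1.1, hfix _ (hl ▸ Nat.dvd_lcm_right _ _) h1.2] at hl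
      exact absurd hl.symm hr1
    · exact ⟨p, h1.1, hp⟩
  have hq : (1 : ℚ) < Nat.card F := by exact_mod_cast hq1
  have hq4 : (1 : ℚ) < (Nat.card F : ℚ) ^ 4 := one_lt_pow₀ hq (by norm_num)
  have key := card_orderOf_generic_mul (F := F) (K := K) hodd.pos.ne'
    (n := (Nat.card F : ℚ) ^ 4 * ((Nat.card F : ℚ) ^ 2 - 1) ^ 2) (by
      intro p hp hl
      obtain ⟨hA, h1⟩ := (hS p).mp ⟨hp, hl⟩
      have h2 : p.1 ^ Nat.card F ^ 2 = p.1⁻¹ := (orderOf_dvd_add_one_of_pow_eq hp.1).mp (hA ▸ hr)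
      obtain ⟨hz, hg⟩ := hp.conj h1
      obtain ⟨t, s, ht, hs, hc⟩ := card_isEigenvaluePair_mul_of_conj hp (by
        rw [add_inv_pow_card, hz])
      rw [hz] at ht hs
      rw [card_units_palindromicQuartic_of_pow_card_sq_eq_inv hp.1 hg h2 ht hs] at hc
      have hc' := congrArg (Nat.cast (R := ℚ)) hc
      rw [Nat.cast_mul, Nat.cast_mul, Nat.cast_sub (Nat.one_le_pow _ _ (by omega)),
        Nat.cast_sub (Nat.one_le_pow _ _ (by omega)), card_symplecticGroup_fin_two] at hc'
      push_cast at hc'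
      have hne : (Nat.card F : ℚ) ^ 4 - 1 ≠ 0 := by linarith
      exact mul_right_cancel₀ hne (by linear_combination hc'))
  rw [Nat.card_congr (Equiv.subtypeEquivRight hgen)]
  rw [Nat.card_congr (Equiv.subtypeEquivRight hS), card_orderOf_graph hodd (fun a => a ^ Nat.card F)
    (by
      intro a ha
      have h0 := ne_zero_of_odd_orderOf (ha ▸ hodd)
      refine ⟨pow_ne_zero _ h0, fun h => hr1 ?_⟩
      rw [← ha, orderOf_eq_one_iff]
      exact pow_card_injective F (by simpa using h))] at key
  push_cast at key
  linear_combination key / 8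

/-- The class size for an eigenvalue pair of orders dividing `q - 1` and `q + 1`. -/
theorem IsRationalPair.card_eq_of_split_of_nonsplit {p : K × K} (h : IsRationalPair F p)
    (h1 : p.1 ^ Nat.card F = p.1) (h2 : p.2 ^ Nat.card F = p.2⁻¹) :
    (Nat.card {g : symplecticGroup (Fin 2) F // IsEigenvaluePair g.1 p} : ℚ) =
      (Nat.card F : ℚ) ^ 4 * ((Nat.card F : ℚ) ^ 4 - 1) := by
  have hq1 : 1 < Nat.card F := Finite.one_lt_card
  have hp0 := h.1
  have hp0' := h.2.1
  have hg := h.genericPair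
  obtain ⟨y, hy⟩ := exists_algebraMap_eq_of_pow_card_eq (F := F) (x := p.1 + p.1⁻¹)
    (by rw [add_inv_pow_card, h1])
  obtain ⟨z, hz⟩ := exists_algebraMap_eq_of_pow_card_eq (F := F) (x := p.2 + p.2⁻¹)
    (by rw [add_inv_pow_card, h2, inv_inv, add_comm])
  have hy0 : y ≠ 0 := by
    rintro rfl
    exact hg.1 (by rw [← hy, map_zero])
  have hz0 : z ≠ 0 := by
    rintro rfl
    exact hg.2.1 (by rw [← hz, map_zero])
  obtain ⟨α, hα⟩ := exists_root_of_pow_card_eq hp0 h1 hy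
  have hc := card_isEigenvaluePair_mul_of_algebraMap h hy hz
  rw [card_units_palindromicQuadratic_of_root hy0 hα, card_units_palindromicQuadratic_of_no_root
    (no_root_of_pow_card_eq_inv hp0' h2 hz hz0)] at hc
  have hc' := congrArg (Nat.cast (R := ℚ)) hc
  simp only [Nat.cast_mul, Nat.cast_pow, Nat.cast_sub hq1.le,
    Nat.cast_sub (Nat.one_le_pow 2 _ (by omega : 0 < Nat.card F)), card_symplecticGroup_fin_two,
    Nat.cast_one] at hc'
  have hq : (1 : ℚ) < Nat.card F := by exact_mod_cast hq1
  have hq2 : (1 : ℚ) < (Nat.card F : ℚ) ^ 2 := one_lt_pow₀ hq (by norm_num)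
  have hne : ((Nat.card F : ℚ) - 1) ^ 2 * ((Nat.card F : ℚ) ^ 2 - 1) ≠ 0 :=
    mul_ne_zero (pow_ne_zero _ (by linarith)) (by linarith)
  exact mul_right_cancel₀ hne (by linear_combination hc')

/-- All elements of order `rs` are generic. Their eigenvalue pairs have orders `(r, s)` or `(s,
r)`, or are `(a, a^q)` and `(a, a^(-q))` for `a` of order `rs`; the two types of classes have equal
size. -/
theorem card_orderOf_eq_of_dvd_sub_one_of_dvd_add_one {r s : ℕ} (hr1 : r ≠ 1)
    (hr : r ∣ Nat.card F - 1) (hs1 : s ≠ 1) (hs : s ∣ Nat.card F + 1) :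
    (Nat.card {g : symplecticGroup (Fin 2) F // orderOf g = r * s} : ℚ) =
      1 / 2 * ((r * s).totient : ℚ) * (Nat.card F : ℚ) ^ 4 * ((Nat.card F : ℚ) ^ 4 - 1) := by
  let K := AlgebraicClosure F
  have hqe := even_natCard F
  have hq1 : 1 < Nat.card F := Finite.one_lt_card
  have hrodd : Odd r := Odd.of_dvd_nat (Nat.Even.sub_odd hq1.le hqe odd_one) hr
  have hsodd : Odd s := Odd.of_dvd_nat hqe.add_one hs
  have hodd : Odd (r * s) := hrodd.mul hsodd
  have hcop : (Nat.card F - 1).Coprime (Nat.card F + 1) := by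
    rw [show Nat.card F + 1 = 2 + (Nat.card F - 1) by omega, Nat.coprime_add_self_right]
    exact (Nat.Even.sub_odd hq1.le hqe odd_one).coprime_two_right
  have hrs : r.Coprime s := Nat.Coprime.coprime_dvd_left hr (hcop.coprime_dvd_right hs)
  have hrne : r ≠ s := by
    rintro rfl
    exact hr1 ((Nat.coprime_self r).mp hrs)
  have hdr : ∀ k, k ∣ r * s → k ∣ Nat.card F - 1 → k ∣ r := fun k h1 h2 =>
    (Nat.Coprime.coprime_dvd_left h2 (hcop.coprime_dvd_right hs)).dvd_of_dvd_mul_right h1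
  have hds : ∀ k, k ∣ r * s → k ∣ Nat.card F + 1 → k ∣ s := fun k h1 h2 =>
    (Nat.Coprime.coprime_dvd_left h2 (hcop.symm.coprime_dvd_right hr)).dvd_of_dvd_mul_left h1
  have hfix : ∀ a : K, orderOf a ∣ r * s → (a + a⁻¹) ^ Nat.card F = a + a⁻¹ →
      orderOf a ∣ r ∨ orderOf a ∣ s := by
    intro a ha h
    have h0 := ne_zero_of_odd_orderOf (Odd.of_dvd_nat hodd ha)
    exact ((add_inv_pow_card_eq_iff h0).mp h).imp (hdr _ ha) (hds _ ha)
  have hrs_not : ¬ r * s ∣ r := fun h => hs1 (by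
    have := Nat.le_of_dvd hrodd.pos h
    have h3 : r * s ≤ r * 1 := by simpa using this
    have h4 := Nat.le_of_mul_le_mul_left h3 hrodd.pos
    have := hsodd.pos
    omega)
  have hrs_not' : ¬ r * s ∣ s := fun h => hr1 (by
    have := Nat.le_of_dvd hsodd.pos h
    have h3 : r * s ≤ 1 * s := by simpa using this
    have h4 := Nat.le_of_mul_le_mul_right h3 hsodd.pos
    have := hrodd.pos
    omega)
  have hpair : ∀ A B, A ∣ r → B ∣ s → A.lcm B = r * s → A = r ∧ B = s := by
    intro A B hA hB hl
    have h1 : r * s ∣ A * B := hl ▸ Nat.lcm_dvd_mul A B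
    refine ⟨Nat.dvd_antisymm hA ?_, Nat.dvd_antisymm hB ?_⟩
    · exact Nat.dvd_of_mul_dvd_mul_right hsodd.pos (h1.trans (mul_dvd_mul_left A hB))
    · exact Nat.dvd_of_mul_dvd_mul_left hrodd.pos (h1.trans (mul_dvd_mul_right hA B))
  -- a pair of fixed `a + a⁻¹`, `b + b⁻¹` has orders `r` and `s` up to exchange
  have hfixpair : ∀ p : K × K, (orderOf p.1).lcm (orderOf p.2) = r * s →
      (p.1 + p.1⁻¹) ^ Nat.card F = p.1 + p.1⁻¹ → (p.2 + p.2⁻¹) ^ Nat.card F = p.2 + p.2⁻¹ →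
      (orderOf p.1 = r ∧ orderOf p.2 = s) ∨ (orderOf p.1 = s ∧ orderOf p.2 = r) := by
    intro p hl h1 h2
    rcases hfix _ (hl ▸ Nat.dvd_lcm_left _ _) h1 with hA | hA <;>
      rcases hfix _ (hl ▸ Nat.dvd_lcm_right _ _) h2 with hB | hB
    · exact absurd (hl ▸ Nat.lcm_dvd hA hB) hrs_not
    · exact Or.inl (hpair _ _ hA hB hl)
    · exact Or.inr (hpair _ _ hB hA (by rwa [Nat.lcm_comm])).symm
    · exact absurd (hl ▸ Nat.lcm_dvd hA hB) hrs_not'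
  have hgenrs : ∀ p : K × K, orderOf p.1 = r → orderOf p.2 = s → p.1 ≠ 0 ∧ p.2 ≠ 0 ∧
      p.1 ^ Nat.card F = p.1 ∧ p.2 ^ Nat.card F = p.2⁻¹ ∧ GenericPair p := by
    intro p hA hB
    have h1 := ne_zero_of_odd_orderOf (hA ▸ hrodd)
    have h2 := ne_zero_of_odd_orderOf (hB ▸ hsodd)
    refine ⟨h1, h2, (orderOf_dvd_sub_one_of_pow_eq h1 hq1.le).mp (hA ▸ hr),
      (orderOf_dvd_add_one_of_pow_eq h2).mp (hB ▸ hs), ?_, ?_, ?_⟩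
    · rw [ne_eq, add_inv_eq_zero_iff h1, ← orderOf_eq_one_iff, hA]
      exact hr1
    · rw [ne_eq, add_inv_eq_zero_iff h2, ← orderOf_eq_one_iff, hB]
      exact hs1
    · rw [ne_eq, add_inv_eq_add_inv_iff h1 h2]
      intro h
      have : p.2 ^ r = 1 := by
        have h3 : p.1 ^ r = 1 := hA ▸ pow_orderOf_eq_one p.1
        rcases h with h | h <;> simp [h, h3]
      rw [← orderOf_dvd_iff_pow_eq_one, hB] at this
      exact hs1 (hrs.symm.eq_one_of_dvd this)
  have hsplit : ∀ p : K × K, orderOf p.1 = r → orderOf p.2 = s → IsRationalPair F p := by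
    intro p hA hB
    obtain ⟨h1, h2, h3, h4, h5⟩ := hgenrs p hA hB
    exact isRationalPair_of_pow_card_eq h1 h2 h5 (by rw [add_inv_pow_card, h3])
      (by rw [add_inv_pow_card, h4, inv_inv, add_comm])
  have hS : ∀ p : K × K, (IsRationalPair F p ∧ (orderOf p.1).lcm (orderOf p.2) = r * s) ↔
      ((orderOf p.1 = r ∧ orderOf p.2 = s) ∨ (orderOf p.1 = s ∧ orderOf p.2 = r)) ∨
      (orderOf p.1 = r * s ∧ (p.2 = p.1 ^ Nat.card F ∨ p.2 = (p.1 ^ Nat.card F)⁻¹)) := by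
    intro p
    constructor
    · rintro ⟨h, hl⟩
      rcases h.pow_card_eq_or with h1 | h1
      · exact Or.inl (hfixpair p hl h1.1 h1.2)
      · refine Or.inr ⟨?_, h1⟩
        rw [← hl, eq_comm, Nat.lcm_eq_left_iff_dvd, orderOf_dvd_iff_pow_eq_one]
        rcases h1 with h1 | h1 <;>
          simp [h1, ← pow_mul, mul_comm (Nat.card F), pow_mul _ (orderOf p.1)]
    · rintro ((⟨hA, hB⟩ | ⟨hA, hB⟩) | ⟨hA, h1⟩)
      · exact ⟨hsplit p hA hB, by rw [hA, hB, hrs.lcm_eq_mul]⟩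
      · exact ⟨(hsplit p.swap hB hA).swap, by rw [hA, hB, Nat.lcm_comm, hrs.lcm_eq_mul]⟩
      · have h0 := ne_zero_of_odd_orderOf (hA ▸ hodd)
        refine ⟨isRationalPair_conj h0 (Or.inl ?_) h1 fun h => ?_, ?_⟩
        · rw [← orderOf_dvd_sub_one_of_pow_eq h0 (Nat.one_le_pow _ _ (by omega)), hA,
            show Nat.card F ^ 2 - 1 = (Nat.card F - 1) * (Nat.card F + 1) by
              rw [mul_comm, ← Nat.sq_sub_sq, one_pow]]
          exact mul_dvd_mul hr hs
        · rcases hfix _ hA.dvd h with h | h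
          · exact hrs_not (hA ▸ h)
          · exact hrs_not' (hA ▸ h)
        · rw [← hA, Nat.lcm_eq_left_iff_dvd, orderOf_dvd_iff_pow_eq_one]
          rcases h1 with h1 | h1 <;>
            simp [h1, ← pow_mul, mul_comm (Nat.card F), pow_mul _ (orderOf p.1)]
  have hgen : ∀ g : symplecticGroup (Fin 2) F, orderOf g = r * s ↔
      orderOf g = r * s ∧ ∃ p : K × K, GenericPair p ∧ IsEigenvaluePair g.1 p := by
    intro g
    refine ⟨fun hg => ⟨hg, ?_⟩, And.left⟩
    obtain ⟨p, hp⟩ := exists_isEigenvaluePair (K := K) g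
    have hl := hp.lcm_orderOf_eq (hg ▸ hodd)
    rw [hg] at hl
    rcases hp.pow_card_eq_or with h1 | h1
    · rcases hfixpair p hl h1.1 h1.2 with ⟨hA, hB⟩ | ⟨hA, hB⟩
      · exact ⟨p, (hgenrs p hA hB).2.2.2.2, hp⟩
      · exact ⟨p.swap, (hgenrs p.swap hB hA).2.2.2.2, hp.swap⟩
    · exact ⟨p, h1.1, hp⟩
  have hq : (1 : ℚ) < Nat.card F := by exact_mod_cast hq1
  have hq2 : (1 : ℚ) < (Nat.card F : ℚ) ^ 2 := one_lt_pow₀ hq (by norm_num)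
  have key := card_orderOf_generic_mul (F := F) (K := K) hodd.pos.ne'
    (n := (Nat.card F : ℚ) ^ 4 * ((Nat.card F : ℚ) ^ 4 - 1)) (by
      intro p hp hl
      rcases (hS p).mp ⟨hp, hl⟩ with (⟨hA, hB⟩ | ⟨hA, hB⟩) | ⟨hA, h1⟩
      · obtain ⟨-, -, h3, h4, -⟩ := hgenrs p hA hB
        exact hp.card_eq_of_split_of_nonsplit h3 h4
      · obtain ⟨-, -, h3, h4, -⟩ := hgenrs p.swap hB hA
        rw [← hp.swap.card_eq_of_split_of_nonsplit h3 h4]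
        congr 1
        exact Nat.card_congr (Equiv.subtypeEquivRight fun g => ⟨fun h => h.swap, fun h => h.swap⟩)
      · have h2 : p.1 ^ Nat.card F ^ 2 = p.1 := by
          rw [← orderOf_dvd_sub_one_of_pow_eq hp.1 (Nat.one_le_pow _ _ (by omega)), hA,
            show Nat.card F ^ 2 - 1 = (Nat.card F - 1) * (Nat.card F + 1) by
              rw [mul_comm, ← Nat.sq_sub_sq, one_pow]]
          exact mul_dvd_mul hr hs
        obtain ⟨hz, hg⟩ := hp.conj h1
        obtain ⟨t, s, ht, hs, hc⟩ := card_isEigenvaluePair_mul_of_conj hp (by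
          rw [add_inv_pow_card, hz])
        rw [hz] at ht hs
        rw [card_units_palindromicQuartic_of_pow_card_sq_eq hp.1 hg h2 ht hs] at hc
        have hc' := congrArg (Nat.cast (R := ℚ)) hc
        simp only [Nat.cast_mul, Nat.cast_pow,
          Nat.cast_sub (Nat.one_le_pow 2 _ (by omega : 0 < Nat.card F)),
          card_symplecticGroup_fin_two, Nat.cast_one] at hc'
        have hne : ((Nat.card F : ℚ) ^ 2 - 1) * ((Nat.card F : ℚ) ^ 2 - 1) ≠ 0 :=
          mul_ne_zero (by linarith) (by linarith)
        exact mul_right_cancel₀ hne (by linear_combination hc'))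
  have hpos : ∀ {m : ℕ}, Odd m → 0 < m.totient := fun h => Nat.totient_pos.mpr h.pos
  have c1 := card_orderOf_prod (K := K) hrodd hsodd
  have c2 := card_orderOf_prod (K := K) hsodd hrodd
  have c3 := card_orderOf_graph (K := K) hodd (fun a => a ^ Nat.card F) (by
      intro a ha
      have h0 := ne_zero_of_odd_orderOf (ha ▸ hodd)
      refine ⟨pow_ne_zero _ h0, fun h => hrs_not ?_⟩
      rw [← ha, orderOf_eq_one_iff.mpr (pow_card_injective F (by simpa using h))]
      exact one_dvd _)
  have f1 := Nat.finite_of_card_pos (c1 ▸ Nat.mul_pos (hpos hrodd) (hpos hsodd))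
  have f2 := Nat.finite_of_card_pos (c2 ▸ Nat.mul_pos (hpos hsodd) (hpos hrodd))
  have f3 := Nat.finite_of_card_pos (c3 ▸ Nat.mul_pos (hpos hodd) two_pos)
  have hd1 : ∀ p : K × K, orderOf p.1 = r ∧ orderOf p.2 = s →
      ¬ (orderOf p.1 = s ∧ orderOf p.2 = r) := fun p h h' => hrne (h.1.symm.trans h'.1)
  have c12 := Nat.card_subtype_or hd1
  have f12 := Nat.finite_of_card_pos (c12 ▸ c1 ▸ Nat.add_pos_left
    (Nat.mul_pos (hpos hrodd) (hpos hsodd)) _)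
  rw [Nat.card_congr (Equiv.subtypeEquivRight hgen)]
  rw [Nat.card_congr (Equiv.subtypeEquivRight hS), Nat.card_subtype_or (by
    rintro p (h | h) h'
    · exact hrs_not (by rw [← h'.1, h.1])
    · exact hrs_not' (by rw [← h'.1, h.1])), c12, c1, c2, c3, Nat.totient_mul hrs] at key
  rw [Nat.totient_mul hrs]
  push_cast at key ⊢
  linear_combination key / 8

end

/-! ### Pairs of roots of unity with given least common multiple of orders -/

theorem dedekindPsi_mul {m n : ℕ} (h : m.Coprime n) :
    dedekindPsi (m * n) = dedekindPsi m * dedekindPsi n := by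
  rw [dedekindPsi, h.primeFactors_mul, Finset.prod_union h.disjoint_primeFactors, Nat.cast_mul,
    dedekindPsi, dedekindPsi]
  ring

/-- `φ ψ` is Jordan's totient function of order two. -/
theorem sum_divisors_totient_mul_dedekindPsi (n : ℕ) :
    ∑ d ∈ n.divisors, (d.totient : ℚ) * dedekindPsi d = (n : ℚ) ^ 2 := by
  let f : ArithmeticFunction ℚ := ⟨fun d => (d.totient : ℚ) * dedekindPsi d, by simp⟩
  have hf : f.IsMultiplicative := by
    refine ⟨by simp [f, dedekindPsi], fun {m n} h => ?_⟩
    simp only [f, ArithmeticFunction.coe_mk]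
    rw [Nat.totient_mul h, dedekindPsi_mul h]
    push_cast
    ring
  have key : f * (ArithmeticFunction.zeta : ArithmeticFunction ℚ) =
      ((ArithmeticFunction.pow 2 : ArithmeticFunction ℕ) : ArithmeticFunction ℚ) := by
    rw [ArithmeticFunction.IsMultiplicative.eq_iff_eq_on_prime_powers _
      (hf.mul ArithmeticFunction.isMultiplicative_zeta.natCast) _
      ArithmeticFunction.isMultiplicative_pow.natCast]
    intro p k hp
    rw [ArithmeticFunction.coe_mul_zeta_apply, Nat.sum_divisors_prime_pow hp]
    simp only [f, ArithmeticFunction.coe_mk, ArithmeticFunction.natCoe_apply,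
      ArithmeticFunction.pow_apply]
    induction k with
    | zero => simp [dedekindPsi]
    | succ k ih =>
      rw [Finset.sum_range_succ, ih, Nat.totient_prime_pow hp k.succ_pos, dedekindPsi,
        Nat.primeFactors_prime_pow k.succ_ne_zero hp, Finset.prod_singleton, Nat.cast_mul,
        Nat.cast_sub hp.one_le]
      have hp0 : (p : ℚ) ≠ 0 := by exact_mod_cast hp.ne_zero
      simp
      field_simp
      ring
  have h := DFunLike.congr_fun key n
  rw [ArithmeticFunction.coe_mul_zeta_apply] at h
  simpa [f, ArithmeticFunction.pow_apply] using h

/-- Both sides have the same sum over the divisors of `m`, namely the number `m²` of pairs of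
`m`-th roots of unity. -/
theorem card_lcm_orderOf_eq (K : Type*) [Field K] [CharP K 2] [IsAlgClosed K] {m : ℕ}
    (hm : Odd m) :
    (Nat.card {p : K × K // (orderOf p.1).lcm (orderOf p.2) = m} : ℚ) =
      (m.totient : ℚ) * dedekindPsi m := by
  classical
  induction m using Nat.strong_induction_on with
  | _ m ih =>
    have : NeZero (m : K) := ⟨fun h => by
      rw [CharP.cast_eq_zero_iff K 2] at h
      exact Nat.not_even_iff_odd.mpr hm (even_iff_two_dvd.mpr h)⟩
    obtain ⟨ζ, hζ⟩ := HasEnoughRootsOfUnity.exists_primitiveRoot K m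
    set S := nthRootsFinset m (1 : K) ×ˢ nthRootsFinset m (1 : K) with hS
    have hmem : ∀ p : K × K, p ∈ S ↔ (orderOf p.1).lcm (orderOf p.2) ∣ m := by
      intro p
      rw [hS, Finset.mem_product, mem_nthRootsFinset hm.pos, mem_nthRootsFinset hm.pos,
        Nat.lcm_dvd_iff, orderOf_dvd_iff_pow_eq_one, orderOf_dvd_iff_pow_eq_one]
    have hfib : ∀ d ∈ m.divisors, Nat.card {p : K × K // (orderOf p.1).lcm (orderOf p.2) = d} =
        {p ∈ S | (orderOf p.1).lcm (orderOf p.2) = d}.card := by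
      intro d hd
      refine Nat.subtype_card _ fun p => ?_
      rw [Finset.mem_filter, hmem]
      exact ⟨And.right, fun h => ⟨h ▸ Nat.dvd_of_mem_divisors hd, h⟩⟩
    have h1 : (∑ d ∈ m.divisors,
        (Nat.card {p : K × K // (orderOf p.1).lcm (orderOf p.2) = d} : ℚ)) = (m : ℚ) ^ 2 := by
      rw [← Nat.cast_sum, Finset.sum_congr rfl hfib, ← Finset.card_eq_sum_card_fiberwise, hS,
        Finset.card_product, hζ.card_nthRootsFinset]
      · push_cast
        ring
      · intro p hp
        exact Nat.mem_divisors.mpr ⟨(hmem p).mp hp, hm.pos.ne'⟩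
    rw [← sum_divisors_totient_mul_dedekindPsi, ← Nat.insert_self_properDivisors hm.pos.ne',
      Finset.sum_insert Nat.self_notMem_properDivisors,
      Finset.sum_insert Nat.self_notMem_properDivisors, Finset.sum_congr rfl fun d hd => ih d
        (Nat.mem_properDivisors.mp hd).2 (Odd.of_dvd_nat hm (Nat.mem_properDivisors.mp hd).1)] at h1
    exact add_right_cancel h1

section
variable {F K : Type*} [Field F] [Finite F] [Field K] [Algebra F K] [CharP K 2] [IsAlgClosed K]

/-- Among the `φ(r) ψ(r)` pairs with least common order `r`, the non-generic ones are
`(1, a)`, `(a, 1)`, `(a, a)` and `(a, a⁻¹)`. -/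
theorem card_isRationalPair {r : ℕ} (hodd : Odd r) (hr1 : r ≠ 1)
    (hfix : ∀ a : K, orderOf a ∣ r → (a + a⁻¹) ^ Nat.card F = a + a⁻¹) :
    (Nat.card {p : K × K // IsRationalPair F p ∧ (orderOf p.1).lcm (orderOf p.2) = r} : ℚ) =
      (r.totient : ℚ) * dedekindPsi r - 4 * r.totient := by
  have hpos : 0 < r.totient := Nat.totient_pos.mpr hodd.pos
  have c1 := card_orderOf_prod (K := K) odd_one hodd
  have c2 := card_orderOf_prod (K := K) hodd odd_one
  have c3 := card_orderOf_graph (K := K) hodd id fun a ha =>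
    ⟨ne_zero_of_odd_orderOf (ha ▸ hodd), fun h => hr1 (by rw [← ha, orderOf_eq_one_iff]; exact h)⟩
  rw [Nat.totient_one, one_mul] at c1
  rw [Nat.totient_one, mul_one] at c2
  have f1 := Nat.finite_of_card_pos (c1 ▸ hpos)
  have f2 := Nat.finite_of_card_pos (c2 ▸ hpos)
  have f3 := Nat.finite_of_card_pos (c3 ▸ Nat.mul_pos hpos two_pos)
  have c12 := Nat.card_subtype_or (P := fun p : K × K => orderOf p.1 = 1 ∧ orderOf p.2 = r)
    (Q := fun p : K × K => orderOf p.1 = r ∧ orderOf p.2 = 1)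
    fun p h h' => hr1 (h'.1.symm.trans h.1)
  have f12 := Nat.finite_of_card_pos (c12 ▸ Nat.add_pos_left (c1 ▸ hpos) _)
  have c123 := Nat.card_subtype_or (P := fun p : K × K =>
      (orderOf p.1 = 1 ∧ orderOf p.2 = r) ∨ (orderOf p.1 = r ∧ orderOf p.2 = 1))
    (Q := fun p : K × K => orderOf p.1 = r ∧ (p.2 = id p.1 ∨ p.2 = (id p.1)⁻¹)) (by
      rintro ⟨a, b⟩ (⟨h1, h2⟩ | ⟨h1, h2⟩) ⟨h3, h4⟩
      · exact hr1 (h3.symm.trans h1)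
      · simp only [id] at h1 h2 h3 h4
        rw [orderOf_eq_one_iff] at h2
        apply hr1
        rw [← h1, orderOf_eq_one_iff]
        rcases h4 with h4 | h4
        · rw [← h4, h2]
        · rw [← inv_inv a, ← h4, h2, inv_one])
  have f123 := Nat.finite_of_card_pos (c123 ▸ Nat.add_pos_right _ (c3 ▸ Nat.mul_pos hpos two_pos))
  have hfin : Finite {p : K × K // IsRationalPair F p ∧ (orderOf p.1).lcm (orderOf p.2) = r} := by
    have := finite_pair_pow_eq_one K hodd.pos.ne'
    refine Finite.of_injective (β := {p : K × K // p.1 ^ r = 1 ∧ p.2 ^ r = 1})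
      (fun p => ⟨p.1, ?_, ?_⟩) (fun p p' h => Subtype.ext (congrArg Subtype.val h :))
    · exact orderOf_dvd_iff_pow_eq_one.mp ((Nat.dvd_lcm_left _ _).trans p.2.2.dvd)
    · exact orderOf_dvd_iff_pow_eq_one.mp ((Nat.dvd_lcm_right _ _).trans p.2.2.dvd)
  have hdisj : ∀ p : K × K, (IsRationalPair F p ∧ (orderOf p.1).lcm (orderOf p.2) = r) →
      ¬ (((orderOf p.1 = 1 ∧ orderOf p.2 = r) ∨ (orderOf p.1 = r ∧ orderOf p.2 = 1)) ∨
        (orderOf p.1 = r ∧ (p.2 = id p.1 ∨ p.2 = (id p.1)⁻¹))) := by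
    rintro p ⟨h, -⟩ ((⟨h1, -⟩ | ⟨-, h1⟩) | ⟨-, h1⟩)
    · exact h.genericPair.1 ((add_inv_eq_zero_iff h.1).mpr (orderOf_eq_one_iff.mp h1))
    · exact h.genericPair.2.1 ((add_inv_eq_zero_iff h.2.1).mpr (orderOf_eq_one_iff.mp h1))
    · exact h.genericPair.2.2 ((add_inv_eq_add_inv_iff h.1 h.2.1).mpr h1)
  have hall : ∀ p : K × K, (orderOf p.1).lcm (orderOf p.2) = r ↔
      (IsRationalPair F p ∧ (orderOf p.1).lcm (orderOf p.2) = r) ∨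
      (((orderOf p.1 = 1 ∧ orderOf p.2 = r) ∨ (orderOf p.1 = r ∧ orderOf p.2 = 1)) ∨
        (orderOf p.1 = r ∧ (p.2 = id p.1 ∨ p.2 = (id p.1)⁻¹))) := by
    intro p
    constructor
    · intro hl
      have hA : orderOf p.1 ∣ r := hl ▸ Nat.dvd_lcm_left _ _
      have hB : orderOf p.2 ∣ r := hl ▸ Nat.dvd_lcm_right _ _
      have h1 := ne_zero_of_odd_orderOf (Odd.of_dvd_nat hodd hA)
      have h2 := ne_zero_of_odd_orderOf (Odd.of_dvd_nat hodd hB)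
      by_cases hg : GenericPair p
      · exact Or.inl ⟨isRationalPair_of_pow_card_eq h1 h2 hg (hfix _ hA) (hfix _ hB), hl⟩
      refine Or.inr ?_
      by_cases e1 : orderOf p.1 = 1
      · rw [e1, Nat.lcm_one_left] at hl
        exact Or.inl (Or.inl ⟨e1, hl⟩)
      by_cases e2 : orderOf p.2 = 1
      · rw [e2, Nat.lcm_one_right] at hl
        exact Or.inl (Or.inr ⟨hl, e2⟩)
      have e3 : p.2 = p.1 ∨ p.2 = p.1⁻¹ := by
        by_contra h
        refine hg ⟨?_, ?_, ?_⟩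
        · rwa [ne_eq, add_inv_eq_zero_iff h1, ← orderOf_eq_one_iff]
        · rwa [ne_eq, add_inv_eq_zero_iff h2, ← orderOf_eq_one_iff]
        · rwa [ne_eq, add_inv_eq_add_inv_iff h1 h2]
      refine Or.inr ⟨?_, e3⟩
      rw [← hl, eq_comm, Nat.lcm_eq_left_iff_dvd, orderOf_dvd_iff_pow_eq_one]
      rcases e3 with h | h <;> simp [h, pow_orderOf_eq_one]
    · rintro (h | (⟨h1, h2⟩ | ⟨h1, h2⟩) | ⟨h1, h2⟩)
      · exact h.2
      · rw [h1, h2, Nat.lcm_one_left]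
      · rw [h1, h2, Nat.lcm_one_right]
      · rw [← h1, Nat.lcm_eq_left_iff_dvd, orderOf_dvd_iff_pow_eq_one]
        rcases h2 with h | h <;> simp [h, pow_orderOf_eq_one]
  have key := card_lcm_orderOf_eq K hodd
  rw [Nat.card_congr (Equiv.subtypeEquivRight hall), Nat.card_subtype_or hdisj, c123, c12, c1, c2,
    c3] at key
  push_cast at key
  linear_combination key

end

/-! ### Classes with an eigenvalue pair `(a, a)` or `(a, 1)` -/

section
variable {F : Type*} [Field F]

theorem palindromicQuadratic_zero [CharP F 2] : palindromicQuadratic (0 : F) = (X - C 1) * (X - C 1) := by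
  have h2 : (2 : F[X]) = 0 := CharTwo.two_eq_zero
  simp only [palindromicQuadratic, map_zero, map_one]
  linear_combination X * h2

/-- The sign `e` that tells whether `X² + yX + 1` splits (`e = 1`) or is irreducible (`e = -1`). -/
def IsSplittingSign (y : F) (e : ℚ) : Prop :=
  (e = 1 ∧ ∃ α : F, α ^ 2 + y * α + 1 = 0) ∨ (e = -1 ∧ ∀ x : F, x ^ 2 + y * x + 1 ≠ 0)

variable {y : F} {e : ℚ}

theorem IsSplittingSign.sq_eq_one (h : IsSplittingSign y e) : e ^ 2 = 1 := by
  rcases h with ⟨rfl, -⟩ | ⟨rfl, -⟩ <;> norm_num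

variable [Finite F]

theorem one_lt_cast_card (F : Type*) [Field F] [Finite F] : (1 : ℚ) < Nat.card F := by
  exact_mod_cast (Finite.one_lt_card : 1 < Nat.card F)

theorem IsSplittingSign.sub_ne_zero (h : IsSplittingSign y e) : (Nat.card F : ℚ) - e ≠ 0 := by
  have := one_lt_cast_card F
  rcases h with ⟨rfl, -⟩ | ⟨rfl, -⟩ <;> linarith

theorem card_units_adjoinRoot_sq {f : F[X]} (hf : Irreducible f) :
    Nat.card (AdjoinRoot (f * f))ˣ = (Nat.card F ^ f.natDegree - 1) * Nat.card F ^ f.natDegree := by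
  have := card_units_adjoinRoot_pow hf 1
  rwa [one_mul, show f ^ (1 + 1) = f * f by rw [pow_succ, pow_one]] at this

theorem card_units_palindromicQuadratic_sq_of_no_root
    (h : ∀ x : F, x ^ 2 + y * x + 1 ≠ 0) :
    Nat.card (AdjoinRoot (palindromicQuadratic y * palindromicQuadratic y))ˣ =
      (Nat.card F ^ 2 - 1) * Nat.card F ^ 2 := by
  rw [card_units_adjoinRoot_sq (irreducible_palindromicQuadratic h), palindromicQuadratic_natDegree]

variable [CharP F 2]

theorem card_units_palindromicQuadratic_zero :
    Nat.card (AdjoinRoot (palindromicQuadratic (0 : F)))ˣ = (Nat.card F - 1) * Nat.card F := by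
  rw [palindromicQuadratic_zero, card_units_adjoinRoot_sq (irreducible_X_sub_C _),
    natDegree_X_sub_C, pow_one]

theorem card_units_palindromicQuadratic_sq_of_root {α : F} (hy : y ≠ 0)
    (hα : α ^ 2 + y * α + 1 = 0) :
    Nat.card (AdjoinRoot (palindromicQuadratic y * palindromicQuadratic y))ˣ =
      ((Nat.card F - 1) * Nat.card F) * ((Nat.card F - 1) * Nat.card F) := by
  have h0 : α ≠ 0 := by
    rintro rfl
    simp at hα
  have h1 : y = α + α⁻¹ := (eval_palindromicQuadratic_eq_zero_iff h0).mp (by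
    simpa [palindromicQuadratic] using hα)
  have hc : IsCoprime (X - C α) (X - C α⁻¹) :=
    isCoprime_X_sub_C_of_isUnit_sub (by rw [CharTwo.sub_eq_add, ← h1]; exact hy.isUnit)
  rw [h1, palindromicQuadratic_add_inv h0, mul_mul_mul_comm, card_units_adjoinRoot_mul
    ((hc.mul_left hc).mul_right (hc.mul_left hc)), card_units_adjoinRoot_sq (irreducible_X_sub_C _),
    card_units_adjoinRoot_sq (irreducible_X_sub_C _)]
  simp

theorem IsSplittingSign.card_units (h : IsSplittingSign y e) (hy : y ≠ 0) :
    (Nat.card (AdjoinRoot (palindromicQuadratic y))ˣ : ℚ) =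
      ((Nat.card F : ℚ) - 1) * ((Nat.card F : ℚ) - e) := by
  have hq1 : 1 < Nat.card F := Finite.one_lt_card
  rcases h with ⟨rfl, α, hα⟩ | ⟨rfl, h⟩
  · rw [card_units_palindromicQuadratic_of_root hy hα, Nat.cast_mul, Nat.cast_sub hq1.le,
      Nat.cast_one]
  · rw [card_units_palindromicQuadratic_of_no_root h, Nat.cast_sub (Nat.one_le_pow _ _ (by omega))]
    push_cast
    ring

theorem IsSplittingSign.card_units_sq (h : IsSplittingSign y e) (hy : y ≠ 0) :
    (Nat.card (AdjoinRoot (palindromicQuadratic y * palindromicQuadratic y))ˣ : ℚ) =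
      (Nat.card F : ℚ) ^ 2 * ((Nat.card F : ℚ) - 1) * ((Nat.card F : ℚ) - e) := by
  have hq1 : 1 < Nat.card F := Finite.one_lt_card
  rcases h with ⟨rfl, α, hα⟩ | ⟨rfl, h⟩
  · rw [card_units_palindromicQuadratic_sq_of_root hy hα]
    simp only [Nat.cast_mul, Nat.cast_sub hq1.le, Nat.cast_one]
    ring
  · rw [card_units_palindromicQuadratic_sq_of_no_root h, Nat.cast_mul,
      Nat.cast_sub (Nat.one_le_pow _ _ (by omega))]
    push_cast
    ring

/-- The number of elements with minimal polynomial `X² + yX + 1`. -/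
theorem IsSplittingSign.card_quadratic (h : IsSplittingSign y e) (hy : y ≠ 0) :
    (Nat.card {g : symplecticGroup (Fin 2) F // g.1 * g.1 + y • g.1 + 1 = 0} : ℚ) =
      (Nat.card F : ℚ) ^ 3 * ((Nat.card F : ℚ) ^ 2 + 1) * ((Nat.card F : ℚ) + e) := by
  have hq := one_lt_cast_card F
  have hq1 : 1 < Nat.card F := Finite.one_lt_card
  have hq2 : 1 ≤ Nat.card F ^ 2 := Nat.one_le_pow _ _ (by omega)
  have hq12 : Nat.card F ≤ Nat.card F ^ 2 := Nat.le_self_pow two_ne_zero _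
  have hq24 : Nat.card F ^ 2 ≤ Nat.card F ^ 4 := Nat.pow_le_pow_right (by omega) (by norm_num)
  have hq4 : 1 ≤ Nat.card F ^ 4 := Nat.one_le_pow _ _ (by omega)
  have h1 : (Nat.card F : ℚ) - 1 ≠ 0 := by linarith
  have h2 : (Nat.card F : ℚ) + 1 ≠ 0 := by linarith
  have h3 : (Nat.card F : ℚ) ≠ 0 := by linarith
  have h4 : (Nat.card F : ℚ) ^ 2 + 1 ≠ 0 := by positivity
  rcases h with ⟨rfl, α, hα⟩ | ⟨rfl, h⟩
  · have hc := congrArg (Nat.cast (R := ℚ)) (card_quadratic_split_mul hy hα)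
    simp only [Nat.cast_mul, Nat.cast_sub hq2, Nat.cast_sub hq12, Nat.cast_pow, Nat.cast_one,
      card_symplecticGroup_fin_two] at hc
    have hne : (Nat.card F : ℚ) * (Nat.card F - 1) ^ 2 * (Nat.card F + 1) ≠ 0 := by positivity
    refine mul_right_cancel₀ hne ?_
    linear_combination hc
  · have hc := congrArg (Nat.cast (R := ℚ)) (card_quadratic_nonsplit_mul h)
    simp only [Nat.cast_mul, Nat.cast_add, Nat.cast_sub hq4, Nat.cast_sub hq24, Nat.cast_sub hq2,
      Nat.cast_sub hq1.le, Nat.cast_sub (show Nat.card F - 1 ≤ Nat.card F ^ 2 by omega),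
      Nat.cast_pow, Nat.cast_one, card_symplecticGroup_fin_two] at hc
    have hne : (Nat.card F : ℚ) ^ 2 * (Nat.card F - 1) ^ 2 * (Nat.card F + 1) ^ 2 *
      (Nat.card F ^ 2 + 1) ≠ 0 := by positivity
    refine mul_right_cancel₀ hne ?_
    linear_combination hc

theorem IsSplittingSign.card_form_ne_zero (h : IsSplittingSign y e) (hy : y ≠ 0) :
    (Nat.card {v : F × F // v.2 ^ 2 + y * v.2 * v.1 + 1 * v.1 ^ 2 ≠ 0} : ℚ) =
      ((Nat.card F : ℚ) - 1) * ((Nat.card F : ℚ) - e) := by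
  have hq1 : 1 < Nat.card F := Finite.one_lt_card
  rcases h with ⟨rfl, α, hα⟩ | ⟨rfl, h⟩
  · have h0 : α ≠ 0 := by
      rintro rfl
      simp at hα
    have h1 : y = α + α⁻¹ := (eval_palindromicQuadratic_eq_zero_iff h0).mp (by
      simpa [palindromicQuadratic] using hα)
    have hne : α ≠ α⁻¹ := by
      intro he
      rw [← he, CharTwo.add_self_eq_zero] at h1
      exact hy h1
    have hc := card_quadratic_ne_zero_of_ne hne
    rw [← h1, mul_inv_cancel₀ h0] at hc
    rw [hc, Nat.cast_pow, Nat.cast_sub hq1.le, Nat.cast_one, sq]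
  · rw [card_quadratic_ne_zero_of_no_root h, Nat.cast_sub (Nat.one_le_pow _ _ (by omega))]
    push_cast
    ring

/-- The number of elements with minimal polynomial `(X + 1)(X² + yX + 1)`. -/
theorem IsSplittingSign.card_trace (h : IsSplittingSign y e) (hy : y ≠ 0) :
    (Nat.card {g : symplecticGroup (Fin 2) F //
        (g.1 * g.1 + y • g.1 + 1) * (g.1 + 1) = 0 ∧ g.1.trace = y} : ℚ) =
      (Nat.card F : ℚ) ^ 3 * ((Nat.card F : ℚ) ^ 2 + 1) * ((Nat.card F : ℚ) + e) := by
  have hq := one_lt_cast_card F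
  have hq1 : 1 < Nat.card F := Finite.one_lt_card
  have hq2 : 1 ≤ Nat.card F ^ 2 := Nat.one_le_pow _ _ (by omega)
  have hq12 : Nat.card F ≤ Nat.card F ^ 2 := Nat.le_self_pow two_ne_zero _
  have h1 : (Nat.card F : ℚ) - 1 ≠ 0 := by linarith
  have h2 : (Nat.card F : ℚ) + 1 ≠ 0 := by linarith
  have h3 : (Nat.card F : ℚ) ≠ 0 := by linarith
  have he := h.sq_eq_one
  have hc := congrArg (Nat.cast (R := ℚ)) (card_trace_eq_mul hy)
  simp only [Nat.cast_mul, Nat.cast_sub hq2, Nat.cast_sub hq12, Nat.cast_sub hq1.le, Nat.cast_pow,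
    Nat.cast_one, card_symplecticGroup_fin_two, h.card_form_ne_zero hy] at hc
  have hne : ((Nat.card F : ℚ) - 1) * ((Nat.card F : ℚ) - e) *
      ((Nat.card F : ℚ) * (Nat.card F - 1) ^ 2 * (Nat.card F + 1)) ≠ 0 :=
    mul_ne_zero (mul_ne_zero h1 h.sub_ne_zero) (mul_ne_zero (mul_ne_zero h3 (pow_ne_zero _ h1)) h2)
  refine mul_right_cancel₀ hne ?_
  linear_combination hc + (Nat.card F : ℚ) ^ 4 * ((Nat.card F : ℚ) ^ 2 + 1) *
    (Nat.card F - 1) ^ 3 * (Nat.card F + 1) * he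

/-- The number of elements with minimal polynomial `(X² + yX + 1)²`. -/
theorem IsSplittingSign.card_minpoly_sq (h : IsSplittingSign y e) (hy : y ≠ 0) :
    (Nat.card {g : symplecticGroup (Fin 2) F //
        minpoly F g.1 = palindromicQuadratic y * palindromicQuadratic y} : ℚ) =
      (Nat.card F : ℚ) ^ 3 * ((Nat.card F : ℚ) + e) * ((Nat.card F : ℚ) ^ 4 - 1) := by
  have hq := one_lt_cast_card F
  have hq1 : 1 < Nat.card F := Finite.one_lt_card
  have h1 : (Nat.card F : ℚ) - 1 ≠ 0 := by linarith
  have h3 : (Nat.card F : ℚ) ≠ 0 := by linarith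
  have he := h.sq_eq_one
  have hc := congrArg (Nat.cast (R := ℚ)) (card_minpoly_eq_palindromicQuartic_mul (y + y) (y * y))
  rw [← palindromicQuadratic_mul, card_quadratic_ne_zero_of_eq, Nat.cast_mul, h.card_units_sq hy]
    at hc
  simp only [Nat.cast_mul, Nat.cast_sub hq1.le, Nat.cast_one, card_symplecticGroup_fin_two] at hc
  have hne : (Nat.card F : ℚ) ^ 2 * ((Nat.card F : ℚ) - 1) * ((Nat.card F : ℚ) - e) ≠ 0 :=
    mul_ne_zero (mul_ne_zero (pow_ne_zero _ h3) h1) h.sub_ne_zero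
  refine mul_right_cancel₀ hne ?_
  linear_combination hc + (Nat.card F : ℚ) ^ 5 * ((Nat.card F : ℚ) ^ 4 - 1) *
    (Nat.card F - 1) * he

/-- The number of elements with minimal polynomial `(X + 1)²(X² + yX + 1)`. -/
theorem IsSplittingSign.card_minpoly_zero_mul (h : IsSplittingSign y e) (hy : y ≠ 0) :
    (Nat.card {g : symplecticGroup (Fin 2) F //
        minpoly F g.1 = palindromicQuadratic 0 * palindromicQuadratic y} : ℚ) =
      (Nat.card F : ℚ) ^ 3 * ((Nat.card F : ℚ) + e) * ((Nat.card F : ℚ) ^ 4 - 1) := by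
  have hq := one_lt_cast_card F
  have hq1 : 1 < Nat.card F := Finite.one_lt_card
  have h1 : (Nat.card F : ℚ) - 1 ≠ 0 := by linarith
  have h3 : (Nat.card F : ℚ) ≠ 0 := by linarith
  have he := h.sq_eq_one
  have hc := congrArg (Nat.cast (R := ℚ)) (card_minpoly_eq_palindromicQuartic_mul (0 + y) (0 * y))
  rw [← palindromicQuadratic_mul, card_quadratic_ne_zero_of_ne hy.symm,
    card_units_adjoinRoot_mul (isCoprime_palindromicQuadratic hy.symm), Nat.cast_mul, Nat.cast_mul,
    h.card_units hy, card_units_palindromicQuadratic_zero] at hc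
  simp only [Nat.cast_mul, Nat.cast_sub hq1.le, Nat.cast_one, Nat.cast_pow,
    card_symplecticGroup_fin_two] at hc
  have hne : ((Nat.card F : ℚ) - 1) * Nat.card F * (((Nat.card F : ℚ) - 1) *
      ((Nat.card F : ℚ) - e)) ≠ 0 :=
    mul_ne_zero (mul_ne_zero h1 h3) (mul_ne_zero h1 h.sub_ne_zero)
  refine mul_right_cancel₀ hne ?_
  linear_combination hc + (Nat.card F : ℚ) ^ 4 * ((Nat.card F : ℚ) ^ 4 - 1) *
    (Nat.card F - 1) ^ 2 * he

/-- The number of elements with a generic eigenvalue pair of this kind. -/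
theorem IsSplittingSign.card_isEigenvaluePair {K : Type*} [Field K] [CharP K 2] [Algebra F K]
    {z : F} {p : K × K} (h : IsSplittingSign y e) (h' : IsSplittingSign z e)
    (hp : IsRationalPair F p) (hy : algebraMap F K y = p.1 + p.1⁻¹)
    (hz : algebraMap F K z = p.2 + p.2⁻¹) :
    (Nat.card {g : symplecticGroup (Fin 2) F // IsEigenvaluePair g.1 p} : ℚ) =
      (Nat.card F : ℚ) ^ 4 * ((Nat.card F : ℚ) ^ 2 + 1) * ((Nat.card F : ℚ) + e) ^ 2 := by
  have hq := one_lt_cast_card F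
  have hq1 : 1 < Nat.card F := Finite.one_lt_card
  have h1 : (Nat.card F : ℚ) - 1 ≠ 0 := by linarith
  have he := h.sq_eq_one
  have hy0 : y ≠ 0 := by
    rintro rfl
    exact hp.genericPair.1 (by rw [← hy, map_zero])
  have hz0 : z ≠ 0 := by
    rintro rfl
    exact hp.genericPair.2.1 (by rw [← hz, map_zero])
  have hc := congrArg (Nat.cast (R := ℚ)) (card_isEigenvaluePair_mul_of_algebraMap hp hy hz)
  simp only [Nat.cast_mul, Nat.cast_pow, Nat.cast_sub hq1.le, Nat.cast_one, h.card_units hy0,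
    h'.card_units hz0, card_symplecticGroup_fin_two] at hc
  have hne : (((Nat.card F : ℚ) - 1) * ((Nat.card F : ℚ) - e)) *
      (((Nat.card F : ℚ) - 1) * ((Nat.card F : ℚ) - e)) ≠ 0 :=
    mul_ne_zero (mul_ne_zero h1 h.sub_ne_zero) (mul_ne_zero h1 h.sub_ne_zero)
  refine mul_right_cancel₀ hne ?_
  have e4 : ((Nat.card F : ℚ) + e) ^ 2 * ((Nat.card F : ℚ) - e) ^ 2 =
      ((Nat.card F : ℚ) ^ 2 - 1) ^ 2 := by
    rw [← mul_pow]
    congr 1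
    linear_combination -he
  linear_combination hc - (Nat.card F : ℚ) ^ 4 * ((Nat.card F : ℚ) ^ 2 + 1) *
    (Nat.card F - 1) ^ 2 * e4

end

/-! ### Orders of elements with special eigenvalues -/

section
variable {F K : Type*} [Field F] [Field K] [Algebra F K]

theorem aeval_palindromicQuadratic {n : Type*} [Fintype n] [DecidableEq n] (M : Matrix n n F)
    (y : F) : aeval M (palindromicQuadratic y) = M * M + y • M + 1 := by
  simp [palindromicQuadratic, sq, Algebra.smul_def]

variable [CharP K 2]

theorem aeval_palindromicQuadratic_eq_zero_iff {a : K} (ha : a ≠ 0) {y : F} :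
    aeval a (palindromicQuadratic y) = 0 ↔ algebraMap F K y = a + a⁻¹ := by
  rw [← eval_map_algebraMap, palindromicQuadratic_map, eval_palindromicQuadratic_eq_zero_iff ha]

theorem palindromicQuadratic_dvd {a : K} (ha : a ≠ 0) {y : F} (hy0 : y ≠ 0)
    (hy : algebraMap F K y = a + a⁻¹) {f : F[X]} (h1 : aeval a f = 0) (h2 : aeval a⁻¹ f = 0) :
    palindromicQuadratic y ∣ f := by
  rw [← map_dvd_map' (algebraMap F K), palindromicQuadratic_map, hy, palindromicQuadratic_add_inv ha]
  refine IsCoprime.mul_dvd ?_ (dvd_iff_isRoot.mpr ?_) (dvd_iff_isRoot.mpr ?_)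
  · refine isCoprime_X_sub_C_of_isUnit_sub ?_
    rw [CharTwo.sub_eq_add, ← hy]
    exact ((_root_.map_ne_zero _).mpr hy0).isUnit
  · rwa [IsRoot.def, eval_map_algebraMap]
  · rwa [IsRoot.def, eval_map_algebraMap]

theorem pow_eq_one_of_dvd {g : symplecticGroup (Fin 2) F} {f : F[X]} (hf : aeval g.1 f = 0) {m : ℕ}
    (h : f ∣ X ^ m - 1) : g ^ m = 1 := by
  obtain ⟨c, hc⟩ := h
  have h2 := congrArg (aeval g.1) hc
  rw [map_mul, hf, zero_mul] at h2
  simp only [map_sub, map_pow, aeval_X, map_one, sub_eq_zero] at h2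
  exact Subtype.ext (by simpa using h2)

theorem minpoly_dvd_X_pow_sub_one {g : symplecticGroup (Fin 2) F} {m : ℕ} (h : g ^ m = 1) :
    minpoly F g.1 ∣ X ^ m - 1 := by
  apply minpoly.dvd
  have h2 := congrArg Subtype.val h
  simp only [SubmonoidClass.coe_pow] at h2
  simp [h2]

theorem IsEigenvaluePair.algebraMap_trace [CharP F 2] {g : symplecticGroup (Fin 2) F} {p : K × K}
    (h : IsEigenvaluePair g.1 p) :
    algebraMap F K g.1.trace = (p.1 + p.1⁻¹) + (p.2 + p.2⁻¹) := by
  obtain ⟨t, s, ht, -, hc⟩ := h.exists_coeff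
  rw [← ht, trace_eq_neg_charpoly_coeff, hc, CharTwo.neg_eq]
  congr 1
  simp [palindromicQuartic, coeff_one]

theorem IsEigenvaluePair.of_palindromicQuadratic {g : symplecticGroup (Fin 2) F} {p : K × K}
    (h : IsEigenvaluePair g.1 p) {y : F} (hy : g.1 * g.1 + y • g.1 + 1 = 0) :
    algebraMap F K y = p.1 + p.1⁻¹ ∧ algebraMap F K y = p.2 + p.2⁻¹ := by
  rw [← aeval_palindromicQuadratic] at hy
  have := h.aeval_eq_zero hy
  exact ⟨(aeval_palindromicQuadratic_eq_zero_iff h.1).mp this.1,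
    (aeval_palindromicQuadratic_eq_zero_iff h.2.1).mp this.2.1⟩

theorem eq_one_or_algebraMap_eq_of_mul {a : K} (ha : a ≠ 0) {y : F}
    (h : aeval a (palindromicQuadratic y * (X + 1)) = 0) : a = 1 ∨ algebraMap F K y = a + a⁻¹ := by
  rw [map_mul, mul_eq_zero, aeval_palindromicQuadratic_eq_zero_iff ha] at h
  refine h.symm.imp (fun h => ?_) id
  simpa [add_eq_zero_iff_eq_neg, CharTwo.neg_eq] using h

/-- The eigenvalue `1` and a pair `a, a⁻¹` of an element annihilated by `(X² + yX + 1)(X + 1)`. -/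
theorem IsEigenvaluePair.of_mul [CharP F 2] {g : symplecticGroup (Fin 2) F} {p : K × K}
    (h : IsEigenvaluePair g.1 p) {y : F} (hy0 : y ≠ 0)
    (hy : (g.1 * g.1 + y • g.1 + 1) * (g.1 + 1) = 0) (ht : g.1.trace = y) :
    (p.1 = 1 ∧ algebraMap F K y = p.2 + p.2⁻¹) ∨ (algebraMap F K y = p.1 + p.1⁻¹ ∧ p.2 = 1) := by
  have h1 : aeval g.1 (palindromicQuadratic y * (X + 1)) = 0 := by
    rw [map_mul, aeval_palindromicQuadratic]
    simpa using hy
  have h2 := h.aeval_eq_zero h1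
  have h3 := h.algebraMap_trace
  rw [ht] at h3
  have hy0' : algebraMap F K y ≠ 0 := (_root_.map_ne_zero _).mpr hy0
  rcases eq_one_or_algebraMap_eq_of_mul h.1 h2.1 with e1 | e1
  · refine Or.inl ⟨e1, ?_⟩
    rwa [(add_inv_eq_zero_iff h.1).mpr e1, zero_add] at h3
  · refine Or.inr ⟨e1, ?_⟩
    rw [e1, left_eq_add, add_inv_eq_zero_iff h.2.1] at h3
    exact h3

/-- Elements with an eigenvalue `a` of order `m`, counted by the two choices `a`, `a⁻¹`. -/
theorem card_exists_orderOf_mul_two [Finite F] [IsAlgClosed K] {m : ℕ} (hm : Odd m) (hm1 : m ≠ 1)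
    (hfix : ∀ a : K, orderOf a = m → (a + a⁻¹) ^ Nat.card F = a + a⁻¹)
    (Q : F → symplecticGroup (Fin 2) F → Prop)
    (huniq : ∀ y y' g, Q y g → Q y' g → y = y') {n : ℚ}
    (hn : ∀ (y : F) (a : K), orderOf a = m → algebraMap F K y = a + a⁻¹ →
      (Nat.card {g // Q y g} : ℚ) = n) :
    (Nat.card {g // ∃ a : K, orderOf a = m ∧ ∃ y, algebraMap F K y = a + a⁻¹ ∧ Q y g} : ℚ) * 2 =
      m.totient * n := by
  classical
  have hfin : Finite {a : K // orderOf a = m} := Nat.finite_of_card_pos (by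
    rw [card_orderOf_eq_totient K hm]; exact Nat.totient_pos.mpr hm.pos)
  let T := {x : symplecticGroup (Fin 2) F × {a : K // orderOf a = m} //
    ∃ y, algebraMap F K y = x.2.1 + x.2.1⁻¹ ∧ Q y x.1}
  have e1 : (Nat.card T : ℚ) = Nat.card {g // ∃ a : K, orderOf a = m ∧ ∃ y,
      algebraMap F K y = a + a⁻¹ ∧ Q y g} * 2 := by
    refine Nat.cast_card_eq_mul_of_card_fiber
      (fun x : T => ⟨x.1.1, x.1.2.1, x.1.2.2, x.2⟩) 2 ?_
    rintro ⟨g, a, ha, y, hy, hQ⟩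
    have h0 := ne_zero_of_odd_orderOf (ha ▸ hm)
    have hne : a ≠ a⁻¹ := by
      intro h
      apply hm1
      rw [← ha, orderOf_eq_one_iff, ← add_inv_eq_zero_iff h0, ← h, CharTwo.add_self_eq_zero]
    have hc : Nat.card {x : K // x = a ∨ x = a⁻¹} = 2 := by
      rw [← Finset.card_pair hne]
      exact Nat.subtype_card _ fun x => by simp
    have hord : ∀ x : K, x = a ∨ x = a⁻¹ → orderOf x = m := by
      rintro x (rfl | rfl)
      · exact ha
      · rw [← ha]
        have : ∀ z : K, orderOf z⁻¹ ∣ orderOf z := fun z => by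
          rw [orderOf_dvd_iff_pow_eq_one, inv_pow, pow_orderOf_eq_one, inv_one]
        exact Nat.dvd_antisymm (this a) (by simpa using this a⁻¹)
    have hx0 : ∀ x : K, x = a ∨ x = a⁻¹ → x ≠ 0 := fun x hx =>
      ne_zero_of_odd_orderOf (hord x hx ▸ hm)
    refine (congrArg (Nat.cast (R := ℚ)) (Eq.trans (Nat.card_congr ?_) hc)).trans Nat.cast_two
    refine ⟨fun x => ⟨x.1.1.2.1, ?_⟩,
      fun x => ⟨⟨(g, ⟨x.1, hord x.1 x.2⟩), y, ?_, hQ⟩, rfl⟩, ?_, fun _ => rfl⟩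
    · have hg : x.1.1.1 = g := congrArg Subtype.val x.2
      obtain ⟨y', hy', hQ'⟩ := x.1.2
      rw [hg] at hQ'
      rw [huniq _ _ _ hQ' hQ] at hy'
      replace hy' := hy.symm.trans hy'
      exact (add_inv_eq_add_inv_iff h0
        (ne_zero_of_odd_orderOf (by rw [x.1.1.2.2]; exact hm))).mp hy'
    · rw [hy]
      exact (add_inv_eq_add_inv_iff h0 (hx0 x.1 x.2)).mpr x.2
    · rintro ⟨⟨⟨g', a'⟩, h'⟩, e⟩
      obtain rfl : g' = g := congrArg Subtype.val e
      rfl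
  rw [← e1, ← card_orderOf_eq_totient K hm]
  refine Nat.cast_card_eq_mul_of_card_fiber (fun x : T => x.1.2) n ?_
  rintro ⟨a, ha⟩
  obtain ⟨y, hy⟩ := exists_algebraMap_eq_of_pow_card_eq (hfix a ha)
  rw [← hn y a ha hy]
  congr 1
  refine Nat.card_congr ⟨fun x => ⟨x.1.1.1, ?_⟩, fun g => ⟨⟨(g.1, ⟨a, ha⟩), y, hy, g.2⟩, rfl⟩, ?_,
    fun _ => rfl⟩
  · obtain ⟨y', hy', hQ'⟩ := x.1.2
    have hx : x.1.1.2 = ⟨a, ha⟩ := x.2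
    rw [hx, ← hy] at hy'
    rwa [(algebraMap F K).injective hy'] at hQ'
  · rintro ⟨⟨⟨g', a'⟩, h'⟩, e⟩
    obtain rfl : a' = ⟨a, ha⟩ := e
    rfl

end

/-! ### Elements of order `r` for `r` dividing `q - 1` or `q + 1` -/

section
variable {F K : Type*} [Field F] [Field K] [Algebra F K]

theorem aeval_X_pow_sub_one {a : K} {m : ℕ} (h : orderOf a ∣ m) :
    aeval a (X ^ m - 1 : F[X]) = 0 ∧ aeval a⁻¹ (X ^ m - 1 : F[X]) = 0 := by
  have := orderOf_dvd_iff_pow_eq_one.mp h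
  constructor <;> simp [this]

theorem IsEigenvaluePair.charpoly_eq {g : symplecticGroup (Fin 2) F} {p : K × K}
    (h : IsEigenvaluePair g.1 p) {y z : F} (hy : algebraMap F K y = p.1 + p.1⁻¹)
    (hz : algebraMap F K z = p.2 + p.2⁻¹) :
    g.1.charpoly = palindromicQuadratic y * palindromicQuadratic z := by
  apply map_injective (algebraMap F K) (algebraMap F K).injective
  rw [h.2.2, Polynomial.map_mul, palindromicQuadratic_map, palindromicQuadratic_map, hy, hz]

variable [CharP F 2] [CharP K 2]

theorem squarefree_X_pow_sub_one {r : ℕ} (hr : Odd r) : Squarefree (X ^ r - 1 : F[X]) := by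
  refine (X_pow_sub_one_separable_iff.mpr fun h => ?_).squarefree
  rw [CharP.cast_eq_zero_iff F 2] at h
  exact Nat.not_even_iff_odd.mpr hr (even_iff_two_dvd.mpr h)

theorem palindromicQuadratic_zero_eq_sq : palindromicQuadratic (0 : F) = (X + 1) ^ 2 := by
  have h2 : (2 : F[X]) = 0 := CharTwo.two_eq_zero
  simp only [palindromicQuadratic, map_zero]
  linear_combination (-X) * h2

/-- A non-generic element of odd order `r` has at most three eigenvalues `1, a, a⁻¹`, each of
which is a simple root of the minimal polynomial. -/
theorem orderOf_eq_iff_of_odd {r : ℕ} (hodd : Odd r) (hr1 : r ≠ 1) [Finite F] [IsAlgClosed K]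
    (hfix : ∀ a : K, orderOf a ∣ r → (a + a⁻¹) ^ Nat.card F = a + a⁻¹)
    (g : symplecticGroup (Fin 2) F) :
    orderOf g = r ↔ (orderOf g = r ∧ ∃ p : K × K, GenericPair p ∧ IsEigenvaluePair g.1 p) ∨
      ((∃ a : K, orderOf a = r ∧ ∃ y, algebraMap F K y = a + a⁻¹ ∧ g.1 * g.1 + y • g.1 + 1 = 0) ∨
      (∃ a : K, orderOf a = r ∧ ∃ y, algebraMap F K y = a + a⁻¹ ∧
        (g.1 * g.1 + y • g.1 + 1) * (g.1 + 1) = 0 ∧ g.1.trace = y)) := by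
  have hyne : ∀ (a : K) (y : F), orderOf a = r → algebraMap F K y = a + a⁻¹ → a ≠ 0 ∧ y ≠ 0 := by
    intro a y ha hy
    have h0 := ne_zero_of_odd_orderOf (ha ▸ hodd)
    refine ⟨h0, ?_⟩
    rintro rfl
    rw [map_zero, eq_comm, add_inv_eq_zero_iff h0, ← orderOf_eq_one_iff, ha] at hy
    exact hr1 hy
  have hordeq : ∀ a b : K, a ≠ 0 → b ≠ 0 → a + a⁻¹ = b + b⁻¹ → orderOf b ∣ orderOf a := by
    intro a b ha hb h
    rw [orderOf_dvd_iff_pow_eq_one]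
    rcases (add_inv_eq_add_inv_iff ha hb).mp h with h | h <;> simp [h, pow_orderOf_eq_one]
  obtain ⟨p, hp⟩ := exists_isEigenvaluePair (K := K) g
  constructor
  · intro hg
    have hl := hp.lcm_orderOf_eq (hg ▸ hodd)
    rw [hg] at hl
    by_cases hgen : GenericPair p
    · exact Or.inl ⟨hg, p, hgen, hp⟩
    refine Or.inr ?_
    have hA : orderOf p.1 ∣ r := hl ▸ Nat.dvd_lcm_left _ _
    have hB : orderOf p.2 ∣ r := hl ▸ Nat.dvd_lcm_right _ _
    obtain ⟨y, hy⟩ := exists_algebraMap_eq_of_pow_card_eq (hfix _ hA)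
    obtain ⟨z, hz⟩ := exists_algebraMap_eq_of_pow_card_eq (hfix _ hB)
    have hc := hp.charpoly_eq hy hz
    have hsq := (squarefree_X_pow_sub_one (F := F) hodd).squarefree_of_dvd
      (minpoly_dvd_X_pow_sub_one (g := g) (hg ▸ pow_orderOf_eq_one g))
    have hd : minpoly F g.1 ∣ palindromicQuadratic y * palindromicQuadratic z :=
      hc ▸ minpoly_dvd_charpoly g.1
    have htr := hp.algebraMap_trace
    have hmul : ∀ w : F, minpoly F g.1 ∣ palindromicQuadratic w * palindromicQuadratic 0 →
        (g.1 * g.1 + w • g.1 + 1) * (g.1 + 1) = 0 := by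
      intro w hw
      have h1 : minpoly F g.1 ∣ (palindromicQuadratic w * (X + 1)) ^ 2 := hw.trans (by
        rw [palindromicQuadratic_zero_eq_sq, mul_pow]
        exact mul_dvd_mul (dvd_pow_self _ two_ne_zero) dvd_rfl)
      rw [hsq.dvd_pow_iff_dvd two_ne_zero, minpoly.dvd_iff, map_mul, aeval_palindromicQuadratic] at h1
      simpa using h1
    by_cases e1 : p.1 = 1
    · have hy0 : y = 0 := by
        rw [(add_inv_eq_zero_iff hp.1).mpr e1, map_eq_zero] at hy
        exact hy
      rw [e1, orderOf_one, Nat.lcm_one_left] at hl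
      refine Or.inr ⟨p.2, hl, z, hz, hmul z ?_, ?_⟩
      · rwa [mul_comm, ← hy0]
      · apply (algebraMap F K).injective
        rw [htr, ← hy, hy0, hz, map_zero, zero_add]
    by_cases e2 : p.2 = 1
    · have hz0 : z = 0 := by
        rw [(add_inv_eq_zero_iff hp.2.1).mpr e2, map_eq_zero] at hz
        exact hz
      rw [e2, orderOf_one, Nat.lcm_one_right] at hl
      refine Or.inr ⟨p.1, hl, y, hy, hmul y ?_, ?_⟩
      · rwa [← hz0]
      · apply (algebraMap F K).injective
        rw [htr, ← hz, hz0, hy, map_zero, add_zero]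
    have e3 : p.1 + p.1⁻¹ = p.2 + p.2⁻¹ := by
      by_contra h
      exact hgen ⟨by rwa [ne_eq, add_inv_eq_zero_iff hp.1], by rwa [ne_eq, add_inv_eq_zero_iff hp.2.1],
        h⟩
    rw [Nat.lcm_eq_left (hordeq _ _ hp.1 hp.2.1 e3)] at hl
    refine Or.inl ⟨p.1, hl, y, hy, ?_⟩
    have : z = y := (algebraMap F K).injective (by rw [hy, hz, e3])
    rw [this, ← sq, hsq.dvd_pow_iff_dvd two_ne_zero, minpoly.dvd_iff, aeval_palindromicQuadratic] at hd
    exact hd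
  · have hfin : g ^ r = 1 → (orderOf p.1).lcm (orderOf p.2) = r → orderOf g = r := by
      intro h1 h2
      rw [← h2, ← hp.lcm_orderOf_eq (Odd.of_dvd_nat hodd (orderOf_dvd_iff_pow_eq_one.mpr h1))]
    rintro (h | ⟨a, ha, y, hy, hQ⟩ | ⟨a, ha, y, hy, hQ, ht⟩)
    · exact h.1
    · obtain ⟨h0, hy0⟩ := hyne a y ha hy
      obtain ⟨h1, h2⟩ := hp.of_palindromicQuadratic hQ
      refine hfin ?_ ?_
      · rw [← aeval_palindromicQuadratic] at hQ
        have := aeval_X_pow_sub_one (F := F) ha.dvd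
        exact pow_eq_one_of_dvd hQ (palindromicQuadratic_dvd h0 hy0 hy this.1 this.2)
      · rw [hy] at h1 h2
        rw [← ha]
        exact Nat.dvd_antisymm (Nat.lcm_dvd (hordeq _ _ h0 hp.1 h1) (hordeq _ _ h0 hp.2.1 h2))
          ((hordeq _ _ hp.1 h0 h1.symm).trans (Nat.dvd_lcm_left _ _))
    · obtain ⟨h0, hy0⟩ := hyne a y ha hy
      refine hfin ?_ ?_
      · have h1 : aeval g.1 (palindromicQuadratic y * (X + 1)) = 0 := by
          rw [map_mul, aeval_palindromicQuadratic]
          simpa using hQ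
        have := aeval_X_pow_sub_one (F := F) ha.dvd
        refine pow_eq_one_of_dvd h1 (IsCoprime.mul_dvd ?_
          (palindromicQuadratic_dvd h0 hy0 hy this.1 this.2) ?_)
        · have := isCoprime_palindromicQuadratic hy0
          rw [palindromicQuadratic_zero_eq_sq] at this
          exact (IsCoprime.pow_right_iff two_pos).mp this
        · rw [show (X + 1 : F[X]) = X - C 1 by rw [C_1, CharTwo.sub_eq_add], dvd_iff_isRoot]
          simp
      · rcases hp.of_mul hy0 hQ ht with ⟨h1, h2⟩ | ⟨h1, h2⟩
        · rw [hy] at h2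
          rw [h1, orderOf_one, Nat.lcm_one_left, ← ha]
          exact Nat.dvd_antisymm (hordeq _ _ h0 hp.2.1 h2) (hordeq _ _ hp.2.1 h0 h2.symm)
        · rw [hy] at h1
          rw [h2, orderOf_one, Nat.lcm_one_right, ← ha]
          exact Nat.dvd_antisymm (hordeq _ _ h0 hp.1 h1) (hordeq _ _ hp.1 h0 h1.symm)

end

section
variable {F : Type*} [Field F] [CharP F 2] [Finite F]

/-- The elements of odd order `r` when every `X² + yX + 1` with roots of order dividing `r` other
than `1` has the same splitting behaviour `e` over `F`: the generic ones and the two kinds of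
semisimple elements that are not regular. -/
theorem card_orderOf_eq_of_isSplittingSign {r : ℕ} (hodd : Odd r) (hr1 : r ≠ 1) {e : ℚ}
    (hfix : ∀ a : AlgebraicClosure F, orderOf a ∣ r → (a + a⁻¹) ^ Nat.card F = a + a⁻¹)
    (he : ∀ (a : AlgebraicClosure F) (y : F), orderOf a ∣ r → a ≠ 1 →
      algebraMap F (AlgebraicClosure F) y = a + a⁻¹ → y ≠ 0 ∧ IsSplittingSign y e) :
    (Nat.card {g : symplecticGroup (Fin 2) F // orderOf g = r} : ℚ) =
      (r.totient : ℚ) * (Nat.card F : ℚ) ^ 3 * ((Nat.card F : ℚ) ^ 2 + 1) * ((Nat.card F : ℚ) + e) *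
        (1 - (Nat.card F : ℚ) * ((Nat.card F : ℚ) + e) / 2 +
          (Nat.card F : ℚ) * ((Nat.card F : ℚ) + e) / 8 * dedekindPsi r) := by
  let K := AlgebraicClosure F
  have hane : ∀ a : K, orderOf a = r → a ≠ 1 := by
    rintro a ha rfl
    exact hr1 (by rw [← ha, orderOf_one])
  have hgen := card_orderOf_generic_mul (F := F) (K := K) hodd.pos.ne'
    (n := (Nat.card F : ℚ) ^ 4 * ((Nat.card F : ℚ) ^ 2 + 1) * ((Nat.card F : ℚ) + e) ^ 2) (by
      intro p hp hl
      have hA : orderOf p.1 ∣ r := hl ▸ Nat.dvd_lcm_left _ _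
      have hB : orderOf p.2 ∣ r := hl ▸ Nat.dvd_lcm_right _ _
      obtain ⟨y, hy⟩ := exists_algebraMap_eq_of_pow_card_eq (hfix _ hA)
      obtain ⟨z, hz⟩ := exists_algebraMap_eq_of_pow_card_eq (hfix _ hB)
      have h1 : p.1 ≠ 1 := fun h => hp.genericPair.1 ((add_inv_eq_zero_iff hp.1).mpr h)
      have h2 : p.2 ≠ 1 := fun h => hp.genericPair.2.1 ((add_inv_eq_zero_iff hp.2.1).mpr h)
      exact (he _ y hA h1 hy).2.card_isEigenvaluePair (he _ z hB h2 hz).2 hp hy hz)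
  rw [card_isRationalPair hodd hr1 hfix] at hgen
  have hqa := card_exists_orderOf_mul_two (F := F) (K := K) hodd hr1 (fun a ha => hfix a ha.dvd)
    (fun y g => g.1 * g.1 + y • g.1 + 1 = 0) (by
      intro y y' g h h'
      obtain ⟨p, hp⟩ := exists_isEigenvaluePair (K := K) g
      apply (algebraMap F K).injective
      rw [(hp.of_palindromicQuadratic h).1, (hp.of_palindromicQuadratic h').1])
    (n := (Nat.card F : ℚ) ^ 3 * ((Nat.card F : ℚ) ^ 2 + 1) * ((Nat.card F : ℚ) + e)) (by
      intro y a ha hy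
      obtain ⟨h1, h2⟩ := he a y ha.dvd (hane a ha) hy
      exact h2.card_quadratic h1)
  have hqb := card_exists_orderOf_mul_two (F := F) (K := K) hodd hr1 (fun a ha => hfix a ha.dvd)
    (fun y g => (g.1 * g.1 + y • g.1 + 1) * (g.1 + 1) = 0 ∧ g.1.trace = y)
    (fun y y' g h h' => h.2.symm.trans h'.2)
    (n := (Nat.card F : ℚ) ^ 3 * ((Nat.card F : ℚ) ^ 2 + 1) * ((Nat.card F : ℚ) + e)) (by
      intro y a ha hy
      obtain ⟨h1, h2⟩ := he a y ha.dvd (hane a ha) hy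
      exact h2.card_trace h1)
  have hd1 : ∀ g : symplecticGroup (Fin 2) F,
      (∃ a : K, orderOf a = r ∧ ∃ y, algebraMap F K y = a + a⁻¹ ∧ g.1 * g.1 + y • g.1 + 1 = 0) →
      ¬ (∃ a : K, orderOf a = r ∧ ∃ y, algebraMap F K y = a + a⁻¹ ∧
        (g.1 * g.1 + y • g.1 + 1) * (g.1 + 1) = 0 ∧ g.1.trace = y) := by
    rintro g ⟨a, -, y, -, hQ⟩ ⟨a', ha', y', hy', -, ht⟩
    obtain ⟨p, hp⟩ := exists_isEigenvaluePair (K := K) g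
    have h1 := hp.algebraMap_trace
    obtain ⟨h2, h3⟩ := hp.of_palindromicQuadratic hQ
    rw [← h2, ← h3, CharTwo.add_self_eq_zero, ht, map_eq_zero] at h1
    exact (he a' y' ha'.dvd (hane a' ha') hy').1 h1
  have hd2 : ∀ g : symplecticGroup (Fin 2) F,
      (orderOf g = r ∧ ∃ p : K × K, GenericPair p ∧ IsEigenvaluePair g.1 p) →
      ¬ ((∃ a : K, orderOf a = r ∧ ∃ y, algebraMap F K y = a + a⁻¹ ∧
        g.1 * g.1 + y • g.1 + 1 = 0) ∨ (∃ a : K, orderOf a = r ∧ ∃ y, algebraMap F K y = a + a⁻¹ ∧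
        (g.1 * g.1 + y • g.1 + 1) * (g.1 + 1) = 0 ∧ g.1.trace = y)) := by
    rintro g ⟨-, p, hg, hp⟩ (⟨a, -, y, -, hQ⟩ | ⟨a, ha, y, hy, hQ, ht⟩)
    · obtain ⟨h2, h3⟩ := hp.of_palindromicQuadratic hQ
      exact hg.2.2 (h2.symm.trans h3)
    · rcases hp.of_mul (he a y ha.dvd (hane a ha) hy).1 hQ ht with ⟨h1, -⟩ | ⟨-, h1⟩
      · exact hg.1 ((add_inv_eq_zero_iff hp.1).mpr h1)
      · exact hg.2.1 ((add_inv_eq_zero_iff hp.2.1).mpr h1)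
  rw [Nat.card_congr (Equiv.subtypeEquivRight (orderOf_eq_iff_of_odd hodd hr1 hfix)),
    Nat.card_subtype_or hd2, Nat.card_subtype_or hd1]
  rw [Nat.cast_add, Nat.cast_add]
  linear_combination hgen / 8 + hqa / 2 + hqb / 2

end

/-! ### Elements of order `2r` for `r` dividing `q - 1` or `q + 1` -/

section
variable {F : Type*} [Field F]

theorem monic_X_add_one : (X + 1 : F[X]).Monic := monic_X_add_C (1 : F)

variable [CharP F 2]

/-- A minimal polynomial that properly divides `(X² + yX + 1)²` and is divisible by `X² + yX + 1`
cannot have degree three: it would be `(X² + yX + 1)(X + c)` with `c ≠ c⁻¹`, but it must also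
annihilate the inverse of the matrix. -/
theorem minpoly_eq_palindromicQuadratic_sq {g : symplecticGroup (Fin 2) F} {y : F} (hy0 : y ≠ 0)
    (h1 : minpoly F g.1 ∣ palindromicQuadratic y * palindromicQuadratic y)
    (h2 : palindromicQuadratic y ∣ minpoly F g.1) (h3 : ¬ minpoly F g.1 ∣ palindromicQuadratic y) :
    minpoly F g.1 = palindromicQuadratic y * palindromicQuadratic y := by
  have hQ := palindromicQuadratic_monic y
  have hP : (minpoly F g.1).Monic := minpoly.monic (Algebra.IsIntegral.isIntegral _)
  obtain ⟨R, hR⟩ := h2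
  have hRm : R.Monic := hQ.of_mul_monic_left (hR ▸ hP)
  rw [hR] at h1
  have hRQ : R ∣ palindromicQuadratic y := (mul_dvd_mul_iff_left hQ.ne_zero).mp h1
  have hdeg : R.natDegree ≤ 2 := by
    rw [← palindromicQuadratic_natDegree y]
    exact natDegree_le_of_dvd hRQ hQ.ne_zero
  have hcases : R.natDegree = 0 ∨ R.natDegree = 1 ∨ R.natDegree = 2 := by omega
  rcases hcases with hd | hd | hd
  · rw [(Monic.natDegree_eq_zero hRm).mp hd, mul_one] at hR
    exact absurd hR.dvd h3
  · exfalso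
    apply h3
    rw [minpoly.dvd_iff]
    have hRX := hRm.eq_X_add_C hd
    set c := R.coeff 0
    have hc : c ^ 2 + y * c + 1 = 0 := by
      have h4 : (X - C c) ∣ palindromicQuadratic y := by
        rwa [CharTwo.sub_eq_add, ← hRX]
      simpa [palindromicQuadratic] using dvd_iff_isRoot.mp h4
    have hc0 : c ≠ 0 := by
      intro h
      simp [h] at hc
    have h5 := minpoly.aeval F g.1
    have h6 := aeval_inv_eq_zero h5
    rw [hR, hRX, map_mul, aeval_palindromicQuadratic] at h5 h6
    rw [aeval_palindromicQuadratic]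
    have hg : (g⁻¹).1 * g.1 = 1 := congrArg Subtype.val (inv_mul_cancel g)
    simp only [map_add, aeval_X, aeval_C, Algebra.algebraMap_eq_smul_one] at h5 h6
    set A := g.1
    set B := (g⁻¹).1
    have hBA : B * A = 1 := hg
    have h7 : (A * A + y • A + 1) * (1 + c • A) = 0 := by
      have h8 : (B * B + y • B + 1) * (B + c • 1) * (A * A * A) =
          (A * A + y • A + 1) * (1 + c • A) := by
        have e1 : (B + c • 1) * (A * A * A) = (1 + c • A) * (A * A) := by
          rw [Matrix.mul_assoc A A A, ← Matrix.mul_assoc, add_mul, hBA, smul_mul_assoc, one_mul]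
        have e2 : (B * B + y • B + 1) * (A * A) = A * A + y • A + 1 := by
          rw [add_mul, add_mul, smul_mul_assoc, ← Matrix.mul_assoc B A A, hBA, one_mul,
            Matrix.mul_assoc B B, ← Matrix.mul_assoc B A A, hBA, one_mul, one_mul, hBA]
          abel
        have e3 : (1 + c • A) * (A * A) = (A * A) * (1 + c • A) := by
          simp only [add_mul, mul_add, one_mul, mul_one, smul_mul_assoc, mul_smul_comm,
            Matrix.mul_assoc]
        rw [Matrix.mul_assoc, e1, e3, ← Matrix.mul_assoc, e2]
      rw [← h8, h6, zero_mul]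
    have h9 : (y * c) • (A * A + y • A + 1) = 0 := by
      have e : (A * A + y • A + 1) * (1 + c • A) + c • ((A * A + y • A + 1) * (A + c • 1)) =
          (y * c) • (A * A + y • A + 1) := by
        have e1 : (1 + c • A) + c • (A + c • 1) = (y * c) • (1 : Matrix (Fin 2 ⊕ Fin 2) _ F) := by
          have h2' : (2 : F) = 0 := CharTwo.two_eq_zero
          have h10 : y * c = 1 + c * c := by linear_combination hc - (1 + c * c) * h2'
          have h11 : c + c = 0 := CharTwo.add_self_eq_zero c
          rw [smul_add, smul_smul, h10, add_smul, one_smul, add_assoc, ← add_assoc (c • A), ← add_smul,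
            h11, zero_smul, zero_add]
        rw [← mul_smul_comm, ← mul_add, e1, mul_smul_comm, mul_one]
      rw [← e, h7, h5, smul_zero, add_zero]
    exact (smul_eq_zero.mp h9).resolve_left (mul_ne_zero hy0 hc0)
  · rw [hR]
    congr 1
    refine (eq_of_monic_of_dvd_of_natDegree_le hRm hQ hRQ ?_).symm
    rw [hd, palindromicQuadratic_natDegree]

theorem minpoly_eq_palindromicQuadratic_zero_mul {g : symplecticGroup (Fin 2) F} {y : F}
    (h1 : minpoly F g.1 ∣ palindromicQuadratic 0 * palindromicQuadratic y)
    (h2 : palindromicQuadratic y * (X + 1) ∣ minpoly F g.1)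
    (h3 : ¬ minpoly F g.1 ∣ palindromicQuadratic y * (X + 1)) :
    minpoly F g.1 = palindromicQuadratic 0 * palindromicQuadratic y := by
  have hD : (palindromicQuadratic y * (X + 1)).Monic :=
    (palindromicQuadratic_monic y).mul monic_X_add_one
  have hP : (minpoly F g.1).Monic := minpoly.monic (Algebra.IsIntegral.isIntegral _)
  have he : palindromicQuadratic 0 * palindromicQuadratic y =
      (palindromicQuadratic y * (X + 1)) * (X + 1) := by
    rw [palindromicQuadratic_zero_eq_sq]
    ring
  obtain ⟨R, hR⟩ := h2
  have hRm : R.Monic := hD.of_mul_monic_left (hR ▸ hP)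
  rw [hR, he] at h1
  have hRQ : R ∣ X + 1 := (mul_dvd_mul_iff_left hD.ne_zero).mp h1
  have hd1 : (X + 1 : F[X]).natDegree = 1 := natDegree_X_add_C (1 : F)
  have hdeg : R.natDegree ≤ 1 := by
    rw [← hd1]
    exact natDegree_le_of_dvd hRQ monic_X_add_one.ne_zero
  rcases Nat.le_one_iff_eq_zero_or_eq_one.mp hdeg with hd | hd
  · rw [(Monic.natDegree_eq_zero hRm).mp hd, mul_one] at hR
    exact absurd hR.dvd h3
  · rw [hR, he]
    congr 1
    exact (eq_of_monic_of_dvd_of_natDegree_le hRm monic_X_add_one hRQ (by rw [hd, hd1])).symm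

end

section
variable {F K : Type*} [Field F] [Field K] [Algebra F K] [CharP F 2] [CharP K 2]

theorem palindromicQuadratic_mul_X_add_one_dvd {r : ℕ} {y : F} (hy0 : y ≠ 0)
    (h : palindromicQuadratic y ∣ X ^ r - 1) :
    palindromicQuadratic y * (X + 1) ∣ X ^ r - 1 := by
  refine IsCoprime.mul_dvd ?_ h ?_
  · have := isCoprime_palindromicQuadratic hy0
    rw [palindromicQuadratic_zero_eq_sq] at this
    exact (IsCoprime.pow_right_iff two_pos).mp this
  · rw [show (X + 1 : F[X]) = X - C 1 by rw [C_1, CharTwo.sub_eq_add], dvd_iff_isRoot]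
    simp

/-- If the minimal polynomial of `g` is a quartic with a repeated factor that has a root of odd
order `r` and divides `(X ^ r - 1) ^ 2`, then `g` has order `2r`. -/
theorem orderOf_eq_two_mul_of_minpoly {r : ℕ} (hodd : Odd r) {a : K} (ha : orderOf a = r) {w y : F}
    {d : F[X]} (h0 : a ≠ 0) (hy : algebraMap F K y = a + a⁻¹) {g : symplecticGroup (Fin 2) F}
    (hP : minpoly F g.1 = palindromicQuadratic w * palindromicQuadratic y)
    (hd : d ∣ X ^ r - 1) (hd2 : minpoly F g.1 ∣ d * d) (hns : ¬ Squarefree (minpoly F g.1)) :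
    orderOf g = 2 * r := by
  have hX : (2 : F[X]) = 0 := CharTwo.two_eq_zero
  have hch : minpoly F g.1 = g.1.charpoly := by
    refine (eq_of_monic_of_dvd_of_natDegree_le (minpoly.monic (Algebra.IsIntegral.isIntegral _))
      (charpoly_monic _) (minpoly_dvd_charpoly _) ?_).symm
    rw [hP, charpoly_natDegree_eq_dim, (palindromicQuadratic_monic w).natDegree_mul
      (palindromicQuadratic_monic y), palindromicQuadratic_natDegree, palindromicQuadratic_natDegree]
    simp
  have h1 : g ^ (2 * r) = 1 := by
    refine pow_eq_one_of_dvd (minpoly.aeval F g.1) ((hd2.trans (mul_dvd_mul hd hd)).trans ?_)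
    refine dvd_of_eq ?_
    rw [mul_comm 2 r, pow_mul]
    linear_combination (1 - X ^ r) * hX
  have h2 : ∀ k, g ^ k = 1 → r ∣ k := by
    intro k hk
    rw [← ha, orderOf_dvd_iff_pow_eq_one]
    have h3 := aeval_eq_zero_of_isRoot_charpoly (g := g.1) (a := a) (p := X ^ k - 1) (by
      rw [← hch, hP, map_mul, (aeval_palindromicQuadratic_eq_zero_iff h0).mpr hy, mul_zero]) (by
      have := congrArg Subtype.val hk
      simp only [SubmonoidClass.coe_pow] at this
      simp [this])
    simpa [sub_eq_zero] using h3
  obtain ⟨k, hk⟩ := h2 _ (pow_orderOf_eq_one g)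
  have h4 := orderOf_dvd_iff_pow_eq_one.mpr h1
  rw [hk, mul_comm 2 r] at h4
  rcases (Nat.dvd_prime Nat.prime_two).mp (Nat.dvd_of_mul_dvd_mul_left hodd.pos h4) with h | h
  · rw [h, mul_one] at hk
    exact absurd ((squarefree_X_pow_sub_one (F := F) hodd).squarefree_of_dvd
      (minpoly_dvd_X_pow_sub_one (g := g) (hk ▸ pow_orderOf_eq_one g))) hns
  · rw [hk, h, mul_comm]

/-- An element has order `2r`, for suitable odd `r`, exactly if it has an eigenvalue of order `r`
and is regular but not semisimple. -/
theorem orderOf_eq_two_mul_iff [Finite F] [IsAlgClosed K] {r : ℕ} (hodd : Odd r) (hr1 : r ≠ 1)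
    (hfix : ∀ a : K, orderOf a ∣ r → (a + a⁻¹) ^ Nat.card F = a + a⁻¹)
    (g : symplecticGroup (Fin 2) F) :
    orderOf g = 2 * r ↔
      (∃ a : K, orderOf a = r ∧ ∃ y, algebraMap F K y = a + a⁻¹ ∧
        minpoly F g.1 = palindromicQuadratic y * palindromicQuadratic y) ∨
      (∃ a : K, orderOf a = r ∧ ∃ y, algebraMap F K y = a + a⁻¹ ∧
        minpoly F g.1 = palindromicQuadratic 0 * palindromicQuadratic y) := by
  have hyne : ∀ (a : K) (y : F), orderOf a = r → algebraMap F K y = a + a⁻¹ → a ≠ 0 ∧ y ≠ 0 := by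
    intro a y ha hy
    have h0 := ne_zero_of_odd_orderOf (ha ▸ hodd)
    refine ⟨h0, ?_⟩
    rintro rfl
    rw [map_zero, eq_comm, add_inv_eq_zero_iff h0, ← orderOf_eq_one_iff, ha] at hy
    exact hr1 hy
  have hdvd : ∀ (a : K) (y : F), orderOf a = r → algebraMap F K y = a + a⁻¹ →
      palindromicQuadratic y ∣ X ^ r - 1 := by
    intro a y ha hy
    obtain ⟨h0, hy0⟩ := hyne a y ha hy
    have := aeval_X_pow_sub_one (F := F) ha.dvd
    exact palindromicQuadratic_dvd h0 hy0 hy this.1 this.2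
  constructor
  · intro hg
    have hnr : ¬ minpoly F g.1 ∣ X ^ r - 1 := by
      intro h
      have h1 := orderOf_dvd_iff_pow_eq_one.mpr (pow_eq_one_of_dvd (minpoly.aeval F g.1) h)
      rw [hg] at h1
      have := Nat.le_of_dvd hodd.pos h1
      have := hodd.pos
      omega
    have hord : ∀ x : K, x ^ (2 * r) = 1 → orderOf x ∣ r := by
      intro x hx
      rw [orderOf_dvd_iff_pow_eq_one, ← sub_eq_zero, ← pow_eq_zero_iff two_ne_zero]
      have h2 : (2 : K) = 0 := CharTwo.two_eq_zero
      rw [mul_comm, pow_mul] at hx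
      linear_combination hx + (1 - x ^ r) * h2
    have hlcm : ∀ p : K × K, IsEigenvaluePair g.1 p → (orderOf p.1).lcm (orderOf p.2) = r := by
      intro p hp
      have h1 := hp.pow_eq_one (hg ▸ pow_orderOf_eq_one g)
      refine Nat.dvd_antisymm (Nat.lcm_dvd (hord _ h1.1) (hord _ h1.2)) ?_
      have h2 := orderOf_dvd_iff_pow_eq_one.mpr (hp.pow_four_mul_eq_one
        (orderOf_dvd_iff_pow_eq_one.mp (Nat.dvd_lcm_left (orderOf p.1) (orderOf p.2)))
        (orderOf_dvd_iff_pow_eq_one.mp (Nat.dvd_lcm_right (orderOf p.1) (orderOf p.2))))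
      rw [hg, show 4 * (orderOf p.1).lcm (orderOf p.2) =
        2 * (2 * (orderOf p.1).lcm (orderOf p.2)) by ring] at h2
      exact hodd.coprime_two_right.dvd_of_dvd_mul_left (Nat.dvd_of_mul_dvd_mul_left two_pos h2)
    have hone : ∀ p : K × K, IsEigenvaluePair g.1 p → p.1 = 1 →
        ∃ a : K, orderOf a = r ∧ ∃ y, algebraMap F K y = a + a⁻¹ ∧
          minpoly F g.1 = palindromicQuadratic 0 * palindromicQuadratic y := by
      intro p hp e1
      have hl := hlcm p hp
      rw [e1, orderOf_one, Nat.lcm_one_left] at hl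
      obtain ⟨y, hy⟩ := exists_algebraMap_eq_of_pow_card_eq (hfix _ hl.dvd)
      obtain ⟨h0, hy0⟩ := hyne _ y hl hy
      have hc := hp.charpoly_eq (y := 0)
        (by rw [map_zero, eq_comm, add_inv_eq_zero_iff hp.1, e1]) hy
      have h3 := hp.aeval_eq_zero (minpoly.aeval F g.1)
      refine ⟨p.2, hl, y, hy, minpoly_eq_palindromicQuadratic_zero_mul
        (hc ▸ minpoly_dvd_charpoly g.1) (IsCoprime.mul_dvd ?_
          (palindromicQuadratic_dvd h0 hy0 hy h3.2.1 h3.2.2.2) ?_)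
        fun h => hnr (h.trans (palindromicQuadratic_mul_X_add_one_dvd hy0 (hdvd _ y hl hy)))⟩
      · have := isCoprime_palindromicQuadratic hy0
        rw [palindromicQuadratic_zero_eq_sq] at this
        exact (IsCoprime.pow_right_iff two_pos).mp this
      · have h4 := h3.1
        rw [e1, ← map_one (algebraMap F K), aeval_algebraMap_apply, map_eq_zero] at h4
        rw [show (X + 1 : F[X]) = X - C 1 by rw [C_1, CharTwo.sub_eq_add], dvd_iff_isRoot]
        exact h4
    obtain ⟨p, hp⟩ := exists_isEigenvaluePair (K := K) g
    by_cases e1 : p.1 = 1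
    · exact Or.inr (hone p hp e1)
    by_cases e2 : p.2 = 1
    · exact Or.inr (hone p.swap hp.swap e2)
    have hl := hlcm p hp
    have e3 : p.1 + p.1⁻¹ = p.2 + p.2⁻¹ := by
      by_contra h
      have hgen : GenericPair p := ⟨by rwa [ne_eq, add_inv_eq_zero_iff hp.1],
        by rwa [ne_eq, add_inv_eq_zero_iff hp.2.1], h⟩
      have h1 := hgen.orderOf_eq hp
      rw [hg, hl] at h1
      have := hodd.pos
      omega
    have hl1 : orderOf p.1 = r := by
      rw [← hl, eq_comm, Nat.lcm_eq_left_iff_dvd, orderOf_dvd_iff_pow_eq_one]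
      rcases (add_inv_eq_add_inv_iff hp.1 hp.2.1).mp e3 with h | h <;> simp [h, pow_orderOf_eq_one]
    obtain ⟨y, hy⟩ := exists_algebraMap_eq_of_pow_card_eq (hfix _ hl1.dvd)
    obtain ⟨h0, hy0⟩ := hyne _ y hl1 hy
    have hc := hp.charpoly_eq hy (hy.trans e3)
    have h3 := hp.aeval_eq_zero (minpoly.aeval F g.1)
    exact Or.inl ⟨p.1, hl1, y, hy, minpoly_eq_palindromicQuadratic_sq hy0
      (hc ▸ minpoly_dvd_charpoly g.1) (palindromicQuadratic_dvd h0 hy0 hy h3.1 h3.2.2.1)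
      fun h => hnr (h.trans (hdvd _ y hl1 hy))⟩
  · have hns : ∀ f h : F[X], f.natDegree ≠ 0 → ¬ Squarefree (f * f * h) := by
      intro f h hf hsq
      exact hf (natDegree_eq_zero_of_isUnit (hsq f (Dvd.intro h rfl)))
    rintro (⟨a, ha, y, hy, hP⟩ | ⟨a, ha, y, hy, hP⟩)
    · obtain ⟨h0, hy0⟩ := hyne a y ha hy
      refine orderOf_eq_two_mul_of_minpoly hodd ha h0 hy hP (hdvd a y ha hy) hP.dvd ?_
      rw [hP, ← mul_one (palindromicQuadratic y * palindromicQuadratic y)]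
      exact hns _ _ (by rw [palindromicQuadratic_natDegree]; norm_num)
    · obtain ⟨h0, hy0⟩ := hyne a y ha hy
      refine orderOf_eq_two_mul_of_minpoly hodd ha h0 hy hP
        (palindromicQuadratic_mul_X_add_one_dvd hy0 (hdvd a y ha hy)) ?_ ?_
      · rw [hP, palindromicQuadratic_zero_eq_sq]
        exact Dvd.intro (palindromicQuadratic y) (by ring)
      · rw [hP, palindromicQuadratic_zero_eq_sq, sq]
        exact hns _ _ (by rw [show (X + 1 : F[X]) = X + C 1 by simp, natDegree_X_add_C]; norm_num)

end

section
variable {F : Type*} [Field F] [CharP F 2] [Finite F]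

/-- The elements of order `2r` are the regular ones with an eigenvalue pair `(a, a)` or `(1, a)`,
for `a` of order `r`. -/
theorem card_orderOf_eq_two_mul_of_isSplittingSign {r : ℕ} (hodd : Odd r) (hr1 : r ≠ 1) {e : ℚ}
    (hfix : ∀ a : AlgebraicClosure F, orderOf a ∣ r → (a + a⁻¹) ^ Nat.card F = a + a⁻¹)
    (he : ∀ (a : AlgebraicClosure F) (y : F), orderOf a ∣ r → a ≠ 1 →
      algebraMap F (AlgebraicClosure F) y = a + a⁻¹ → y ≠ 0 ∧ IsSplittingSign y e) :
    (Nat.card {g : symplecticGroup (Fin 2) F // orderOf g = 2 * r} : ℚ) =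
      (r.totient : ℚ) * (Nat.card F : ℚ) ^ 3 * ((Nat.card F : ℚ) + e) *
        ((Nat.card F : ℚ) ^ 4 - 1) := by
  let K := AlgebraicClosure F
  have hane : ∀ a : K, orderOf a = r → a ≠ 1 := by
    rintro a ha rfl
    exact hr1 (by rw [← ha, orderOf_one])
  have h2 : (2 : F) = 0 := CharTwo.two_eq_zero
  have hqa := card_exists_orderOf_mul_two (F := F) (K := K) hodd hr1 (fun a ha => hfix a ha.dvd)
    (fun y g => minpoly F g.1 = palindromicQuadratic y * palindromicQuadratic y) (by
      intro y y' g h h'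
      rw [h, palindromicQuadratic_mul, palindromicQuadratic_mul] at h'
      have h3 := (palindromicQuartic_inj h').2
      rw [← sub_eq_zero, ← pow_eq_zero_iff two_ne_zero]
      linear_combination h3 + (y' * y' - y * y') * h2)
    (n := (Nat.card F : ℚ) ^ 3 * ((Nat.card F : ℚ) + e) * ((Nat.card F : ℚ) ^ 4 - 1)) (by
      intro y a ha hy
      obtain ⟨h1, h2⟩ := he a y ha.dvd (hane a ha) hy
      exact h2.card_minpoly_sq h1)
  have hqb := card_exists_orderOf_mul_two (F := F) (K := K) hodd hr1 (fun a ha => hfix a ha.dvd)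
    (fun y g => minpoly F g.1 = palindromicQuadratic 0 * palindromicQuadratic y) (by
      intro y y' g h h'
      rw [h, palindromicQuadratic_mul, palindromicQuadratic_mul] at h'
      simpa using (palindromicQuartic_inj h').1)
    (n := (Nat.card F : ℚ) ^ 3 * ((Nat.card F : ℚ) + e) * ((Nat.card F : ℚ) ^ 4 - 1)) (by
      intro y a ha hy
      obtain ⟨h1, h2⟩ := he a y ha.dvd (hane a ha) hy
      exact h2.card_minpoly_zero_mul h1)
  have hd1 : ∀ g : symplecticGroup (Fin 2) F,
      (∃ a : K, orderOf a = r ∧ ∃ y, algebraMap F K y = a + a⁻¹ ∧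
        minpoly F g.1 = palindromicQuadratic y * palindromicQuadratic y) →
      ¬ (∃ a : K, orderOf a = r ∧ ∃ y, algebraMap F K y = a + a⁻¹ ∧
        minpoly F g.1 = palindromicQuadratic 0 * palindromicQuadratic y) := by
    rintro g ⟨a, -, y, -, hQ⟩ ⟨a', ha', y', hy', hQ'⟩
    rw [hQ, palindromicQuadratic_mul, palindromicQuadratic_mul] at hQ'
    have h1 := (palindromicQuartic_inj hQ').1
    rw [CharTwo.add_self_eq_zero, zero_add] at h1
    exact (he a' y' ha'.dvd (hane a' ha') hy').1 h1.symm
  rw [Nat.card_congr (Equiv.subtypeEquivRight (orderOf_eq_two_mul_iff hodd hr1 hfix)),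
    Nat.card_subtype_or hd1, Nat.cast_add]
  linear_combination hqa / 2 + hqb / 2

/-- Roots of unity `a` of order dividing `q - 1` lie in `F`, so `X² + yX + 1` splits. -/
theorem isSplittingSign_of_dvd_sub_one {r : ℕ} (hr : r ∣ Nat.card F - 1) :
    (∀ a : AlgebraicClosure F, orderOf a ∣ r → (a + a⁻¹) ^ Nat.card F = a + a⁻¹) ∧
    ∀ (a : AlgebraicClosure F) (y : F), orderOf a ∣ r → a ≠ 1 →
      algebraMap F (AlgebraicClosure F) y = a + a⁻¹ → y ≠ 0 ∧ IsSplittingSign y 1 := by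
  have hq1 : 1 < Nat.card F := Finite.one_lt_card
  have hodd : Odd r := Odd.of_dvd_nat (Nat.Even.sub_odd hq1.le (even_natCard F) odd_one) hr
  have h : ∀ a : AlgebraicClosure F, orderOf a ∣ r → a ≠ 0 ∧ a ^ Nat.card F = a := by
    intro a ha
    have h0 := ne_zero_of_odd_orderOf (Odd.of_dvd_nat hodd ha)
    exact ⟨h0, (orderOf_dvd_sub_one_of_pow_eq h0 hq1.le).mp (ha.trans hr)⟩
  refine ⟨fun a ha => by rw [add_inv_pow_card, (h a ha).2], fun a y ha ha1 hy => ⟨?_, ?_⟩⟩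
  · rintro rfl
    rw [map_zero, eq_comm, add_inv_eq_zero_iff (h a ha).1] at hy
    exact ha1 hy
  · exact Or.inl ⟨rfl, exists_root_of_pow_card_eq (h a ha).1 (h a ha).2 hy⟩

/-- Roots of unity `a ≠ 1` of order dividing `q + 1` are not in `F` and have conjugate `a^q = a⁻¹`.
-/
theorem isSplittingSign_of_dvd_add_one {r : ℕ} (hr : r ∣ Nat.card F + 1) :
    (∀ a : AlgebraicClosure F, orderOf a ∣ r → (a + a⁻¹) ^ Nat.card F = a + a⁻¹) ∧
    ∀ (a : AlgebraicClosure F) (y : F), orderOf a ∣ r → a ≠ 1 →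
      algebraMap F (AlgebraicClosure F) y = a + a⁻¹ → y ≠ 0 ∧ IsSplittingSign y (-1) := by
  have hodd : Odd r := Odd.of_dvd_nat (even_natCard F).add_one hr
  have h : ∀ a : AlgebraicClosure F, orderOf a ∣ r → a ≠ 0 ∧ a ^ Nat.card F = a⁻¹ := by
    intro a ha
    have h0 := ne_zero_of_odd_orderOf (Odd.of_dvd_nat hodd ha)
    exact ⟨h0, (orderOf_dvd_add_one_of_pow_eq h0).mp (ha.trans hr)⟩
  refine ⟨fun a ha => by rw [add_inv_pow_card, (h a ha).2, inv_inv, add_comm],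
    fun a y ha ha1 hy => ?_⟩
  have hy0 : y ≠ 0 := by
    rintro rfl
    rw [map_zero, eq_comm, add_inv_eq_zero_iff (h a ha).1] at hy
    exact ha1 hy
  exact ⟨hy0, Or.inr ⟨rfl, no_root_of_pow_card_eq_inv (h a ha).1 (h a ha).2 hy hy0⟩⟩

end

/-! ### Passage to the projective group -/

section
variable {F : Type*} [Field F] [CharP F 2]

/-- A central element commutes with all transvections, hence acts on every vector as a scalar; the
scalar preserves the form, so its square is `1`. -/
theorem center_symplecticGroup_eq_bot :
    Subgroup.center (symplecticGroup (Fin 2) F) = ⊥ := by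
  rw [eq_bot_iff]
  intro g hg
  rw [Subgroup.mem_center_iff] at hg
  rw [Subgroup.mem_bot]
  have key : ∀ m, g.1 *ᵥ m = m := by
    intro m
    rcases eq_or_ne m 0 with rfl | hm
    · exact mulVec_zero _
    obtain ⟨x, hx⟩ := exists_symplForm_eq_one hm
    rw [symplForm_comm] at hx
    have h1 : transvectionMatrix m * g.1 = g.1 * transvectionMatrix m :=
      congrArg Subtype.val (hg ⟨transvectionMatrix m, transvectionMatrix_mem m⟩)
    have h2 := congrArg (fun M => M *ᵥ x) h1
    simp only [← mulVec_mulVec, transvectionMatrix_mulVec, mulVec_add, hx, one_smul]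
      at h2
    have h3 : g.1 *ᵥ m = symplForm m (g.1 *ᵥ x) • m := (add_left_cancel h2).symm
    set c := symplForm m (g.1 *ᵥ x) with hc
    have h4 := symplForm_mulVec g m x
    rw [h3, symplForm_smul_left, ← hc, hx] at h4
    have h5 : c = 1 := by
      have h6 : (c - 1) ^ 2 = 0 := by
        have h2 : (2 : F) = 0 := CharTwo.two_eq_zero
        linear_combination h4 + (1 - c) * h2
      exact sub_eq_zero.mp (pow_eq_zero_iff two_ne_zero |>.mp h6)
    rw [h3, h5, one_smul]
  exact Subtype.ext (ext_mulVec_single ((key _).trans (one_mulVec _).symm)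
    ((key _).trans (one_mulVec _).symm) ((key _).trans (one_mulVec _).symm)
    ((key _).trans (one_mulVec _).symm))

/-- In characteristic two `PSp₄(q)` is `Sp₄(q)`. -/
theorem numElementsOfOrder_PSp4 (n : ℕ) :
    numElementsOfOrder (PSp4 F) n = Nat.card {g : symplecticGroup (Fin 2) F // orderOf g = n} := by
  let e : PSp4 F ≃* symplecticGroup (Fin 2) F :=
    (QuotientGroup.quotientMulEquivOfEq center_symplecticGroup_eq_bot).trans QuotientGroup.quotientBot
  exact Nat.card_congr (e.toEquiv.subtypeEquiv fun g => by
    rw [show e.toEquiv g = e g from rfl, e.orderOf_eq])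

variable [Finite F]

theorem card_orderOf_eq_two :
    (Nat.card {g : symplecticGroup (Fin 2) F // orderOf g = 2} : ℚ) =
      ((Nat.card F : ℚ) ^ 2 + 1) * ((Nat.card F : ℚ) ^ 4 - 1) := by
  rw [← card_involutions]
  congr 1
  refine Nat.card_congr (Equiv.subtypeEquivRight fun g => ?_)
  rw [orderOf_eq_prime_iff, sq, ← Subtype.val_inj, ← Subtype.val_inj.ne]
  rfl

theorem card_orderOf_eq_four :
    (Nat.card {g : symplecticGroup (Fin 2) F // orderOf g = 4} : ℚ) =
      (Nat.card F : ℚ) ^ 2 * ((Nat.card F : ℚ) ^ 2 - 1) * ((Nat.card F : ℚ) ^ 4 - 1) := by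
  rw [← card_order_four]
  congr 1
  refine Nat.card_congr (Equiv.subtypeEquivRight fun g => ?_)
  have hpow : ∀ k : ℕ, g.1 ^ k = 1 ↔ g ^ k = 1 := fun k => by
    rw [← SubmonoidClass.coe_pow, ← Subtype.val_inj]
    rfl
  rw [ne_eq, hpow, hpow]
  constructor
  · intro h
    refine ⟨h ▸ pow_orderOf_eq_one g, fun h2 => ?_⟩
    have := orderOf_dvd_iff_pow_eq_one.mpr h2
    rw [h] at this
    norm_num at this
  · rintro ⟨h4, h2⟩
    exact orderOf_eq_prime_pow (p := 2) (n := 1) (by rwa [pow_one]) h4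

end

theorem proposition3p3 (F : Type*) [Field F] [Finite F] (q f : ℕ)
    (hF : Nat.card F = q) (hqf : q = 2 ^ f) (hq : 2 < q) :
    ((numElementsOfOrder (PSp4 F) 2 : ℚ) = ((q : ℚ) ^ 2 + 1) * ((q : ℚ) ^ 4 - 1)) ∧
    ((numElementsOfOrder (PSp4 F) 4 : ℚ) =
      (q : ℚ) ^ 2 * ((q : ℚ) ^ 2 - 1) * ((q : ℚ) ^ 4 - 1)) ∧
    (∀ r : ℕ, r ≠ 1 → r ∣ q - 1 →
      (numElementsOfOrder (PSp4 F) r : ℚ) =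
        (Nat.totient r : ℚ) * (q : ℚ) ^ 3 * ((q : ℚ) ^ 2 + 1) * ((q : ℚ) + 1) *
          (1 - (q : ℚ) * ((q : ℚ) + 1) / 2 + (q : ℚ) * ((q : ℚ) + 1) / 8 * dedekindPsi r)) ∧
    (∀ r : ℕ, r ≠ 1 → r ∣ q + 1 →
      (numElementsOfOrder (PSp4 F) r : ℚ) =
        (Nat.totient r : ℚ) * (q : ℚ) ^ 3 * ((q : ℚ) ^ 2 + 1) * ((q : ℚ) - 1) *
          (1 - (q : ℚ) * ((q : ℚ) - 1) / 2 + (q : ℚ) * ((q : ℚ) - 1) / 8 * dedekindPsi r)) ∧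
    (∀ r : ℕ, r ≠ 1 → r ∣ q - 1 →
      (numElementsOfOrder (PSp4 F) (2 * r) : ℚ) =
        (Nat.totient r : ℚ) * (q : ℚ) ^ 3 * ((q : ℚ) + 1) * ((q : ℚ) ^ 4 - 1)) ∧
    (∀ r : ℕ, r ≠ 1 → r ∣ q + 1 →
      (numElementsOfOrder (PSp4 F) (2 * r) : ℚ) =
        (Nat.totient r : ℚ) * (q : ℚ) ^ 3 * ((q : ℚ) - 1) * ((q : ℚ) ^ 4 - 1)) ∧
    (∀ r s : ℕ, r ≠ 1 → r ∣ q - 1 → s ≠ 1 → s ∣ q + 1 →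
      (numElementsOfOrder (PSp4 F) (r * s) : ℚ) =
        1 / 2 * (Nat.totient (r * s) : ℚ) * (q : ℚ) ^ 4 * ((q : ℚ) ^ 4 - 1)) ∧
    (∀ r : ℕ, r ≠ 1 → r ∣ q ^ 2 + 1 →
      (numElementsOfOrder (PSp4 F) r : ℚ) =
        1 / 4 * (Nat.totient r : ℚ) * (q : ℚ) ^ 4 * ((q : ℚ) ^ 2 - 1) ^ 2) := by
  subst hF
  have hchar : CharP F 2 := by
    have := Fintype.ofFinite F
    have hf : f ≠ 0 := by
      rintro rfl
      omega
    have h : ringChar F = 2 := by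
      rw [FiniteField.even_card_iff_char_two, ← Nat.card_eq_fintype_card, hqf, ← Nat.even_iff]
      exact (even_two).pow_of_ne_zero hf
    exact ringChar.of_eq h
  have hq1 : 1 < Nat.card F := Finite.one_lt_card
  have hodd1 : Odd (Nat.card F - 1) := Nat.Even.sub_odd hq1.le (even_natCard F) odd_one
  have hodd2 : Odd (Nat.card F + 1) := (even_natCard F).add_one
  simp only [numElementsOfOrder_PSp4]
  refine ⟨card_orderOf_eq_two, card_orderOf_eq_four, fun r hr1 hr => ?_, fun r hr1 hr => ?_,
    fun r hr1 hr => ?_, fun r hr1 hr => ?_, fun r s hr1 hr hs1 hs =>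
      card_orderOf_eq_of_dvd_sub_one_of_dvd_add_one hr1 hr hs1 hs, fun r hr1 hr =>
      card_orderOf_eq_of_dvd_sq_add_one hr1 hr⟩
  · obtain ⟨h1, h2⟩ := isSplittingSign_of_dvd_sub_one hr
    exact card_orderOf_eq_of_isSplittingSign (Odd.of_dvd_nat hodd1 hr) hr1 h1 h2
  · obtain ⟨h1, h2⟩ := isSplittingSign_of_dvd_add_one hr
    rw [card_orderOf_eq_of_isSplittingSign (Odd.of_dvd_nat hodd2 hr) hr1 h1 h2]
    ring
  · obtain ⟨h1, h2⟩ := isSplittingSign_of_dvd_sub_one hr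
    exact card_orderOf_eq_two_mul_of_isSplittingSign (Odd.of_dvd_nat hodd1 hr) hr1 h1 h2
  · obtain ⟨h1, h2⟩ := isSplittingSign_of_dvd_add_one hr
    rw [card_orderOf_eq_two_mul_of_isSplittingSign (Odd.of_dvd_nat hodd2 hr) hr1 h1 h2]
    ring
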